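/- A rooted tree $T$ on $n\ge 1$ nodes is given by its parent array, together with a real threshold $w_0$ and, for each node $i$, a real weight $w_i$ with $0\le w_i\le w_0$ and a real cost $s_i$. A chain is a path of $T$ such that, of any two nodes on it, one is an ancestor of the other. The sum-of-max chain partition problem asks for a partition of the nodes of $T$ into disjoint chains $C_1,\dots,C_k$ ($k$ arbitrary) with $\sum_{j\in C_i} w_j\le w_0$ for every $i$ such that $\sum_{i=1}^k \max_{j\in C_i}s_j$ is minimum. Theorem. The sum-of-max chain partition problem can be solved in $O(n\log n)$ time. That is, there are a single random access machine program and a function $t:\mathbb N\to\mathbb N$ with $t(n)=O(n\log n)$ such that, on every instance with $n$ nodes, the program halts after at most $t(n)$ steps and outputs an optimal chain partition together with its cost. (The machine has cells for natural numbers and cells for real numbers with indirect addressing; its unit-cost operations are reading and writing cells, successor, predecessor and comparison of natural numbers, and addition, subtraction and comparison of real numbers.) -/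

import Mathlib

/-! ## Rooted trees, chains and chain partitions -/

/-- A rooted tree on the nodes `0, …, n - 1`, given by its parent function. The root is recorded
as its own parent, and every node reaches the root by iterating `parent`. -/
structure NodeTree (n : ℕ) where
  root : Fin n
  parent : Fin n → Fin n
  parent_root : parent root = root
  reaches_root : ∀ v, ∃ k, parent^[k] v = root

namespace NodeTree

variable {n : ℕ} (T : NodeTree n)

/-- `u` is an ancestor of `v` (every node is an ancestor of itself). -/
def IsAncestor (u v : Fin n) : Prop := ∃ k, T.parent^[k] v = u

/-- The underlying undirected graph: the edges are the pairs of a non-root node and its parent. -/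
def graph : SimpleGraph (Fin n) := SimpleGraph.fromRel fun u v => T.parent u = v

/-- A chain is (the vertex set of) a path of the tree such that of any two nodes on the path one is
an ancestor of the other. -/
def IsChain (C : Finset (Fin n)) : Prop :=
  (∃ (a b : Fin n) (p : T.graph.Walk a b), p.IsPath ∧ ∀ v, v ∈ C ↔ v ∈ p.support) ∧
    ∀ u ∈ C, ∀ v ∈ C, T.IsAncestor u v ∨ T.IsAncestor v u

/-- A partition of the nodes into chains, each of total weight at most `w₀`. -/
def IsChainPartition (w : Fin n → ℝ) (w₀ : ℝ)
    (P : Finpartition (Finset.univ : Finset (Fin n))) : Prop :=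
  ∀ C ∈ P.parts, T.IsChain C ∧ ∑ i ∈ C, w i ≤ w₀

end NodeTree

/-- The sum, over the parts of the partition, of the largest `s i` in the part. -/
noncomputable def sumOfMax {n : ℕ} (s : Fin n → ℝ)
    (P : Finpartition (Finset.univ : Finset (Fin n))) : ℝ :=
  ∑ C ∈ P.parts.attach, C.1.sup' (P.nonempty_of_mem_parts C.2) s

/-- `P` is an optimal solution of the sum-of-max chain partition problem. -/
def IsOptimalPartition {n : ℕ} (T : NodeTree n) (w s : Fin n → ℝ) (w₀ : ℝ)
    (P : Finpartition (Finset.univ : Finset (Fin n))) : Prop :=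
  T.IsChainPartition w w₀ P ∧ ∀ Q, T.IsChainPartition w w₀ Q → sumOfMax s P ≤ sumOfMax s Q

/-! ## The machine: a random access machine with integer and real cells

A program is a finite piece of code that refers to finitely many variables and arrays, each of
them holding natural numbers or real numbers. Array cells are accessed indirectly, through a
computed natural-number index. The arithmetic on natural numbers is only successor, predecessor and
comparison, so in `t` steps every natural number stays at most (largest input number or
constant) `+ t` and fits in a machine word of `O(log (n + t))` bits. On real numbers there are
addition, subtraction and comparison; there is no multiplication, no rounding and no conversion
between the two sorts. Every elementary operation costs one step. -/

namespace RAM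

/-- Contents of the memory. Variables and arrays are named by natural numbers. -/
structure State where
  /-- natural-number variables -/
  nvar : ℕ → ℕ
  /-- real variables -/
  rvar : ℕ → ℝ
  /-- natural-number arrays: array name, then index -/
  narr : ℕ → ℕ → ℕ
  /-- real arrays: array name, then index -/
  rarr : ℕ → ℕ → ℝ

/-- Natural-number expressions. -/
inductive NExpr where
  | const (c : ℕ)
  | var (x : ℕ)
  | get (a : ℕ) (i : NExpr)
  | succ (e : NExpr)
  | pred (e : NExpr)

/-- Real expressions. -/
inductive RExpr where
  | zero
  | var (x : ℕ)
  | get (a : ℕ) (i : NExpr)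
  | add (e f : RExpr)
  | sub (e f : RExpr)

/-- Tests. -/
inductive Test where
  | eqN (e f : NExpr)
  | leN (e f : NExpr)
  | leR (e f : RExpr)
  | not (b : Test)
  | and (b c : Test)

/-- Programs. -/
inductive Prog where
  | skip
  | setN (x : ℕ) (e : NExpr)
  | setR (x : ℕ) (e : RExpr)
  | putN (a : ℕ) (i e : NExpr)
  | putR (a : ℕ) (i : NExpr) (e : RExpr)
  | seq (p q : Prog)
  | ite (b : Test) (p q : Prog)
  | loop (b : Test) (p : Prog)

/-- Value of a natural-number expression (the predecessor of `0` is `0`). -/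
def NExpr.eval (σ : State) : NExpr → ℕ
  | const c => c
  | var x => σ.nvar x
  | get a i => σ.narr a (i.eval σ)
  | succ e => e.eval σ + 1
  | pred e => e.eval σ - 1

/-- Value of a real expression. -/
noncomputable def RExpr.eval (σ : State) : RExpr → ℝ
  | zero => 0
  | var x => σ.rvar x
  | get a i => σ.rarr a (i.eval σ)
  | add e f => e.eval σ + f.eval σ
  | sub e f => e.eval σ - f.eval σ

/-- Truth of a test: equality or `≤` of natural numbers, `≤` of real numbers, and Boolean
combinations. -/
def Test.Holds (σ : State) : Test → Prop
  | eqN e f => e.eval σ = f.eval σ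
  | leN e f => e.eval σ ≤ f.eval σ
  | leR e f => e.eval σ ≤ f.eval σ
  | not b => ¬ b.Holds σ
  | and b c => b.Holds σ ∧ c.Holds σ

/-- Number of steps to evaluate a natural-number expression. -/
def NExpr.cost : NExpr → ℕ
  | const _ => 1
  | var _ => 1
  | get _ i => i.cost + 1
  | succ e => e.cost + 1
  | pred e => e.cost + 1

/-- Number of steps to evaluate a real expression. -/
def RExpr.cost : RExpr → ℕ
  | zero => 1
  | var _ => 1
  | get _ i => i.cost + 1
  | add e f => e.cost + f.cost + 1
  | sub e f => e.cost + f.cost + 1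

/-- Number of steps to evaluate a test. -/
def Test.cost : Test → ℕ
  | eqN e f => e.cost + f.cost + 1
  | leN e f => e.cost + f.cost + 1
  | leR e f => e.cost + f.cost + 1
  | not b => b.cost + 1
  | and b c => b.cost + c.cost + 1

namespace State

/-- Write a natural-number variable. -/
def setN (σ : State) (x v : ℕ) : State :=
  { σ with nvar := Function.update σ.nvar x v }

/-- Write a real variable. -/
noncomputable def setR (σ : State) (x : ℕ) (v : ℝ) : State :=
  { σ with rvar := Function.update σ.rvar x v }

/-- Write a cell of a natural-number array. -/
def putN (σ : State) (a i v : ℕ) : State :=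
  { σ with narr := Function.update σ.narr a (Function.update (σ.narr a) i v) }

/-- Write a cell of a real array. -/
noncomputable def putR (σ : State) (a i : ℕ) (v : ℝ) : State :=
  { σ with rarr := Function.update σ.rarr a (Function.update (σ.rarr a) i v) }

end State

/-- `Exec p σ t τ`: started in the memory `σ`, the program `p` halts after exactly `t` steps with
the memory `τ`. -/
inductive Exec : Prog → State → ℕ → State → Prop where
  | skip (σ : State) : Exec .skip σ 1 σ
  | setN (σ : State) (x : ℕ) (e : NExpr) :
      Exec (.setN x e) σ (e.cost + 1) (σ.setN x (e.eval σ))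
  | setR (σ : State) (x : ℕ) (e : RExpr) :
      Exec (.setR x e) σ (e.cost + 1) (σ.setR x (e.eval σ))
  | putN (σ : State) (a : ℕ) (i e : NExpr) :
      Exec (.putN a i e) σ (i.cost + e.cost + 1) (σ.putN a (i.eval σ) (e.eval σ))
  | putR (σ : State) (a : ℕ) (i : NExpr) (e : RExpr) :
      Exec (.putR a i e) σ (i.cost + e.cost + 1) (σ.putR a (i.eval σ) (e.eval σ))
  | seq {p q : Prog} {σ τ υ : State} {t u : ℕ} :
      Exec p σ t τ → Exec q τ u υ → Exec (.seq p q) σ (t + u) υ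
  | ite_true {b : Test} {p q : Prog} {σ τ : State} {t : ℕ} :
      b.Holds σ → Exec p σ t τ → Exec (.ite b p q) σ (b.cost + 1 + t) τ
  | ite_false {b : Test} {p q : Prog} {σ τ : State} {t : ℕ} :
      ¬ b.Holds σ → Exec q σ t τ → Exec (.ite b p q) σ (b.cost + 1 + t) τ
  | loop_true {b : Test} {p : Prog} {σ τ υ : State} {t u : ℕ} :
      b.Holds σ → Exec p σ t τ → Exec (.loop b p) τ u υ →
        Exec (.loop b p) σ (b.cost + 1 + t + u) υ
  | loop_false {b : Test} {p : Prog} {σ : State} :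
      ¬ b.Holds σ → Exec (.loop b p) σ (b.cost + 1) σ

/-- The memory at the start of a computation. Natural-number variable `0` holds the number of nodes
and natural-number array `0` the parent of each node (the root being its own parent); real
variable `0` holds the threshold, real array `0` the weights and real array `1` the costs. All other
cells are zero. -/
noncomputable def input {n : ℕ} (T : NodeTree n) (w s : Fin n → ℝ) (w₀ : ℝ) : State where
  nvar x := if x = 0 then n else 0
  rvar x := if x = 0 then w₀ else 0
  narr a i := if h : i < n then (if a = 0 then (T.parent ⟨i, h⟩ : ℕ) else 0) else 0
  rarr a i := if h : i < n then
    (if a = 0 then w ⟨i, h⟩ else if a = 1 then s ⟨i, h⟩ else 0) else 0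

/-- The final memory `τ` describes the partition `P` and the value `c`: the entries of
natural-number array `1` are equal at two nodes exactly if the nodes lie in the same part of `P`,
and real variable `1` holds `c`. -/
def Outputs {n : ℕ} (τ : State) (P : Finpartition (Finset.univ : Finset (Fin n))) (c : ℝ) : Prop :=
  (∀ i j : Fin n, τ.narr 1 i = τ.narr 1 j ↔ P.part i = P.part j) ∧ τ.rvar 1 = c

/-- The program solves the sum-of-max chain partition problem within `t n` steps on `n`-node trees:
for all non-negative weights that do not exceed the threshold, and all costs, it halts within that
time with an optimal chain partition and its cost. -/
def SolvesInTime (p : Prog) (t : ℕ → ℕ) : Prop :=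
  ∀ (n : ℕ) (T : NodeTree n) (w s : Fin n → ℝ) (w₀ : ℝ),
    (∀ i, 0 ≤ w i) → (∀ i, w i ≤ w₀) →
    ∃ (k : ℕ) (τ : State) (P : Finpartition (Finset.univ : Finset (Fin n))),
      k ≤ t n ∧ Exec p (input T w s w₀) k τ ∧
        IsOptimalPartition T w s w₀ P ∧ Outputs τ P (sumOfMax s P)

end RAM

/-! Call a path light if its weight is at most `w₀`. Treat children before parents and let E(v) be
the minimum, over all light paths from `v` down to a descendant `u`, of the largest cost on the path
minus the values E of its nodes other than `v`; let ch(v) be a minimising `u`. Then the values of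
any light path sum to at most its largest cost, with equality on the path from `v` to ch(v)
(`PathCert`). This is linear programming duality. Every admissible chain is a light path, so summing
over its parts shows that each partition costs at least the sum of all E (`sum_le_sumOfMax`).
Conversely, going from the root to the leaves and cutting off the path from `v` to ch(v) at each
node `v` not yet covered gives disjoint tight paths (`Labelled.unlabelled`), hence a partition of
exactly that cost (`isOptimal_labelPartition`).

To compute E quickly, each untreated node `r` owns a component: `r` and the nodes below it that are
separated from `r` only by treated nodes. The treated nodes `u` of the component are the candidates.
They are grouped by the largest cost on the treated part of their path; a group is named by a node
with that cost. Treating `v` fuses all groups of cost at most `s v` into one of cost `s v` and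
leaves the others alone, so a heap `M` of groups ordered by cost suffices. A heap `I x` orders the
candidates of group `x` by key, and a heap `O` orders the groups by their best value, cost plus
smallest key. The top of `O` gives E(v), once fused groups and heavy candidates have been discarded.
Discarding is final, because weights are non-negative and paths only grow.

The key of `u` plus an offset of the component is minus the sum of E over the treated part of the
path. Fixing E(v) therefore changes a single offset. When the component of `v` is joined to that of
its parent, the offsets are made equal by rekeying the component with fewer nodes.

Time is handled by the logic `WP`, whose postconditions see the unspent steps, so that amortised
bounds become part of loop invariants. Leftist heaps meld in logarithmic time. Each node enters each
of the three families of heaps once and carries credit for its later removal (`heapCredit`);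
`listPot` pays for the rekeying, O(n log n) in total (`mul_log_add_le`). Sorting, path weights and
labelling are linear. -/

set_option linter.unusedSimpArgs false

/-! ## A program logic with time credits -/

namespace RAM

infixr:60 ";;" => Prog.seq

/-- Started in `σ`, the program `p` halts in some `τ` with `Q τ c'`, where `c'` is what is left of
the `c` steps that are allowed. -/
def WP (p : Prog) (Q : State → ℕ → Prop) (σ : State) (c : ℕ) : Prop :=
  ∃ (t : ℕ) (τ : State) (c' : ℕ), Exec p σ t τ ∧ t + c' ≤ c ∧ Q τ c'

namespace WP

variable {p q : Prog} {b : Test} {Q Q' : State → ℕ → Prop} {σ : State} {c d : ℕ}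

theorem mono (h : WP p Q σ c) (hQ : ∀ τ c', Q τ c' → Q' τ c') : WP p Q' σ c := by
  obtain ⟨t, τ, c', h1, h2, h3⟩ := h
  exact ⟨t, τ, c', h1, h2, hQ _ _ h3⟩

theorem seq (h : WP p (fun τ c' => WP q Q τ c') σ c) : WP (p ;; q) Q σ c := by
  obtain ⟨t, τ, c', h1, h2, u, υ, c'', h3, h4, h5⟩ := h
  exact ⟨t + u, υ, c'', .seq h1 h3, by omega, h5⟩

theorem ite_true (hb : b.Holds σ) (hc : b.cost + 1 + d ≤ c) (h : WP p Q σ d) :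
    WP (.ite b p q) Q σ c := by
  obtain ⟨t, τ, c', h1, h2, h3⟩ := h
  exact ⟨_, τ, c', .ite_true hb h1, by omega, h3⟩

theorem ite_false (hb : ¬ b.Holds σ) (hc : b.cost + 1 + d ≤ c) (h : WP q Q σ d) :
    WP (.ite b p q) Q σ c := by
  obtain ⟨t, τ, c', h1, h2, h3⟩ := h
  exact ⟨_, τ, c', .ite_false hb h1, by omega, h3⟩

/-- The loop rule. No variant is needed: every iteration uses up a step. -/
theorem loop (I : State → ℕ → Prop)
    (hI : ∀ σ c, I σ c →
      (b.Holds σ ∧ ∃ d, b.cost + 1 + d ≤ c ∧ WP p I σ d) ∨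
      (¬ b.Holds σ ∧ ∃ d, b.cost + 1 + d ≤ c ∧ Q σ d))
    (h : I σ c) : WP (.loop b p) Q σ c := by
  induction c using Nat.strong_induction_on generalizing σ with
  | _ c ih =>
    rcases hI σ c h with ⟨hb, d, hd, t, τ, c', h1, h2, h3⟩ | ⟨hb, d, hd, hQ⟩
    · obtain ⟨u, υ, c'', h4, h5, h6⟩ := ih c' (by omega) h3
      exact ⟨_, υ, c'', .loop_true hb h1 h4, by omega, h6⟩
    · exact ⟨_, σ, d, .loop_false hb, by omega, hQ⟩

end WP

/-- Programs without loops. -/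
def Prog.Straight : Prog → Prop
  | .seq p q => p.Straight ∧ q.Straight
  | .ite _ p q => p.Straight ∧ q.Straight
  | .loop _ _ => False
  | _ => True

/-- The largest number of steps of a loop-free program. -/
def Prog.steps : Prog → ℕ
  | .skip => 1
  | .setN _ e => e.cost + 1
  | .setR _ e => e.cost + 1
  | .putN _ i e => i.cost + e.cost + 1
  | .putR _ i e => i.cost + e.cost + 1
  | .seq p q => p.steps + q.steps
  | .ite b p q => b.cost + 1 + max p.steps q.steps
  | .loop _ _ => 0

open Classical in
/-- The final memory of a loop-free program. -/
noncomputable def Prog.run : Prog → State → State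
  | .skip, σ => σ
  | .setN x e, σ => σ.setN x (e.eval σ)
  | .setR x e, σ => σ.setR x (e.eval σ)
  | .putN a i e, σ => σ.putN a (i.eval σ) (e.eval σ)
  | .putR a i e, σ => σ.putR a (i.eval σ) (e.eval σ)
  | .seq p q, σ => q.run (p.run σ)
  | .ite b p q, σ => if b.Holds σ then p.run σ else q.run σ
  | .loop _ _, σ => σ

theorem exec_run (p : Prog) (hp : p.Straight) (σ : State) :
    ∃ t ≤ p.steps, Exec p σ t (p.run σ) := by
  induction p generalizing σ with
  | skip => exact ⟨_, le_rfl, .skip σ⟩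
  | setN x e => exact ⟨_, le_rfl, .setN σ x e⟩
  | setR x e => exact ⟨_, le_rfl, .setR σ x e⟩
  | putN a i e => exact ⟨_, le_rfl, .putN σ a i e⟩
  | putR a i e => exact ⟨_, le_rfl, .putR σ a i e⟩
  | seq p q ihp ihq =>
    obtain ⟨t, ht, h1⟩ := ihp hp.1 σ
    obtain ⟨u, hu, h2⟩ := ihq hp.2 (p.run σ)
    exact ⟨t + u, Nat.add_le_add ht hu, .seq h1 h2⟩
  | ite b p q ihp ihq =>
    by_cases hb : b.Holds σ
    · obtain ⟨t, ht, h1⟩ := ihp hp.1 σ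
      refine ⟨_, ?_, by simpa [Prog.run, hb] using Exec.ite_true (q := q) hb h1⟩
      simp only [Prog.steps]; omega
    · obtain ⟨t, ht, h1⟩ := ihq hp.2 σ
      refine ⟨_, ?_, by simpa [Prog.run, hb] using Exec.ite_false (p := p) hb h1⟩
      simp only [Prog.steps]; omega
  | loop b p _ => exact hp.elim

/-- Reduces a loop-free program to two calculations: `simp` executes `run` symbolically and `omega`
compares `steps` with the budget. A conditional is charged at its longer branch, and `d` is the
credit handed on. -/
theorem WP.block {p : Prog} {Q : State → ℕ → Prop} {σ : State} {c : ℕ} (hp : p.Straight) (d : ℕ)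
    (hc : p.steps + d ≤ c) (h : Q (p.run σ) d) : WP p Q σ c := by
  obtain ⟨t, ht, h1⟩ := exec_run p hp σ
  exact ⟨t, _, d, h1, by omega, h⟩

namespace State

variable (σ : State) (x y a b i : ℕ) (v : ℕ) (z : ℝ)

@[simp] theorem nvar_setN : (σ.setN x v).nvar y = if y = x then v else σ.nvar y := by
  simp [setN, Function.update_apply]
@[simp] theorem rvar_setN : (σ.setN x v).rvar = σ.rvar := rfl
@[simp] theorem narr_setN : (σ.setN x v).narr = σ.narr := rfl
@[simp] theorem rarr_setN : (σ.setN x v).rarr = σ.rarr := rfl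
@[simp] theorem nvar_setR : (σ.setR x z).nvar = σ.nvar := rfl
@[simp] theorem rvar_setR : (σ.setR x z).rvar y = if y = x then z else σ.rvar y := by
  simp [setR, Function.update_apply]
@[simp] theorem narr_setR : (σ.setR x z).narr = σ.narr := rfl
@[simp] theorem rarr_setR : (σ.setR x z).rarr = σ.rarr := rfl
@[simp] theorem nvar_putN : (σ.putN a i v).nvar = σ.nvar := rfl
@[simp] theorem rvar_putN : (σ.putN a i v).rvar = σ.rvar := rfl
@[simp] theorem narr_putN : (σ.putN a i v).narr b =
    if b = a then Function.update (σ.narr a) i v else σ.narr b := by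
  simp [putN, Function.update_apply]
@[simp] theorem rarr_putN : (σ.putN a i v).rarr = σ.rarr := rfl
@[simp] theorem nvar_putR : (σ.putR a i z).nvar = σ.nvar := rfl
@[simp] theorem rvar_putR : (σ.putR a i z).rvar = σ.rvar := rfl
@[simp] theorem narr_putR : (σ.putR a i z).narr = σ.narr := rfl
@[simp] theorem rarr_putR : (σ.putR a i z).rarr b =
    if b = a then Function.update (σ.rarr a) i z else σ.rarr b := by
  simp [putR, Function.update_apply]

end State

attribute [simp] Prog.Straight Prog.run Prog.steps NExpr.eval RExpr.eval Test.Holds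
  NExpr.cost RExpr.cost Test.cost

end RAM

/-! ## Leftist heaps -/

/-- Binary trees whose nodes are labelled by natural numbers. -/
inductive HTree where
  | nil
  | node (l : HTree) (x : ℕ) (r : HTree)

namespace HTree

/-- The length of the right spine. -/
def rk : HTree → ℕ
  | nil => 0
  | node _ _ r => r.rk + 1

/-- The labels of the nodes. -/
def nodes : HTree → List ℕ
  | nil => []
  | node l x r => x :: (l.nodes ++ r.nodes)

/-- At every node, the right spine of the left subtree is at least as long as that of the right
subtree. -/
def Leftist : HTree → Prop
  | nil => True
  | node l _ r => r.rk ≤ l.rk ∧ l.Leftist ∧ r.Leftist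

/-- Heap order with respect to `key`. -/
def Ord (key : ℕ → ℝ) : HTree → Prop
  | nil => True
  | node l x r => (∀ y ∈ l.nodes ++ r.nodes, key x ≤ key y) ∧ l.Ord key ∧ r.Ord key

/-- Join two trees below a node, the one with the longer right spine to the left. -/
def join (l : HTree) (x : ℕ) (r : HTree) : HTree :=
  if r.rk ≤ l.rk then node l x r else node r x l

open Classical in
/-- The union of two leftist heaps. -/
noncomputable def meld (key : ℕ → ℝ) : HTree → HTree → HTree
  | nil, b => b
  | node l x r, nil => node l x r
  | node l x r, node l' y r' =>
    if key x ≤ key y then join l x (meld key r (node l' y r'))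
    -- The arguments change places, as in `meldDown`, which exchanges the two addresses so that it
    -- always descends from variable `1`.
    else join l' y (meld key r' (node l x r))
termination_by a b => a.nodes.length + b.nodes.length
decreasing_by all_goals simp [nodes] <;> omega

@[simp] theorem nil_meld (key : ℕ → ℝ) (b : HTree) : meld key nil b = b := by
  rw [meld]

@[simp] theorem meld_nil (key : ℕ → ℝ) (a : HTree) : meld key a nil = a := by
  cases a <;> rw [meld]

theorem meld_of_le {key : ℕ → ℝ} {l r l' r' : HTree} {x y : ℕ} (h : key x ≤ key y) :
    meld key (node l x r) (node l' y r') = join l x (meld key r (node l' y r')) := by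
  rw [meld, if_pos h]

theorem meld_of_not_le {key : ℕ → ℝ} {l r l' r' : HTree} {x y : ℕ} (h : ¬ key x ≤ key y) :
    meld key (node l x r) (node l' y r') = join l' y (meld key r' (node l x r)) := by
  rw [meld, if_neg h]

theorem nodes_join (l : HTree) (x : ℕ) (r : HTree) :
    (join l x r).nodes.Perm (x :: (l.nodes ++ r.nodes)) := by
  unfold join
  split_ifs
  · rfl
  · exact List.Perm.cons _ List.perm_append_comm

theorem leftist_join {l r : HTree} (x : ℕ) (hl : l.Leftist) (hr : r.Leftist) :
    (join l x r).Leftist := by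
  unfold join
  split_ifs with h
  · exact ⟨h, hl, hr⟩
  · exact ⟨by omega, hr, hl⟩

theorem ord_join {key : ℕ → ℝ} {l r : HTree} {x : ℕ} (hl : l.Ord key) (hr : r.Ord key)
    (hx : ∀ y ∈ l.nodes ++ r.nodes, key x ≤ key y) : (join l x r).Ord key := by
  unfold join
  split_ifs with h
  · exact ⟨hx, hl, hr⟩
  · exact ⟨fun y hy => hx y (by simp at hy ⊢; tauto), hr, hl⟩

theorem nodes_meld (key : ℕ → ℝ) (a b : HTree) :
    (meld key a b).nodes.Perm (a.nodes ++ b.nodes) := by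
  induction a, b using meld.induct key with
  | case1 b => simp [nodes]
  | case2 l x r => simp [nodes]
  | case3 l x r l' y r' h ih =>
    rw [meld_of_le h]
    refine (nodes_join _ _ _).trans ?_
    simp only [nodes, List.cons_append, List.append_assoc] at ih ⊢
    exact List.Perm.cons _ (List.Perm.append_left _ ih)
  | case4 l x r l' y r' h ih =>
    rw [meld_of_not_le h]
    refine (nodes_join _ _ _).trans ?_
    refine (List.Perm.cons y (List.Perm.append_left _ ih)).trans ?_
    rw [← List.append_assoc, ← List.cons_append]
    exact List.perm_append_comm

theorem leftist_meld (key : ℕ → ℝ) {a b : HTree} (ha : a.Leftist) (hb : b.Leftist) :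
    (meld key a b).Leftist := by
  induction a, b using meld.induct key with
  | case1 b => simpa using hb
  | case2 l x r => simpa using ha
  | case3 l x r l' y r' h ih =>
    rw [meld_of_le h]
    exact leftist_join _ ha.2.1 (ih ha.2.2 hb)
  | case4 l x r l' y r' h ih =>
    rw [meld_of_not_le h]
    exact leftist_join _ hb.2.1 (ih hb.2.2 ha)

theorem mem_meld {key : ℕ → ℝ} {a b : HTree} {x : ℕ} :
    x ∈ (meld key a b).nodes ↔ x ∈ a.nodes ∨ x ∈ b.nodes := by
  rw [(nodes_meld key a b).mem_iff, List.mem_append]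

theorem ord_meld {key : ℕ → ℝ} {a b : HTree} (ha : a.Ord key) (hb : b.Ord key) :
    (meld key a b).Ord key := by
  induction a, b using meld.induct key with
  | case1 b => simpa using hb
  | case2 l x r => simpa using ha
  | case3 l x r l' y r' h ih =>
    rw [meld_of_le h]
    refine ord_join ha.2.1 (ih ha.2.2 hb) fun z hz => ?_
    have h1 := ha.1 z
    have h2 := hb.1 z
    simp only [List.mem_append, mem_meld, nodes, List.mem_cons] at hz h1 h2
    rcases hz with hz | hz | rfl | hz
    · exact h1 (.inl hz)
    · exact h1 (.inr hz)
    · exact h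
    · exact h.trans (h2 hz)
  | case4 l x r l' y r' h ih =>
    rw [meld_of_not_le h]
    have h' := le_of_not_ge h
    refine ord_join hb.2.1 (ih hb.2.2 ha) fun z hz => ?_
    have h1 := ha.1 z
    have h2 := hb.1 z
    simp only [List.mem_append, mem_meld, nodes, List.mem_cons] at hz h1 h2
    rcases hz with hz | hz | rfl | hz
    · exact h2 (.inl hz)
    · exact h2 (.inr hz)
    · exact h'
    · exact h'.trans (h1 hz)

/-- A leftist heap has a short right spine. -/
theorem two_pow_rk_le {t : HTree} (h : t.Leftist) : 2 ^ t.rk ≤ t.nodes.length + 1 := by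
  induction t with
  | nil => simp [rk, nodes]
  | node l x r ihl ihr =>
    have h1 := ihl h.2.1
    have h2 := ihr h.2.2
    -- The left subtree has the larger rank, so both subtrees have at least `2 ^ r.rk - 1` nodes.
    have h3 := Nat.pow_le_pow_right (n := 2) (by norm_num) h.1
    simp only [rk, nodes, List.length_cons, List.length_append, pow_succ]
    omega

/-- Heap order depends only on comparisons between nodes of the tree. It therefore survives a common
shift of these keys and any change of other keys. -/
theorem Ord.congr {key key' : ℕ → ℝ} {t : HTree} (h : t.Ord key)
    (hk : ∀ x ∈ t.nodes, ∀ y ∈ t.nodes, key x ≤ key y → key' x ≤ key' y) : t.Ord key' := by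
  induction t with
  | nil => trivial
  | node l x r ihl ihr =>
    refine ⟨fun y hy => hk _ (by simp [nodes]) _ (by simp [nodes] at hy ⊢; tauto) (h.1 y hy),
      ihl h.2.1 fun a ha b hb => hk _ (by simp [nodes, ha]) _ (by simp [nodes, hb]),
      ihr h.2.2 fun a ha b hb => hk _ (by simp [nodes, ha]) _ (by simp [nodes, hb])⟩

/-- The tree stored at the address `q` in the arrays of left and right children and of ranks, where
`e` is the address of the empty tree. -/
def Stored (L R K : ℕ → ℕ) (e : ℕ) : HTree → ℕ → Prop
  | nil, q => q = e
  | node l x r, q =>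
    q = x ∧ x ≠ e ∧ K x = r.rk + 1 ∧ Stored L R K e l (L x) ∧ Stored L R K e r (R x)

/-- A frame rule: only the cells of the heap's own nodes matter, so disjoint heaps can share the
arrays. -/
theorem Stored.congr {L R K L' R' K' : ℕ → ℕ} {e q : ℕ} {t : HTree} (h : Stored L R K e t q)
    (hL : ∀ x ∈ t.nodes, L' x = L x) (hR : ∀ x ∈ t.nodes, R' x = R x)
    (hK : ∀ x ∈ t.nodes, K' x = K x) : Stored L' R' K' e t q := by
  induction t generalizing q with
  | nil => exact h
  | node l x r ihl ihr =>
    simp only [nodes, List.mem_cons, List.mem_append] at hL hR hK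
    obtain ⟨rfl, h1, h2, h3, h4⟩ := h
    refine ⟨rfl, h1, by rw [hK _ (.inl rfl), h2], ?_, ?_⟩
    · rw [hL _ (.inl rfl)]
      exact ihl h3 (fun y hy => hL y (by tauto)) (fun y hy => hR y (by tauto))
        (fun y hy => hK y (by tauto))
    · rw [hR _ (.inl rfl)]
      exact ihr h4 (fun y hy => hL y (by tauto)) (fun y hy => hR y (by tauto))
        (fun y hy => hK y (by tauto))

/-- With rank `0` in the cell of the empty address, ranks can be compared without testing for
emptiness. -/
theorem Stored.rk_eq {L R K : ℕ → ℕ} {e q : ℕ} {t : HTree} (h : Stored L R K e t q) (hK : K e = 0) :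
    K q = t.rk := by
  cases t with
  | nil => rw [show q = e from h, hK, rk]
  | node l x r => obtain ⟨rfl, -, h2, -⟩ := h; exact h2

theorem Stored.eq_nil_iff {L R K : ℕ → ℕ} {e q : ℕ} {t : HTree} (h : Stored L R K e t q) :
    q = e ↔ t = nil := by
  cases t with
  | nil => exact iff_of_true h rfl
  | node l x r => obtain ⟨rfl, h2, -⟩ := h; simpa using h2

theorem Stored.exists_node {L R K : ℕ → ℕ} {e q : ℕ} {t : HTree} (h : Stored L R K e t q) (hq : q ≠ e) :
    ∃ l r, t = node l q r ∧ K q = r.rk + 1 ∧ Stored L R K e l (L q) ∧ Stored L R K e r (R q) := by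
  cases t with
  | nil => exact absurd h hq
  | node l x r => obtain ⟨rfl, h2, h3⟩ := h; exact ⟨l, r, rfl, h3⟩

/-- The tree obtained by joining the trees on a stack, one after the other, to a given one. -/
def plug : List (HTree × ℕ) → HTree → HTree
  | [], t => t
  | (l, x) :: fs, t => plug fs (join l x t)

/-- The nodes of the trees on a stack. -/
def stackNodes (fs : List (HTree × ℕ)) : List ℕ := fs.flatMap fun f => f.2 :: f.1.nodes

/-- The array `S` holds the nodes of a stack, whose left subtrees are stored in the arrays. -/
def StackStored (L R K S : ℕ → ℕ) (e : ℕ) : List (HTree × ℕ) → Prop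
  | [] => True
  | (l, x) :: fs => S fs.length = x ∧ x ≠ e ∧ Stored L R K e l (L x) ∧ StackStored L R K S e fs

/-- A frame rule for the stack, whose top is the head of the list. The right child and the rank of a
stacked node are not part of the invariant, since `meldUp` overwrites both. -/
theorem StackStored.congr {L R K S L' R' K' S' : ℕ → ℕ} {e : ℕ} {fs : List (HTree × ℕ)}
    (h : StackStored L R K S e fs)
    (hL : ∀ x ∈ stackNodes fs, L' x = L x) (hR : ∀ x ∈ stackNodes fs, R' x = R x)
    (hK : ∀ x ∈ stackNodes fs, K' x = K x) (hS : ∀ i < fs.length, S' i = S i) :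
    StackStored L' R' K' S' e fs := by
  induction fs with
  | nil => trivial
  | cons f fs ih =>
    obtain ⟨l, x⟩ := f
    simp only [stackNodes, List.flatMap_cons, List.mem_append, List.mem_cons] at hL hR hK
    simp only [List.length_cons] at hS
    obtain ⟨h1, h2, h3, h4⟩ := h
    refine ⟨by rw [hS _ (by omega), h1], h2, ?_, ih h4 (fun y hy => hL y (.inr hy))
      (fun y hy => hR y (.inr hy)) (fun y hy => hK y (.inr hy)) (fun i hi => hS i (by omega))⟩
    rw [hL _ (.inl (.inl rfl))]
    exact h3.congr (fun y hy => hL y (.inl (.inr hy))) (fun y hy => hR y (.inl (.inr hy)))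
      (fun y hy => hK y (.inl (.inr hy)))

end HTree


/-! ### Melding two heaps in memory -/

namespace RAM

open HTree NExpr

/-- Descend along the right spines of the heaps at the addresses in the variables `1` and `2`,
keeping the nodes met in array `9`, used as a stack. -/
def meldDown (k key : ℕ) : Prog :=
  .loop (.and (.not (.eqN (var 1) (var 0))) (.not (.eqN (var 2) (var 0))))
    (.ite (.leR (.get key (var 1)) (.get key (var 2))) .skip
        (.setN 4 (var 1) ;; .setN 1 (var 2) ;; .setN 2 (var 4)) ;;
      .putN 9 (var 3) (var 1) ;; .setN 3 (succ (var 3)) ;; .setN 1 (get (k + 11) (var 1)))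

/-- Rebuild the leftist heap from the stack. -/
def meldUp (k : ℕ) : Prog :=
  .loop (.not (.eqN (var 3) (const 0)))
    (.setN 3 (pred (var 3)) ;; .setN 4 (get 9 (var 3)) ;;
      .ite (.leN (get (k + 12) (var 1)) (get (k + 12) (get (k + 10) (var 4))))
        (.putN (k + 11) (var 4) (var 1))
        (.putN (k + 11) (var 4) (get (k + 10) (var 4)) ;; .putN (k + 10) (var 4) (var 1)) ;;
      .putN (k + 12) (var 4) (succ (get (k + 12) (get (k + 11) (var 4)))) ;;
      .setN 1 (var 4))

/-- Meld the heaps at the addresses in the variables `1` and `2`; the result is in variable `1`. The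
children are in the arrays `k + 10` and `k + 11`, the ranks in `k + 12`, the keys in `key`. The
address of the empty heap is in variable `0`. -/
def meldProg (k key : ℕ) : Prog :=
  .setN 3 (const 0) ;; meldDown k key ;; .ite (.eqN (var 1) (var 0)) (.setN 1 (var 2)) .skip ;;
    meldUp k

/-- `τ` differs from `σ` only in the variables `1` to `4`, in array `9` and at the nodes `N` of the
heap arrays. -/
structure MeldFrame (k : ℕ) (N : List ℕ) (σ τ : State) : Prop where
  rvar : τ.rvar = σ.rvar
  rarr : τ.rarr = σ.rarr
  nvar : ∀ x, x = 0 ∨ 5 ≤ x → τ.nvar x = σ.nvar x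
  narr : ∀ a, a ≠ 9 → a ≠ k + 10 → a ≠ k + 11 → a ≠ k + 12 → τ.narr a = σ.narr a
  left : ∀ x ∉ N, τ.narr (k + 10) x = σ.narr (k + 10) x
  right : ∀ x ∉ N, τ.narr (k + 11) x = σ.narr (k + 11) x
  rank : ∀ x ∉ N, τ.narr (k + 12) x = σ.narr (k + 12) x

theorem MeldFrame.trans {k : ℕ} {N : List ℕ} {σ τ υ : State} (h : MeldFrame k N σ τ)
    (h' : MeldFrame k N τ υ) : MeldFrame k N σ υ where
  rvar := h'.rvar.trans h.rvar
  rarr := h'.rarr.trans h.rarr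
  nvar x hx := (h'.nvar x hx).trans (h.nvar x hx)
  narr a h1 h2 h3 h4 := (h'.narr a h1 h2 h3 h4).trans (h.narr a h1 h2 h3 h4)
  left x hx := (h'.left x hx).trans (h.left x hx)
  right x hx := (h'.right x hx).trans (h.right x hx)
  rank x hx := (h'.rank x hx).trans (h.rank x hx)

theorem MeldFrame.refl (k : ℕ) (N : List ℕ) (σ : State) : MeldFrame k N σ σ :=
  ⟨rfl, rfl, fun _ _ => rfl, fun _ _ _ _ _ => rfl, fun _ _ => rfl, fun _ _ => rfl, fun _ _ => rfl⟩

/-- The tree `t` is stored at `q` in the heap arrays. -/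
def State.HStored (σ : State) (k : ℕ) (t : HTree) (q : ℕ) : Prop :=
  Stored (σ.narr (k + 10)) (σ.narr (k + 11)) (σ.narr (k + 12)) (σ.nvar 0) t q

/-- Invariant: `plug fs t = T`. A round pops `(l, x)`, replaces `t` by `join l x t` and spends the
40 credits of the stack entry. As the empty address is not in `N`, its rank stays `0` throughout. -/
theorem meldUp_spec {k : ℕ} {σ : State} {N : List ℕ} {T : HTree} {c : ℕ}
    (hN : σ.nvar 0 ∉ N) (hK : σ.narr (k + 12) (σ.nvar 0) = 0)
    (fs : List (HTree × ℕ)) (t : HTree) (hT : plug fs t = T) (hsp : σ.nvar 3 = fs.length)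
    (ht : σ.HStored k t (σ.nvar 1))
    (hfs : StackStored (σ.narr (k + 10)) (σ.narr (k + 11)) (σ.narr (k + 12)) (σ.narr 9) (σ.nvar 0) fs)
    (hnd : (stackNodes fs ++ t.nodes).Nodup) (hsub : ∀ x ∈ stackNodes fs ++ t.nodes, x ∈ N)
    (d : ℕ) (hc : 40 * fs.length + 10 + d ≤ c) :
    WP (meldUp k) (fun τ c' => d ≤ c' ∧ MeldFrame k N σ τ ∧ τ.HStored k T (τ.nvar 1)) σ c := by
  refine WP.loop (fun τ c' => MeldFrame k N σ τ ∧ ∃ (fs : List (HTree × ℕ)) (t : HTree),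
    plug fs t = T ∧ τ.nvar 3 = fs.length ∧ τ.HStored k t (τ.nvar 1) ∧
    StackStored (τ.narr (k + 10)) (τ.narr (k + 11)) (τ.narr (k + 12)) (τ.narr 9) (τ.nvar 0) fs ∧
    (stackNodes fs ++ t.nodes).Nodup ∧ (∀ x ∈ stackNodes fs ++ t.nodes, x ∈ N) ∧
    40 * fs.length + 10 + d ≤ c') ?_
    ⟨MeldFrame.refl _ _ _, fs, t, hT, hsp, ht, hfs, hnd, hsub, hc⟩
  clear! fs t c
  rintro τ c ⟨hF, fs, t, hT, hsp, ht, hfs, hnd, hsub, hc⟩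
  cases fs with
  | nil =>
    right
    refine ⟨by simp [hsp], d, by simp at hc ⊢; omega, le_rfl, hF, ?_⟩
    rw [← hT]; exact ht
  | cons f fs =>
    left
    obtain ⟨l, x⟩ := f
    obtain ⟨h1, h2, h3, h4⟩ := hfs
    simp only [List.length_cons] at hc hsp
    have hτK : τ.narr (k + 12) (τ.nvar 0) = 0 := by
      rw [hF.nvar 0 (.inl rfl), hF.rank _ hN, hK]
    have hkt := ht.rk_eq hτK
    have hkl := h3.rk_eq hτK
    simp only [stackNodes, List.flatMap_cons, List.cons_append, List.nodup_cons,
      List.append_assoc] at hnd hsub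
    rw [← stackNodes.eq_def fs] at hnd hsub
    have hxN : x ∈ N := hsub x (by simp)
    have hx0 : x ≠ τ.nvar 0 := h2
    refine ⟨by simp [hsp], 40 * fs.length + 40 + d, by simp; omega, ?_⟩
    refine WP.block (by simp) (40 * fs.length + 10 + d) (by simp; omega) ?_
    have hxl : x ∉ l.nodes := fun h => hnd.1 (by simp [h])
    have hxt : x ∉ t.nodes := fun h => hnd.1 (by simp [h])
    have hxf : x ∉ stackNodes fs := fun h => hnd.1 (by simp [h])
    have hxl' : ∀ y ∈ l.nodes, y ≠ x := fun y hy h => hxl (h ▸ hy)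
    have hxt' : ∀ y ∈ t.nodes, y ≠ x := fun y hy h => hxt (h ▸ hy)
    have hxf' : ∀ y ∈ stackNodes fs, y ≠ x := fun y hy h => hxf (h ▸ hy)
    have hxN' : ∀ y, y ∉ N → y ≠ x := fun y hy h => hy (h ▸ hxN)
    have hnd' : (stackNodes fs ++ (join l x t).nodes).Nodup := by
      refine (List.Perm.nodup_iff ?_).1 (List.nodup_cons.2 hnd)
      refine List.Perm.trans ?_ (List.Perm.append_left _ (nodes_join l x t).symm)
      exact (List.perm_append_comm_assoc (x :: l.nodes) (stackNodes fs) t.nodes)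
    have hsub' : ∀ y ∈ stackNodes fs ++ (join l x t).nodes, y ∈ N := by
      intro y hy
      simp only [List.mem_append, (nodes_join l x t).mem_iff, List.mem_cons] at hy
      exact hsub y (by simp; tauto)
    by_cases hle : t.rk ≤ l.rk
    all_goals
      refine ⟨hF.trans ⟨?_, ?_, ?_, ?_, ?_, ?_, ?_⟩, fs, join l x t, by simpa [plug] using hT, ?_,
        ?_, ?_, hnd', hsub', le_rfl⟩
      · simp [hsp, h1, hkt, hkl, hle]
      · simp [hsp, h1, hkt, hkl, hle]
      · intro y hy
        have e1 : y ≠ 1 := by omega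
        have e3 : y ≠ 3 := by omega
        have e4 : y ≠ 4 := by omega
        simp [hsp, h1, hkt, hkl, hle, e1, e3, e4]
      · intro a a1 a2 a3 a4
        simp [hsp, h1, hkt, hkl, hle, a2, a3, a4]
      · intro y hy
        simp [hsp, h1, hkt, hkl, hle, hxN' y hy]
      · intro y hy
        simp [hsp, h1, hkt, hkl, hle, hxN' y hy]
      · intro y hy
        simp [hsp, h1, hkt, hkl, hle, hxN' y hy]
      · simp [hsp, h1, hkt, hkl, hle]
      · simp [State.HStored, join, hsp, h1, hkt, hkl, hle, Stored, hx0]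
        exact ⟨by
          first
          | exact h3.congr (fun y hy => by simp [hxl' y hy]) (fun y hy => by simp [hxl' y hy])
              (fun y hy => by simp [hxl' y hy])
          | exact ht.congr (fun y hy => by simp [hxt' y hy]) (fun y hy => by simp [hxt' y hy])
              (fun y hy => by simp [hxt' y hy]), by
          first
          | exact h3.congr (fun y hy => by simp [hxl' y hy]) (fun y hy => by simp [hxl' y hy])
              (fun y hy => by simp [hxl' y hy])
          | exact ht.congr (fun y hy => by simp [hxt' y hy]) (fun y hy => by simp [hxt' y hy])
              (fun y hy => by simp [hxt' y hy])⟩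
      · simp [hsp, h1, hkt, hkl, hle]
        exact h4.congr (fun y hy => by simp [hxf' y hy]) (fun y hy => by simp [hxf' y hy])
          (fun y hy => by simp [hxf' y hy]) (fun _ _ => rfl)

/-- Invariant: `plug fs (meld ta tb) = T`. A round moves one root from a right spine to the stack,
so the sum of the ranks drops by one. Of the 100 credits per spine node, 60 pay for the round and 40
stay with the stack entry for `meldUp`. -/
theorem meldDown_spec {k key : ℕ} {σ : State} {N : List ℕ} {T : HTree} {c : ℕ} (ta tb : HTree)
    (hT : meld (σ.rarr key) ta tb = T) (hsp : σ.nvar 3 = 0)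
    (ha : σ.HStored k ta (σ.nvar 1)) (hb : σ.HStored k tb (σ.nvar 2))
    (hnd : (ta.nodes ++ tb.nodes).Nodup) (hsub : ∀ x ∈ ta.nodes ++ tb.nodes, x ∈ N)
    (d : ℕ) (hc : 100 * (ta.rk + tb.rk) + 10 + d ≤ c) :
    WP (meldDown k key) (fun τ c' => MeldFrame k N σ τ ∧ ∃ (fs : List (HTree × ℕ)) (t : HTree),
      plug fs t = T ∧ τ.nvar 3 = fs.length ∧
      (τ.nvar 1 = τ.nvar 0 ∧ τ.HStored k t (τ.nvar 2) ∨
        τ.nvar 1 ≠ τ.nvar 0 ∧ τ.HStored k t (τ.nvar 1)) ∧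
      StackStored (τ.narr (k + 10)) (τ.narr (k + 11)) (τ.narr (k + 12)) (τ.narr 9) (τ.nvar 0) fs ∧
      (stackNodes fs ++ t.nodes).Nodup ∧ (∀ x ∈ stackNodes fs ++ t.nodes, x ∈ N) ∧
      40 * fs.length + d ≤ c') σ c := by
  refine WP.loop (fun τ c' => MeldFrame k N σ τ ∧ ∃ (fs : List (HTree × ℕ)) (ta tb : HTree),
    plug fs (meld (σ.rarr key) ta tb) = T ∧ τ.nvar 3 = fs.length ∧
    τ.HStored k ta (τ.nvar 1) ∧ τ.HStored k tb (τ.nvar 2) ∧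
    StackStored (τ.narr (k + 10)) (τ.narr (k + 11)) (τ.narr (k + 12)) (τ.narr 9) (τ.nvar 0) fs ∧
    (stackNodes fs ++ (ta.nodes ++ tb.nodes)).Nodup ∧
    (∀ x ∈ stackNodes fs ++ (ta.nodes ++ tb.nodes), x ∈ N) ∧
    100 * (ta.rk + tb.rk) + 40 * fs.length + 10 + d ≤ c') ?_
    ⟨MeldFrame.refl _ _ _, [], ta, tb, hT, hsp, ha, hb, trivial, hnd, hsub, by simpa using hc⟩
  clear! ta tb c
  rintro τ c ⟨hF, fs, ta, tb, hT, hsp, ha, hb, hfs, hnd, hsub, hc⟩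
  have hna := ha.eq_nil_iff
  have hnb := hb.eq_nil_iff
  have hr : τ.rarr = σ.rarr := hF.rarr
  cases ta with
  | nil =>
    right
    have e := hna.2 rfl
    exact ⟨by simp [e], 40 * fs.length + d, by simp [rk] at hc ⊢; omega, hF, fs, tb,
      by simpa using hT, hsp, .inl ⟨e, hb⟩, hfs, by simpa [nodes] using hnd,
      by simpa [nodes] using hsub, le_rfl⟩
  | node l x r =>
  cases tb with
  | nil =>
    right
    have e := hnb.2 rfl
    exact ⟨by simp [e], 40 * fs.length + d, by simp [rk] at hc ⊢; omega, hF, fs, _,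
      by simpa using hT, hsp, .inr ⟨fun h => by simp at hna; exact hna h, ha⟩, hfs,
      by simpa [nodes] using hnd,
      by simpa [nodes] using hsub, le_rfl⟩
  | node l' y r' =>
    left
    simp only [reduceCtorEq, iff_false] at hna hnb
    obtain ⟨ea, a1, a2, a3, a4⟩ := id ha
    obtain ⟨eb, b1, b2, b3, b4⟩ := id hb
    simp only [rk] at hc
    refine ⟨by simp [hna, hnb], 100 * (r.rk + r'.rk) + 40 * fs.length + 190 + d,
      by simp; omega, ?_⟩
    refine WP.block (by simp) (100 * (r.rk + r'.rk) + 100 + 40 * (fs.length + 1) + 10 + d)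
      (by simp; omega) ?_
    by_cases hle : σ.rarr key x ≤ σ.rarr key y
    · refine ⟨hF.trans ⟨?_, ?_, ?_, ?_, ?_, ?_, ?_⟩, (l, x) :: fs, r, node l' y r', ?_, ?_, ?_, ?_,
        ?_, ?_, ?_, ?_⟩
      · simp [hr, ea, eb, hle]
      · simp [hr, ea, eb, hle]
      · intro z hz
        have e1 : z ≠ 1 := by omega
        have e3 : z ≠ 3 := by omega
        simp [hr, ea, eb, hle, e1, e3]
      · intro a h1 h2 h3 h4
        simp [hr, ea, eb, hle, h1]
      · simp [hr, ea, eb, hle]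
      · simp [hr, ea, eb, hle]
      · simp [hr, ea, eb, hle]
      · simpa [plug, meld_of_le hle] using hT
      · simp [hr, ea, eb, hle, hsp]
      · simpa [hr, ea, eb, hle, State.HStored] using a4
      · simpa [hr, ea, eb, hle, State.HStored] using hb
      · refine ⟨?_, ?_, ?_, ?_⟩
        · simp [hr, ea, eb, hle, hsp]
        · simpa [hr, ea, eb, hle] using a1
        · simpa [hr, ea, eb, hle] using a3
        · simp [hr, ea, eb, hle, hsp]
          exact hfs.congr (fun _ _ => rfl) (fun _ _ => rfl) (fun _ _ => rfl) fun i hi => by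
            simp [hi.ne]
      · refine (List.Perm.nodup_iff ?_).1 hnd
        simp only [stackNodes, List.flatMap_cons, nodes, List.cons_append, List.append_assoc]
        refine List.perm_middle.trans (List.Perm.cons _ ?_)
        exact List.perm_append_comm_assoc _ _ _
      · intro z hz
        refine hsub z ?_
        simp only [stackNodes, List.flatMap_cons, nodes, List.cons_append, List.append_assoc,
          List.mem_append, List.mem_cons] at hz ⊢
        tauto
      · simp [rk]; omega
    · refine ⟨hF.trans ⟨?_, ?_, ?_, ?_, ?_, ?_, ?_⟩, (l', y) :: fs, r', node l x r, ?_, ?_, ?_, ?_,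
        ?_, ?_, ?_, ?_⟩
      · simp [hr, ea, eb, hle]
      · simp [hr, ea, eb, hle]
      · intro z hz
        have e1 : z ≠ 1 := by omega
        have e2 : z ≠ 2 := by omega
        have e3 : z ≠ 3 := by omega
        have e4 : z ≠ 4 := by omega
        simp [hr, ea, eb, hle, e1, e2, e3, e4]
      · intro a h1 h2 h3 h4
        simp [hr, ea, eb, hle, h1]
      · simp [hr, ea, eb, hle]
      · simp [hr, ea, eb, hle]
      · simp [hr, ea, eb, hle]
      · simpa [plug, meld_of_not_le hle] using hT
      · simp [hr, ea, eb, hle, hsp]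
      · simpa [hr, ea, eb, hle, State.HStored] using b4
      · simpa [hr, ea, eb, hle, State.HStored] using ha
      · refine ⟨?_, ?_, ?_, ?_⟩
        · simp [hr, ea, eb, hle, hsp]
        · simpa [hr, ea, eb, hle] using b1
        · simpa [hr, ea, eb, hle] using b3
        · simp [hr, ea, eb, hle, hsp]
          exact hfs.congr (fun _ _ => rfl) (fun _ _ => rfl) (fun _ _ => rfl) fun i hi => by
            simp [hi.ne]
      · refine (List.Perm.nodup_iff ?_).1 hnd
        simp only [stackNodes, List.flatMap_cons, nodes, List.cons_append, List.append_assoc]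
        rw [List.perm_iff_count]
        intro z
        simp only [List.count_append, List.count_cons]
        omega
      · intro z hz
        refine hsub z ?_
        simp only [stackNodes, List.flatMap_cons, nodes, List.cons_append, List.append_assoc,
          List.mem_append, List.mem_cons] at hz ⊢
        tauto
      · simp [rk]; omega

theorem meldProg_spec {k key : ℕ} {σ : State} {c : ℕ} (ta tb : HTree)
    (hN : σ.nvar 0 ∉ ta.nodes ++ tb.nodes) (hK : σ.narr (k + 12) (σ.nvar 0) = 0)
    (ha : σ.HStored k ta (σ.nvar 1)) (hb : σ.HStored k tb (σ.nvar 2))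
    (hnd : (ta.nodes ++ tb.nodes).Nodup)
    (d : ℕ) (hc : 100 * (ta.rk + tb.rk) + 40 + d ≤ c) :
    WP (meldProg k key) (fun τ c' => d ≤ c' ∧ MeldFrame k (ta.nodes ++ tb.nodes) σ τ ∧
      τ.HStored k (meld (σ.rarr key) ta tb) (τ.nvar 1)) σ c := by
  refine WP.seq (WP.block (by simp) (100 * (ta.rk + tb.rk) + 30 + d) (by simp; omega) ?_)
  have hF0 : MeldFrame k (ta.nodes ++ tb.nodes) σ (Prog.run (.setN 3 (const 0)) σ) :=
    ⟨rfl, rfl, fun x hx => by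
      have : x ≠ 3 := by omega
      simp [this], fun _ _ _ _ _ => rfl, fun _ _ => rfl, fun _ _ => rfl, fun _ _ => rfl⟩
  refine WP.seq (WP.mono (meldDown_spec (N := ta.nodes ++ tb.nodes) ta tb rfl (by simp) (by simpa [State.HStored] using ha)
    (by simpa [State.HStored] using hb) hnd (fun _ h => h) (20 + d) (by omega)) ?_)
  rintro τ c1 ⟨hF, fs, t, hT, hsp, h, hfs, hnd1, hsub, hc1⟩
  have hF1 := hF0.trans hF
  refine WP.seq (WP.block (by simp) (40 * fs.length + 10 + d) (by simp; omega) ?_)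
  set υ := Prog.run (.ite (.eqN (var 1) (var 0)) (.setN 1 (var 2)) .skip) τ with hυ
  obtain ⟨z, hz, hzt⟩ : ∃ z, υ = τ.setN 1 z ∧ τ.HStored k t z := by
    rcases h with ⟨h1, h2⟩ | ⟨h1, h2⟩
    · exact ⟨_, by simp [hυ, h1], h2⟩
    · exact ⟨τ.nvar 1, by simp [hυ, h1, State.setN], h2⟩
  clear_value υ
  subst hz
  have hF2 : MeldFrame k (ta.nodes ++ tb.nodes) τ (τ.setN 1 z) :=
    ⟨rfl, rfl, fun x hx => by
      have : x ≠ 1 := by omega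
      simp [this], fun _ _ _ _ _ => rfl, fun _ _ => rfl, fun _ _ => rfl, fun _ _ => rfl⟩
  have e0 : (τ.setN 1 z).nvar 0 = σ.nvar 0 := (hF1.trans hF2).nvar 0 (.inl rfl)
  refine WP.mono (meldUp_spec (by rw [e0]; exact hN) (by rw [e0, (hF1.trans hF2).rank _ hN, hK])
    fs t hT (by simpa using hsp) (by simpa [State.HStored] using hzt) (by simpa using hfs)
    hnd1 hsub d le_rfl) ?_
  rintro ρ c2 ⟨h1, h2, h3⟩
  exact ⟨h1, (hF1.trans hF2).trans h2, h3⟩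

end RAM

/-! ## Families of disjoint heaps -/

open HTree in
/-- Leftist heaps, one for every `r < n`, with pairwise disjoint sets of nodes below `n`. -/
structure HeapFamily (n : ℕ) (t : ℕ → HTree) : Prop where
  leftist : ∀ r, (t r).Leftist
  lt : ∀ r, ∀ x ∈ (t r).nodes, x < n
  nodup : ∀ r, (t r).nodes.Nodup
  disj : ∀ r q x, x ∈ (t r).nodes → x ∈ (t q).nodes → r = q

/-- The number of nodes in a family of heaps. -/
def heapCount (n : ℕ) (t : ℕ → HTree) : ℕ := ∑ r ∈ Finset.range n, (t r).nodes.length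

/-- Move all nodes of the heap `q` to the heap `r`. -/
noncomputable def moveHeap (key : ℕ → ℝ) (t : ℕ → HTree) (r q : ℕ) : ℕ → HTree :=
  Function.update (Function.update t r (HTree.meld key (t r) (t q))) q .nil

/-- Remove the smallest node of the heap `r`. -/
noncomputable def popHeap (key : ℕ → ℝ) (t : ℕ → HTree) (r : ℕ) : ℕ → HTree :=
  Function.update t r (match t r with
    | .nil => .nil
    | .node a _ b => HTree.meld key a b)

/-- Insert the node `x` into the heap `r`. -/
noncomputable def insHeap (key : ℕ → ℝ) (t : ℕ → HTree) (r x : ℕ) : ℕ → HTree :=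
  Function.update t r (HTree.meld key (t r) (.node .nil x .nil))

namespace HeapFamily

open HTree

variable {n : ℕ} {t : ℕ → HTree} {key : ℕ → ℝ}

theorem moveHeap (h : HeapFamily n t) {r q : ℕ} (hrq : r ≠ q) :
    HeapFamily n (moveHeap key t r q) := by
  have hmem : ∀ y z, z ∈ (_root_.moveHeap key t r q y).nodes →
      y = r ∧ (z ∈ (t r).nodes ∨ z ∈ (t q).nodes) ∨ y ≠ r ∧ y ≠ q ∧ z ∈ (t y).nodes := by
    intro y z hz
    by_cases hq : y = q
    · subst hq; simp [_root_.moveHeap, nodes] at hz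
    · by_cases hr : y = r
      · subst hr; simp [_root_.moveHeap, hq, mem_meld] at hz; exact .inl ⟨rfl, hz⟩
      · simp [_root_.moveHeap, hq, hr] at hz; exact .inr ⟨hr, hq, hz⟩
  refine ⟨fun y => ?_, fun y z hz => ?_, fun y => ?_, fun y y' z hz hz' => ?_⟩
  · by_cases hq : y = q
    · subst hq; simp [_root_.moveHeap, Leftist]
    · by_cases hr : y = r
      · subst hr; simp [_root_.moveHeap, hq, leftist_meld, h.leftist]
      · simp [_root_.moveHeap, hq, hr, h.leftist]
  · rcases hmem y z hz with ⟨-, hz | hz⟩ | ⟨-, -, hz⟩ <;> exact h.lt _ _ hz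
  · by_cases hq : y = q
    · subst hq; simp [_root_.moveHeap, nodes]
    · by_cases hr : y = r
      · subst hr
        simp only [_root_.moveHeap, ne_eq, hq, not_false_eq_true, Function.update_of_ne,
          Function.update_self]
        rw [(nodes_meld key _ _).nodup_iff]
        refine List.Nodup.append (h.nodup _) (h.nodup _) fun z hz hz' => hrq (h.disj _ _ _ hz hz')
      · simp [_root_.moveHeap, hq, hr, h.nodup]
  · rcases hmem y z hz with ⟨rfl, hz1⟩ | ⟨h1, h1', hz1⟩ <;>
    rcases hmem y' z hz' with ⟨rfl, hz2⟩ | ⟨h2, h2', hz2⟩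
    · rfl
    · rcases hz1 with hz1 | hz1
      · exact absurd (h.disj _ _ _ hz1 hz2) (Ne.symm h2)
      · exact absurd (h.disj _ _ _ hz1 hz2) (Ne.symm h2')
    · rcases hz2 with hz2 | hz2
      · exact absurd (h.disj _ _ _ hz2 hz1) (Ne.symm h1)
      · exact absurd (h.disj _ _ _ hz2 hz1) (Ne.symm h1')
    · exact h.disj _ _ _ hz1 hz2

theorem update (h : HeapFamily n t) {r : ℕ} {a : HTree} (hl : a.Leftist) (hn : a.nodes.Nodup)
    (ha : ∀ z ∈ a.nodes, z < n ∧ ∀ y, y ≠ r → z ∉ (t y).nodes) :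
    HeapFamily n (Function.update t r a) := by
  refine ⟨fun y => ?_, fun y z hz => ?_, fun y => ?_, fun y y' z hz hz' => ?_⟩
  · by_cases hr : y = r
    · subst hr; simpa
    · simp [hr, h.leftist]
  · by_cases hr : y = r
    · subst hr; simp at hz; exact (ha z hz).1
    · simp [hr] at hz; exact h.lt _ _ hz
  · by_cases hr : y = r
    · subst hr; simpa
    · simp [hr, h.nodup]
  · by_cases hr : y = r <;> by_cases hr' : y' = r
    · rw [hr, hr']
    · subst hr; simp [hr'] at hz hz'; exact absurd hz' ((ha z hz).2 _ hr')
    · subst hr'; simp [hr] at hz hz'; exact absurd hz ((ha z hz').2 _ hr)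
    · simp [hr, hr'] at hz hz'; exact h.disj _ _ _ hz hz'

theorem popHeap (h : HeapFamily n t) (r : ℕ) : HeapFamily n (popHeap key t r) := by
  unfold _root_.popHeap
  cases ht : t r with
  | nil => exact h.update trivial (by simp [nodes]) (by simp [nodes])
  | node a x b =>
    have h1 := h.leftist r
    have h2 := h.nodup r
    rw [ht] at h1 h2
    refine h.update (leftist_meld _ h1.2.1 h1.2.2) ?_ fun z hz => ?_
    · rw [(nodes_meld key _ _).nodup_iff]
      exact (List.nodup_cons.1 h2).2
    · have : z ∈ (t r).nodes := by
        rw [ht]; rw [mem_meld] at hz; simp [nodes, hz]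
      exact ⟨h.lt _ _ this, fun y hy hz' => hy (h.disj _ _ _ hz' this)⟩

theorem insHeap (h : HeapFamily n t) {r x : ℕ} (hx : x < n) (hxt : ∀ y, x ∉ (t y).nodes) :
    HeapFamily n (insHeap key t r x) := by
  refine h.update (leftist_meld _ (h.leftist _) (by simp [Leftist])) ?_ fun z hz => ?_
  · rw [(nodes_meld key _ _).nodup_iff]
    refine List.Nodup.append (h.nodup _) (by simp [nodes]) fun z hz hz' => ?_
    simp [nodes] at hz'
    subst hz'
    exact hxt _ hz
  · simp only [mem_meld, nodes, List.append_nil, List.mem_singleton] at hz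
    rcases hz with hz | rfl
    · exact ⟨h.lt _ _ hz, fun y hy hz' => hy (h.disj _ _ _ hz' hz)⟩
    · exact ⟨hx, fun y _ => hxt y⟩

theorem length_le (h : HeapFamily n t) (r : ℕ) : (t r).nodes.length ≤ n := by
  rw [← List.toFinset_card_of_nodup (h.nodup r)]
  calc _ ≤ (Finset.range n).card := Finset.card_le_card fun z hz => by
        simpa using h.lt r z (by simpa using hz)
    _ = n := by simp

theorem rk_le (h : HeapFamily n t) (r : ℕ) : (t r).rk ≤ Nat.log 2 (n + 1) := by
  refine Nat.le_log_of_pow_le (by norm_num) ?_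
  have := two_pow_rk_le (h.leftist r)
  have := h.length_le r
  omega

end HeapFamily

/-- An equation between sums rather than differences, so that `omega` never meets a truncated
subtraction. -/
theorem heapCount_update {n : ℕ} (t : ℕ → HTree) {r : ℕ} (hr : r < n) (a : HTree) :
    heapCount n (Function.update t r a) + (t r).nodes.length = heapCount n t + a.nodes.length := by
  unfold heapCount
  have hr' : r ∈ Finset.range n := by simpa using hr
  rw [← Finset.add_sum_erase _ _ hr', ← Finset.add_sum_erase (Finset.range n) (fun x =>
    (t x).nodes.length) hr']
  have : ∀ x ∈ (Finset.range n).erase r, (Function.update t r a x).nodes.length =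
      (t x).nodes.length := by
    intro x hx
    rw [Function.update_of_ne (Finset.ne_of_mem_erase hx)]
  rw [Finset.sum_congr rfl this, Function.update_self]
  omega

theorem heapCount_moveHeap {n : ℕ} {t : ℕ → HTree} {key : ℕ → ℝ} {r q : ℕ} (hr : r < n)
    (hq : q < n) (hrq : r ≠ q) : heapCount n (moveHeap key t r q) = heapCount n t := by
  have h1 := heapCount_update t hr (HTree.meld key (t r) (t q))
  have h2 := heapCount_update (Function.update t r (HTree.meld key (t r) (t q))) hq .nil
  rw [(HTree.nodes_meld key _ _).length_eq, List.length_append] at h1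
  rw [Function.update_of_ne hrq.symm] at h2
  simp only [HTree.nodes, List.length_nil] at h2
  unfold moveHeap
  omega

theorem heapCount_popHeap {n : ℕ} {t : ℕ → HTree} {key : ℕ → ℝ} {r : ℕ} (hr : r < n)
    (h : t r ≠ .nil) : heapCount n (popHeap key t r) + 1 = heapCount n t := by
  unfold popHeap
  cases ht : t r with
  | nil => exact absurd ht h
  | node a x b =>
    have h1 := heapCount_update t hr (HTree.meld key a b)
    rw [(HTree.nodes_meld key _ _).length_eq, ht] at h1
    simp only [HTree.nodes, List.length_cons] at h1 ⊢
    omega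

theorem heapCount_insHeap {n : ℕ} {t : ℕ → HTree} {key : ℕ → ℝ} {r x : ℕ} (hr : r < n) :
    heapCount n (insHeap key t r x) = heapCount n t + 1 := by
  have h1 := heapCount_update t hr (HTree.meld key (t r) (.node .nil x .nil))
  rw [(HTree.nodes_meld key _ _).length_eq] at h1
  simp only [HTree.nodes, List.append_nil, List.length_append, List.length_singleton] at h1
  unfold insHeap
  omega

/-! ### Heap operations on families stored in memory -/

namespace RAM

open HTree NExpr

/-- `τ` differs from `σ` only in the variables `1` to `4`, in array `9` and in the four arrays of a
family of heaps. -/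
structure HeapFrame (k : ℕ) (σ τ : State) : Prop where
  rvar : τ.rvar = σ.rvar
  rarr : τ.rarr = σ.rarr
  nvar : ∀ x, x = 0 ∨ 5 ≤ x → τ.nvar x = σ.nvar x
  narr : ∀ a, a ≠ 9 → a < k + 10 ∨ k + 13 < a → τ.narr a = σ.narr a

/-- A family of heaps is stored in the arrays `k + 10` to `k + 12`, its roots in `k + 13`. -/
structure HeapsAt (n k : ℕ) (σ : State) (t : ℕ → HTree) : Prop extends HeapFamily n t where
  size : σ.nvar 0 = n
  rank : σ.narr (k + 12) n = 0
  stored : ∀ r < n, σ.HStored k (t r) (σ.narr (k + 13) r)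

theorem HeapsAt.of_eq {n k : ℕ} {σ τ : State} {t : ℕ → HTree} (h : HeapsAt n k σ t)
    (h0 : τ.nvar 0 = σ.nvar 0) (h1 : ∀ a, k + 10 ≤ a → a ≤ k + 13 → τ.narr a = σ.narr a) :
    HeapsAt n k τ t := by
  refine ⟨h.toHeapFamily, by rw [h0, h.size], by rw [h1 _ (by omega) (by omega), h.rank],
    fun r hr => ?_⟩
  have := h.stored r hr
  unfold State.HStored at this ⊢
  rw [h1 _ (by omega) (by omega), h1 _ (by omega) (by omega), h1 _ (by omega) (by omega),
    h1 _ (by omega) (by omega), h0]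
  exact this

/-- A family occupies the arrays `k + 10` to `k + 13`. The values `0`, `4`, `8` of `k`, used for
`M`, `O`, `I`, give disjoint blocks, so work on one family preserves the other two. -/
theorem HeapFrame.heapsAt {n k k' : ℕ} {σ τ : State} {t : ℕ → HTree} (hF : HeapFrame k σ τ)
    (h : HeapsAt n k' σ t) (hk : k + 3 < k' ∨ k' + 3 < k) : HeapsAt n k' τ t :=
  h.of_eq (hF.nvar 0 (.inl rfl)) fun a h1 h2 => hF.narr a (by omega) (by omega)

theorem HeapFrame.trans {k : ℕ} {σ τ υ : State} (h : HeapFrame k σ τ) (h' : HeapFrame k τ υ) :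
    HeapFrame k σ υ where
  rvar := h'.rvar.trans h.rvar
  rarr := h'.rarr.trans h.rarr
  nvar x hx := (h'.nvar x hx).trans (h.nvar x hx)
  narr a h1 h2 := (h'.narr a h1 h2).trans (h.narr a h1 h2)

theorem MeldFrame.heapFrame {k : ℕ} {N : List ℕ} {σ τ : State} (h : MeldFrame k N σ τ) :
    HeapFrame k σ τ :=
  ⟨h.rvar, h.rarr, h.nvar, fun a h1 h2 => h.narr a h1 (by omega) (by omega) (by omega)⟩

theorem MeldFrame.hStored {k q : ℕ} {N : List ℕ} {σ τ : State} (h : MeldFrame k N σ τ) {t : HTree}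
    (ht : ∀ x ∈ t.nodes, x ∉ N) (hs : σ.HStored k t q) : τ.HStored k t q := by
  unfold State.HStored at hs ⊢
  rw [h.nvar 0 (.inl rfl)]
  exact hs.congr (fun x hx => h.left x (ht x hx)) (fun x hx => h.right x (ht x hx))
    (fun x hx => h.rank x (ht x hx))

/-- Move all nodes of the heap `q` to the heap `r`, where `r` and `q` are the contents of the
variables `ρ` and `κ`. -/
def moveProg (k key ρ κ : ℕ) : Prog :=
  (.setN 1 (get (k + 13) (var ρ)) ;; .setN 2 (get (k + 13) (var κ))) ;; meldProg k key ;;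
    (.putN (k + 13) (var ρ) (var 1) ;; .putN (k + 13) (var κ) (var 0))

/-- Remove the smallest node of the heap `r`, where `r` is the content of the variable `ρ`. -/
def popProg (k key ρ : ℕ) : Prog :=
  (.setN 4 (get (k + 13) (var ρ)) ;; .setN 1 (get (k + 10) (var 4)) ;;
    .setN 2 (get (k + 11) (var 4))) ;; meldProg k key ;; .putN (k + 13) (var ρ) (var 1)

/-- Insert `x` into the heap `r`, where `r` and `x` are the contents of the variables `ρ` and
`ξ`. -/
def insProg (k key ρ ξ : ℕ) : Prog :=
  (.putN (k + 10) (var ξ) (var 0) ;; .putN (k + 11) (var ξ) (var 0) ;;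
    .putN (k + 12) (var ξ) (const 1) ;; .setN 1 (get (k + 13) (var ρ)) ;; .setN 2 (var ξ)) ;;
    meldProg k key ;; .putN (k + 13) (var ρ) (var 1)

/-- A bound for the time of one operation on heaps with at most `n` nodes. -/
def heapTime (n : ℕ) : ℕ := 200 * Nat.log 2 (n + 1) + 100

variable {n k key : ℕ} {σ : State} {t : ℕ → HTree} {c : ℕ}

/-- Each of the two right spines has at most `Nat.log 2 (n + 1)` nodes at 100 credits apiece; hence
the factor 200 in `heapTime`. -/
theorem moveProg_spec {ρ κ : ℕ} (h : HeapsAt n k σ t) (hρ : 5 ≤ ρ) (hκ : 5 ≤ κ)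
    (hr : σ.nvar ρ < n) (hq : σ.nvar κ < n) (hne : σ.nvar ρ ≠ σ.nvar κ) (d : ℕ)
    (hc : heapTime n + d ≤ c) :
    WP (moveProg k key ρ κ) (fun τ c' => d ≤ c' ∧ HeapFrame k σ τ ∧
      HeapsAt n k τ (moveHeap (σ.rarr key) t (σ.nvar ρ) (σ.nvar κ))) σ c := by
  set r := σ.nvar ρ with hrdef
  set q := σ.nvar κ with hqdef
  have ρ1 : ρ ≠ 1 := by omega
  have ρ2 : ρ ≠ 2 := by omega
  have κ1 : κ ≠ 1 := by omega
  have κ2 : κ ≠ 2 := by omega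
  have hrk := h.rk_le r
  have hqk := h.rk_le q
  unfold heapTime at hc
  refine WP.seq (WP.block (by simp) (200 * Nat.log 2 (n + 1) + 80 + d) (by simp; omega) ?_)
  set σ1 := Prog.run (.setN 1 (get (k + 13) (var ρ)) ;; .setN 2 (get (k + 13) (var κ))) σ with hσ1
  have hF1 : MeldFrame k [] σ σ1 := by
    refine ⟨rfl, rfl, fun x hx => ?_, fun _ _ _ _ _ => rfl, fun _ _ => rfl, fun _ _ => rfl,
      fun _ _ => rfl⟩
    have : x ≠ 1 := by omega
    have : x ≠ 2 := by omega
    simp [hσ1, *]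
  have e0 : σ1.nvar 0 = n := by rw [hF1.nvar 0 (.inl rfl), h.size]
  refine WP.seq (WP.mono (meldProg_spec (t r) (t q) ?_ ?_ ?_ ?_ ?_ (20 + d) (by omega)) ?_)
  · rw [e0]
    intro hm
    rcases List.mem_append.1 hm with hm | hm <;> exact (h.lt _ _ hm).ne rfl
  · rw [e0]; exact h.rank
  · have := h.stored r hr
    simpa [hσ1, State.HStored, κ1, ← hrdef] using this
  · have := h.stored q hq
    simpa [hσ1, State.HStored, κ1, ← hqdef] using this
  · exact List.Nodup.append (h.nodup _) (h.nodup _) fun z hz hz' => hne (h.disj _ _ _ hz hz')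
  · rintro τ c1 ⟨hc1, hF, hst⟩
    have hFF := hF1.heapFrame.trans hF.heapFrame
    have eρ : τ.nvar ρ = r := hFF.nvar _ (.inr hρ)
    have eκ : τ.nvar κ = q := hFF.nvar _ (.inr hκ)
    have e0' : τ.nvar 0 = n := by rw [hFF.nvar _ (.inl rfl), h.size]
    refine WP.block (by simp) d (by simp; omega) ⟨le_rfl, ⟨?_, ?_, ?_, ?_⟩, ?_⟩
    · simpa using hFF.rvar
    · simpa using hFF.rarr
    · simpa using hFF.nvar
    · intro a h1 h2
      have : a ≠ k + 13 := by omega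
      simp [this, hFF.narr a h1 h2]
    · refine ⟨h.moveHeap hne, by simpa using e0', ?_, fun y hy => ?_⟩
      · have : n ∉ (t r).nodes ++ (t q).nodes := fun hm => by
          rcases List.mem_append.1 hm with hm | hm <;> exact (h.lt _ _ hm).ne rfl
        simp [hF.rank n this]
        exact h.rank
      · simp only [State.HStored, Prog.run, eval, State.narr_putN, State.nvar_putN, eρ, eκ, e0']
        simp only [Nat.add_left_cancel_iff, Nat.reduceEqDiff, ite_false, ite_true, moveHeap]
        by_cases hyq : y = q
        · subst hyq; simp [HTree.Stored]
        · by_cases hyr : y = r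
          · subst hyr
            simpa [hyq, State.HStored, e0', hF1.rarr] using hst
          · simp only [ne_eq, hyq, not_false_eq_true, Function.update_of_ne, hyr]
            have h1 := hF.hStored (t := t y) (q := σ.narr (k + 13) y) (fun x hx hm => by
              rcases List.mem_append.1 hm with hm | hm
              · exact hyr (h.disj _ _ _ hx hm)
              · exact hyq (h.disj _ _ _ hx hm)) (hF1.hStored (by simp) (h.stored y hy))
            have h2 : τ.narr (k + 13) = σ.narr (k + 13) :=
              (hF.narr _ (by omega) (by omega) (by omega) (by omega)).trans
                (hF1.narr _ (by omega) (by omega) (by omega) (by omega))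
            rw [h2]
            simpa [State.HStored, e0'] using h1

theorem popProg_spec {ρ : ℕ} (h : HeapsAt n k σ t) (hρ : 5 ≤ ρ)
    (hr : σ.nvar ρ < n) (hne : t (σ.nvar ρ) ≠ .nil) (d : ℕ) (hc : heapTime n + d ≤ c) :
    WP (popProg k key ρ) (fun τ c' => d ≤ c' ∧ HeapFrame k σ τ ∧
      HeapsAt n k τ (popHeap (σ.rarr key) t (σ.nvar ρ))) σ c := by
  set r := σ.nvar ρ with hrdef
  have ρ1 : ρ ≠ 1 := by omega
  have ρ2 : ρ ≠ 2 := by omega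
  have ρ4 : ρ ≠ 4 := by omega
  obtain ⟨x, a, b, htr⟩ : ∃ x a b, t r = node a x b := by
    cases ht : t r with
    | nil => exact absurd ht hne
    | node a x b => exact ⟨x, a, b, rfl⟩
  have hsr := h.stored r hr
  have hnd := h.nodup r
  have hlf := h.leftist r
  have hrk := h.rk_le r
  have hlt := h.lt r
  have hlen := h.length_le r
  rw [htr] at hsr hnd hlf hrk hlt hlen
  simp only [nodes, List.mem_cons, List.mem_append, List.length_cons, List.length_append] at hlt hlen
  obtain ⟨ex, x0, hxk, hxa, hxb⟩ := hsr
  -- The right spine of the left subtree is not part of the spine of the heap; its length is bounded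
  -- through the size of that subtree.
  have hak : a.rk ≤ Nat.log 2 (n + 1) := by
    refine Nat.le_log_of_pow_le (by norm_num) ?_
    have := two_pow_rk_le hlf.2.1
    omega
  have hbk : b.rk ≤ Nat.log 2 (n + 1) := by
    simp only [rk] at hrk; omega
  unfold heapTime at hc
  refine WP.seq (WP.block (by simp) (200 * Nat.log 2 (n + 1) + 80 + d) (by simp; omega) ?_)
  set σ1 := Prog.run (.setN 4 (get (k + 13) (var ρ)) ;; .setN 1 (get (k + 10) (var 4)) ;;
    .setN 2 (get (k + 11) (var 4))) σ with hσ1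
  have hF1 : MeldFrame k [] σ σ1 := by
    refine ⟨rfl, rfl, fun x hx => ?_, fun _ _ _ _ _ => rfl, fun _ _ => rfl, fun _ _ => rfl,
      fun _ _ => rfl⟩
    have : x ≠ 1 := by omega
    have : x ≠ 2 := by omega
    have : x ≠ 4 := by omega
    simp [hσ1, *]
  have e0 : σ1.nvar 0 = n := by rw [hF1.nvar 0 (.inl rfl), h.size]
  refine WP.seq (WP.mono (meldProg_spec a b ?_ ?_ ?_ ?_ ?_ (20 + d) (by omega)) ?_)
  · rw [e0]
    intro hm
    rcases List.mem_append.1 hm with hm | hm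
    · exact (hlt n (.inr (.inl hm))).ne rfl
    · exact (hlt n (.inr (.inr hm))).ne rfl
  · rw [e0]; exact h.rank
  · simpa [hσ1, State.HStored, ← hrdef, ex] using hxa
  · simpa [hσ1, State.HStored, ← hrdef, ex] using hxb
  · exact (List.nodup_cons.1 hnd).2
  · rintro τ c1 ⟨hc1, hF, hst⟩
    have hFF := hF1.heapFrame.trans hF.heapFrame
    have eρ : τ.nvar ρ = r := hFF.nvar _ (.inr hρ)
    have e0' : τ.nvar 0 = n := by rw [hFF.nvar _ (.inl rfl), h.size]
    refine WP.block (by simp) d (by simp; omega) ⟨le_rfl, ⟨?_, ?_, ?_, ?_⟩, ?_⟩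
    · simpa using hFF.rvar
    · simpa using hFF.rarr
    · simpa using hFF.nvar
    · intro a h1 h2
      have : a ≠ k + 13 := by omega
      simp [this, hFF.narr a h1 h2]
    · refine ⟨h.popHeap r, by simpa using e0', ?_, fun y hy => ?_⟩
      · have : n ∉ a.nodes ++ b.nodes := fun hm => by
          rcases List.mem_append.1 hm with hm | hm
          · exact (hlt n (.inr (.inl hm))).ne rfl
          · exact (hlt n (.inr (.inr hm))).ne rfl
        simp [hF.rank n this]
        exact h.rank
      · simp only [State.HStored, Prog.run, eval, State.narr_putN, State.nvar_putN, eρ, e0']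
        simp only [Nat.add_left_cancel_iff, Nat.reduceEqDiff, ite_false, ite_true, popHeap, htr]
        by_cases hyr : y = r
        · subst hyr
          simpa [State.HStored, e0', hF1.rarr] using hst
        · simp only [ne_eq, not_false_eq_true, Function.update_of_ne, hyr]
          have h1 := hF.hStored (t := t y) (q := σ.narr (k + 13) y) (fun z hz hm => by
            refine hyr (h.disj _ _ z hz ?_)
            rw [htr]
            exact List.mem_cons_of_mem _ hm) (hF1.hStored (by simp) (h.stored y hy))
          have h2 : τ.narr (k + 13) = σ.narr (k + 13) :=
            (hF.narr _ (by omega) (by omega) (by omega) (by omega)).trans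
              (hF1.narr _ (by omega) (by omega) (by omega) (by omega))
          rw [h2]
          simpa [State.HStored, e0'] using h1

theorem insProg_spec {ρ ξ : ℕ} (h : HeapsAt n k σ t) (hρ : 5 ≤ ρ) (hξ : 5 ≤ ξ)
    (hr : σ.nvar ρ < n) (hx : σ.nvar ξ < n) (hxt : ∀ y, σ.nvar ξ ∉ (t y).nodes) (d : ℕ)
    (hc : heapTime n + d ≤ c) :
    WP (insProg k key ρ ξ) (fun τ c' => d ≤ c' ∧ HeapFrame k σ τ ∧
      HeapsAt n k τ (insHeap (σ.rarr key) t (σ.nvar ρ) (σ.nvar ξ))) σ c := by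
  set r := σ.nvar ρ with hrdef
  set x := σ.nvar ξ with hxdef
  have ρ1 : ρ ≠ 1 := by omega
  have ρ2 : ρ ≠ 2 := by omega
  have ξ1 : ξ ≠ 1 := by omega
  have ξ2 : ξ ≠ 2 := by omega
  have hsr := h.stored r hr
  have hrk := h.rk_le r
  unfold heapTime at hc
  -- The one-node heap has a spine of length 1, whose cost has to fit into the second `100 * Nat.log
  -- 2 (n + 1)` of the budget.
  have hn1 : 1 ≤ Nat.log 2 (n + 1) := Nat.log_pos (by norm_num) (by omega)
  refine WP.seq (WP.block (by simp) (200 * Nat.log 2 (n + 1) + 60 + d) (by simp; omega) ?_)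
  set σ1 := Prog.run (.putN (k + 10) (var ξ) (var 0) ;; .putN (k + 11) (var ξ) (var 0) ;;
    .putN (k + 12) (var ξ) (const 1) ;; .setN 1 (get (k + 13) (var ρ)) ;; .setN 2 (var ξ)) σ with hσ1
  have hF1 : MeldFrame k [x] σ σ1 := by
    refine ⟨rfl, rfl, fun x hx => ?_, fun a h1 h2 h3 h4 => ?_, fun y hy => ?_, fun y hy => ?_,
      fun y hy => ?_⟩
    · have : x ≠ 1 := by omega
      have : x ≠ 2 := by omega
      simp [hσ1, *]
    · simp [hσ1, *]
    · have : y ≠ x := by simpa using hy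
      simp [hσ1, ← hxdef, this]
    · have : y ≠ x := by simpa using hy
      simp [hσ1, ← hxdef, this]
    · have : y ≠ x := by simpa using hy
      simp [hσ1, ← hxdef, this]
  have e0 : σ1.nvar 0 = n := by rw [hF1.nvar 0 (.inl rfl), h.size]
  have hnx : n ∉ [x] := by simpa using hx.ne'
  have hdis : ∀ y, ∀ z ∈ (t y).nodes, z ∉ [x] := fun y z hz hz' => by
    simp only [List.mem_singleton] at hz'
    subst hz'
    exact hxt y hz
  have er : σ1.nvar 1 = σ.narr (k + 13) r := by simp [hσ1, ← hrdef]
  refine WP.seq (WP.mono (meldProg_spec (t r) (node nil x nil) ?_ ?_ ?_ ?_ ?_ (10 + d)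
    (by simp only [rk]; omega)) ?_)
  · rw [e0]
    intro hm
    rcases List.mem_append.1 hm with hm | hm
    · exact (h.lt _ _ hm).ne rfl
    · simp [nodes] at hm; exact hx.ne' hm
  · rw [e0, hF1.rank n hnx]; exact h.rank
  · rw [er]; exact hF1.hStored (hdis r) hsr
  · have : x ≠ σ.nvar 0 := by rw [h.size]; exact hx.ne
    simp [hσ1, State.HStored, HTree.Stored, ← hxdef, ξ1, this, rk]
  · refine List.Nodup.append (h.nodup _) (by simp [nodes]) fun z hz hz' => ?_
    simp [nodes] at hz'
    subst hz'
    exact hxt _ hz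
  · rintro τ c1 ⟨hc1, hF, hst⟩
    have hFF := hF1.heapFrame.trans hF.heapFrame
    have eρ : τ.nvar ρ = r := hFF.nvar _ (.inr hρ)
    have e0' : τ.nvar 0 = n := by rw [hFF.nvar _ (.inl rfl), h.size]
    refine WP.block (by simp) d (by simp; omega) ⟨le_rfl, ⟨?_, ?_, ?_, ?_⟩, ?_⟩
    · simpa using hFF.rvar
    · simpa using hFF.rarr
    · simpa using hFF.nvar
    · intro a h1 h2
      have : a ≠ k + 13 := by omega
      simp [this, hFF.narr a h1 h2]
    · refine ⟨h.insHeap hx hxt, by simpa using e0', ?_, fun y hy => ?_⟩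
      · have : n ∉ (t r).nodes ++ (node nil x nil).nodes := fun hm => by
          rcases List.mem_append.1 hm with hm | hm
          · exact (h.lt _ _ hm).ne rfl
          · simp [nodes] at hm; exact hx.ne' hm
        simp [hF.rank n this, hF1.rank n hnx]
        exact h.rank
      · simp only [State.HStored, Prog.run, eval, State.narr_putN, State.nvar_putN, eρ, e0']
        simp only [Nat.add_left_cancel_iff, Nat.reduceEqDiff, ite_false, ite_true, insHeap]
        by_cases hyr : y = r
        · subst hyr
          simpa [State.HStored, e0', hF1.rarr] using hst
        · simp only [ne_eq, not_false_eq_true, Function.update_of_ne, hyr]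
          have h1 := hF.hStored (t := t y) (q := σ.narr (k + 13) y) (fun z hz hm => by
            rcases List.mem_append.1 hm with hm | hm
            · exact hyr (h.disj _ _ z hz hm)
            · simp [nodes] at hm; subst hm; exact hxt _ hz) (hF1.hStored (hdis y) (h.stored y hy))
          have h2 : τ.narr (k + 13) = σ.narr (k + 13) :=
            (hF.narr _ (by omega) (by omega) (by omega) (by omega)).trans
              (hF1.narr _ (by omega) (by omega) (by omega) (by omega))
          rw [h2]
          simpa [State.HStored, e0'] using h1

end RAM

/-! ## Rooted trees on natural numbers -/

/-- `A v` is the set of ancestors of `v` (including `v`) in a rooted tree on `0, …, n - 1`. -/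
structure AncTree (n root : ℕ) (par : ℕ → ℕ) (A : ℕ → Finset ℕ) : Prop where
  root_lt : root < n
  par_lt : ∀ v < n, par v < n
  par_root : par root = root
  anc_root : A root = {root}
  anc_step : ∀ v < n, v ≠ root → A v = insert v (A (par v))
  notMem : ∀ v < n, v ≠ root → v ∉ A (par v)

/-- The path from `u` up to its ancestor `v`. -/
def pathSet (A : ℕ → Finset ℕ) (v u : ℕ) : Finset ℕ := (A u).filter fun y => v ∈ A y

namespace AncTree

variable {n root : ℕ} {par : ℕ → ℕ} {A : ℕ → Finset ℕ}

theorem card_par_lt (T : AncTree n root par A) {v : ℕ} (hv : v < n) (h : v ≠ root) :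
    (A (par v)).card < (A v).card := by
  rw [T.anc_step v hv h, Finset.card_insert_of_notMem (T.notMem v hv h)]
  omega

/-- Induction from the root towards the leaves. -/
theorem induct (T : AncTree n root par A) {motive : ℕ → Prop} (h0 : motive root)
    (h1 : ∀ v < n, v ≠ root → motive (par v) → motive v) {v : ℕ} (hv : v < n) : motive v := by
  induction hk : (A v).card using Nat.strong_induction_on generalizing v with
  | _ k ih =>
    by_cases h : v = root
    · rw [h]; exact h0
    · exact h1 v hv h (ih _ (hk ▸ T.card_par_lt hv h) (T.par_lt v hv) rfl)

theorem self_mem (T : AncTree n root par A) {v : ℕ} (hv : v < n) : v ∈ A v := by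
  by_cases h : v = root
  · rw [h, T.anc_root]; simp
  · rw [T.anc_step v hv h]; simp

theorem anc_lt (T : AncTree n root par A) {u v : ℕ} (hv : v < n) (h : u ∈ A v) : u < n := by
  revert h
  refine T.induct (motive := fun v => u ∈ A v → u < n) ?_ ?_ hv
  · rw [T.anc_root]; simp only [Finset.mem_singleton]; rintro rfl; exact T.root_lt
  · intro v hv hr ih h
    rw [T.anc_step v hv hr, Finset.mem_insert] at h
    rcases h with rfl | h
    · exact hv
    · exact ih h

theorem anc_subset (T : AncTree n root par A) {u v : ℕ} (hv : v < n) (h : u ∈ A v) : A u ⊆ A v := by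
  revert h
  refine T.induct (motive := fun v => u ∈ A v → A u ⊆ A v) ?_ ?_ hv
  · rw [T.anc_root]; simp only [Finset.mem_singleton]; rintro rfl; rw [T.anc_root]
  · intro v hv hr ih h
    have h' := h
    rw [T.anc_step v hv hr, Finset.mem_insert] at h
    rcases h with rfl | h
    · exact subset_rfl
    · rw [T.anc_step v hv hr]
      exact (ih h).trans (Finset.subset_insert _ _)

theorem anc_antisymm (T : AncTree n root par A) {u v : ℕ} (hv : v < n) (h : u ∈ A v) (h' : v ∈ A u) :
    u = v := by
  by_contra hne
  have hu := T.anc_lt hv h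
  by_cases hr : v = root
  · rw [hr, T.anc_root, Finset.mem_singleton] at h; exact hne (h.trans hr.symm)
  · rw [T.anc_step v hv hr, Finset.mem_insert] at h
    rcases h with h | h
    · exact hne h
    · exact T.notMem v hv hr (T.anc_subset (T.par_lt v hv) h h')

theorem anc_total (T : AncTree n root par A) {x u v : ℕ} (hx : x < n) (hu : u ∈ A x) (hv : v ∈ A x) :
    u ∈ A v ∨ v ∈ A u := by
  revert hu hv
  refine T.induct (motive := fun x => u ∈ A x → v ∈ A x → u ∈ A v ∨ v ∈ A u) ?_ ?_ hx
  · rw [T.anc_root]; simp only [Finset.mem_singleton]; rintro rfl rfl; rw [T.anc_root]; simp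
  · intro x hx hr ih hu hv
    by_cases h1 : u = x
    · subst h1; exact .inr hv
    · by_cases h2 : v = x
      · subst h2; exact .inl hu
      · rw [T.anc_step x hx hr, Finset.mem_insert] at hu hv
        exact ih (hu.resolve_left h1) (hv.resolve_left h2)

theorem par_ne (T : AncTree n root par A) {v : ℕ} (hv : v < n) (hr : v ≠ root) : par v ≠ v := by
  intro h
  have := T.notMem v hv hr
  rw [h] at this
  exact this (T.self_mem hv)

theorem par_mem (T : AncTree n root par A) {v : ℕ} (hv : v < n) : par v ∈ A v := by
  by_cases hr : v = root
  · rw [hr, T.par_root]; exact T.self_mem T.root_lt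
  · rw [T.anc_step v hv hr]
    exact Finset.mem_insert_of_mem (T.self_mem (T.par_lt v hv))

theorem mem_par_of_ne (T : AncTree n root par A) {u v : ℕ} (hv : v < n) (h : u ∈ A v) (hne : u ≠ v) :
    u ∈ A (par v) := by
  by_cases hr : v = root
  · rw [hr, T.anc_root, Finset.mem_singleton] at h; exact absurd (h.trans hr.symm) hne
  · rw [T.anc_step v hv hr, Finset.mem_insert] at h
    exact h.resolve_left hne

theorem root_mem (T : AncTree n root par A) {v : ℕ} (hv : v < n) : root ∈ A v := by
  refine T.induct (motive := fun v => root ∈ A v) (T.self_mem T.root_lt) ?_ hv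
  intro v hv hr ih
  rw [T.anc_step v hv hr]
  exact Finset.mem_insert_of_mem ih

theorem mem_pathSet_top (T : AncTree n root par A) {v u : ℕ} (hu : u < n) (h : v ∈ A u) :
    v ∈ pathSet A v u := by
  simp [pathSet, h, T.self_mem (T.anc_lt hu h)]

theorem mem_pathSet_bot (T : AncTree n root par A) {v u : ℕ} (hu : u < n) (h : v ∈ A u) :
    u ∈ pathSet A v u := by
  simp [pathSet, h, T.self_mem hu]

/-- The ancestors of `u` are the path up to `v` together with the proper ancestors of `v`. So the
weight of a path is obtained in constant time from the weights of the paths to the root. -/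
theorem sum_anc (T : AncTree n root par A) (f : ℕ → ℝ) {v u : ℕ} (hu : u < n) (h : v ∈ A u) :
    ∑ y ∈ A u, f y = ∑ y ∈ pathSet A v u, f y + ∑ y ∈ A v, f y - f v := by
  have hv := T.anc_lt hu h
  have h1 : A u = pathSet A v u ∪ (A v).erase v := by
    ext y
    simp only [pathSet, Finset.mem_union, Finset.mem_filter, Finset.mem_erase]
    constructor
    · intro hy
      by_cases hvy : v ∈ A y
      · exact .inl ⟨hy, hvy⟩
      · refine .inr ⟨?_, (T.anc_total hu hy h).resolve_right hvy⟩
        rintro rfl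
        exact hvy (T.self_mem hv)
    · rintro (hy | hy)
      · exact hy.1
      · exact T.anc_subset hu h hy.2
  have h2 : Disjoint (pathSet A v u) ((A v).erase v) := by
    rw [Finset.disjoint_left]
    intro y hy hy'
    simp only [pathSet, Finset.mem_filter, Finset.mem_erase] at hy hy'
    exact hy'.1 (T.anc_antisymm hv hy'.2 hy.2)
  rw [h1, Finset.sum_union h2, ← Finset.add_sum_erase _ _ (T.self_mem hv)]
  ring

end AncTree

/-- `m` is the largest value of `s` on the set `X`. -/
def IsMaxVal (s : ℕ → ℝ) (X : Finset ℕ) (m : ℝ) : Prop := (∀ y ∈ X, s y ≤ m) ∧ ∃ y ∈ X, s y = m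

/-- The values `E` are tight on the path from `ch v` up to `v`, and they are feasible on all light
paths with top `v`. -/
structure PathCert (n : ℕ) (A : ℕ → Finset ℕ) (w s E : ℕ → ℝ) (w₀ : ℝ) (v u : ℕ) : Prop where
  lt : u < n
  anc : v ∈ A u
  light : ∑ y ∈ pathSet A v u, w y ≤ w₀
  tight : IsMaxVal s (pathSet A v u) (∑ y ∈ pathSet A v u, E y)
  feasible : ∀ x < n, v ∈ A x → ∑ y ∈ pathSet A v x, w y ≤ w₀ →
    ∀ m, IsMaxVal s (pathSet A v x) m → ∑ y ∈ pathSet A v x, E y ≤ m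

/-! ## The candidates below a node

`S` is a set of nodes, `D u` the set of those ancestors of `u` that have been treated. The heap `M`
holds the groups, ordered by the largest cost on the path; the heap `I x` holds the candidates of the
group `x`, the heap `O` the groups ordered by their best value, and `B` is a group under
construction. -/

open HTree in
/-- The invariant of the heaps of one component. -/
structure Component (D : ℕ → Finset ℕ) (w s : ℕ → ℝ) (w₀ : ℝ) (S : List ℕ) (M O : HTree)
    (I : ℕ → HTree) (B : HTree) (m : ℝ) (key val : ℕ → ℝ) : Prop where
  M_sub : ∀ x ∈ M.nodes, x ∈ S ∧ x ∈ D x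
  O_sub : ∀ x ∈ O.nodes, x ∈ S ∧ x ∈ D x
  I_sub : ∀ x ∈ M.nodes, ∀ u ∈ (I x).nodes, u ∈ S ∧ u ∈ D u ∧ IsMaxVal s (D u) (s x)
  B_sub : ∀ u ∈ B.nodes, u ∈ S ∧ u ∈ D u ∧ ∀ y ∈ D u, s y ≤ m
  -- A fused group is not searched for in `O`; it stays there with an empty candidate heap until it
  -- reaches the top.
  dead : ∀ x ∈ O.nodes, x ∉ M.nodes → I x = .nil
  -- Nothing is required of the value of a group without candidates: it can only waste one removal.
  live : ∀ x ∈ M.nodes, ∀ l u r, I x = .node l u r → x ∈ O.nodes ∧ val x = s x + key u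
  -- A candidate may be missing only if it is too heavy, and then it is too heavy for all later tops
  -- as well.
  complete : ∀ u ∈ S, u ∈ D u →
    (∃ x ∈ M.nodes, u ∈ (I x).nodes) ∨ u ∈ B.nodes ∨ w₀ < ∑ y ∈ D u, w y
  M_ord : M.Ord s
  O_ord : O.Ord val
  I_ord : ∀ x ∈ M.nodes, (I x).Ord key
  B_ord : B.Ord key

namespace Component

open HTree

variable {D D' : ℕ → Finset ℕ} {w s : ℕ → ℝ} {w₀ : ℝ} {S : List ℕ} {M O : HTree}
  {I I' : ℕ → HTree} {B : HTree} {m : ℝ} {key val key' val' : ℕ → ℝ}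

/-- A frame rule: the invariant reads its data only at nodes of `S`, so treating one component does
not disturb the others. -/
theorem congr (h : Component D w s w₀ S M O I B m key val) (hD : ∀ u ∈ S, D' u = D u)
    (hI : ∀ x ∈ S, x ∈ D x → I' x = I x) (hk : ∀ u ∈ S, key' u = key u)
    (hv : ∀ u ∈ S, val' u = val u) : Component D' w s w₀ S M O I' B m key' val' := by
  have eI : ∀ x ∈ M.nodes, I' x = I x := fun x hx => hI x (h.M_sub x hx).1 (h.M_sub x hx).2
  have eD : ∀ x ∈ M.nodes, ∀ u ∈ (I x).nodes, D' u = D u := fun x hx u hu =>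
    hD u (h.I_sub x hx u hu).1
  refine ⟨fun x hx => ?_, fun x hx => ?_, fun x hx u hu => ?_, fun u hu => ?_, fun x hx hx' => ?_,
    fun x hx l u r e => ?_, fun u hu hu' => ?_, h.M_ord, ?_, fun x hx => ?_, ?_⟩
  · rw [hD x (h.M_sub x hx).1]; exact h.M_sub x hx
  · rw [hD x (h.O_sub x hx).1]; exact h.O_sub x hx
  · rw [eI x hx] at hu
    rw [eD x hx u hu]; exact h.I_sub x hx u hu
  · rw [hD u (h.B_sub u hu).1]; exact h.B_sub u hu
  · rw [hI x (h.O_sub x hx).1 (h.O_sub x hx).2]; exact h.dead x hx hx'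
  · rw [eI x hx] at e
    rw [hv x (h.M_sub x hx).1, hk u (h.I_sub x hx u (by simp [e, nodes])).1]
    exact h.live x hx l u r e
  · rw [hD u hu] at hu' ⊢
    rcases h.complete u hu hu' with ⟨x, hx, hux⟩ | h1
    · exact .inl ⟨x, hx, by rwa [eI x hx]⟩
    · exact .inr h1
  · refine h.O_ord.congr fun x hx y hy hxy => ?_
    rwa [hv x (h.O_sub x hx).1, hv y (h.O_sub y hy).1]
  · rw [eI x hx]
    refine (h.I_ord x hx).congr fun a ha b hb hab => ?_
    rwa [hk a (h.I_sub x hx a ha).1, hk b (h.I_sub x hx b hb).1]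
  · refine h.B_ord.congr fun a ha b hb hab => ?_
    rwa [hk a (h.B_sub a ha).1, hk b (h.B_sub b hb).1]

/-- Change all keys by the same amount. -/
theorem shift (h : Component D w s w₀ S M O I B m key val) (δ : ℝ)
    (hk : ∀ u ∈ S, key' u = key u + δ) (hv : ∀ u ∈ S, val' u = val u + δ) :
    Component D w s w₀ S M O I B m key' val' := by
  refine ⟨h.M_sub, h.O_sub, h.I_sub, h.B_sub, h.dead, fun x hx l u r e => ?_, h.complete, h.M_ord,
    ?_, fun x hx => ?_, ?_⟩
  · rw [hv x (h.M_sub x hx).1, hk u (h.I_sub x hx u (by simp [e, nodes])).1,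
      (h.live x hx l u r e).2]
    exact ⟨(h.live x hx l u r e).1, by ring⟩
  · refine h.O_ord.congr fun x hx y hy hxy => ?_
    rw [hv x (h.O_sub x hx).1, hv y (h.O_sub y hy).1]; linarith
  · refine (h.I_ord x hx).congr fun a ha b hb hab => ?_
    rw [hk a (h.I_sub x hx a ha).1, hk b (h.I_sub x hx b hb).1]; linarith
  · refine h.B_ord.congr fun a ha b hb hab => ?_
    rw [hk a (h.B_sub a ha).1, hk b (h.B_sub b hb).1]; linarith

/-- Two components are joined. -/
theorem union {S₁ S₂ S : List ℕ} {M₁ M₂ O₁ O₂ : HTree} {m₁ m₂ : ℝ}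
    (h₁ : Component D w s w₀ S₁ M₁ O₁ I .nil m₁ key val)
    (h₂ : Component D w s w₀ S₂ M₂ O₂ I .nil m₂ key val) (hS : ∀ x, x ∈ S ↔ x ∈ S₁ ∨ x ∈ S₂) :
    Component D w s w₀ S (meld s M₁ M₂) (meld val O₁ O₂) I .nil m key val := by
  refine ⟨fun x hx => ?_, fun x hx => ?_, fun x hx u hu => ?_, by simp [nodes],
    fun x hx hx' => ?_, fun x hx l u r e => ?_, fun u hu hu' => ?_, ord_meld h₁.M_ord h₂.M_ord,
    ord_meld h₁.O_ord h₂.O_ord, fun x hx => ?_, trivial⟩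
  · rw [mem_meld] at hx
    rw [hS]
    rcases hx with hx | hx
    · exact ⟨.inl (h₁.M_sub x hx).1, (h₁.M_sub x hx).2⟩
    · exact ⟨.inr (h₂.M_sub x hx).1, (h₂.M_sub x hx).2⟩
  · rw [mem_meld] at hx
    rw [hS]
    rcases hx with hx | hx
    · exact ⟨.inl (h₁.O_sub x hx).1, (h₁.O_sub x hx).2⟩
    · exact ⟨.inr (h₂.O_sub x hx).1, (h₂.O_sub x hx).2⟩
  · rw [mem_meld] at hx
    rw [hS]
    rcases hx with hx | hx
    · exact ⟨.inl (h₁.I_sub x hx u hu).1, (h₁.I_sub x hx u hu).2⟩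
    · exact ⟨.inr (h₂.I_sub x hx u hu).1, (h₂.I_sub x hx u hu).2⟩
  · rw [mem_meld] at hx hx'
    push Not at hx'
    rcases hx with hx | hx
    · exact h₁.dead x hx hx'.1
    · exact h₂.dead x hx hx'.2
  · rw [mem_meld] at hx ⊢
    rcases hx with hx | hx
    · exact ⟨.inl (h₁.live x hx l u r e).1, (h₁.live x hx l u r e).2⟩
    · exact ⟨.inr (h₂.live x hx l u r e).1, (h₂.live x hx l u r e).2⟩
  · simp only [mem_meld]
    rw [hS] at hu
    rcases hu with hu | hu
    · rcases h₁.complete u hu hu' with ⟨x, hx, h⟩ | h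
      · exact .inl ⟨x, .inl hx, h⟩
      · exact .inr h
    · rcases h₂.complete u hu hu' with ⟨x, hx, h⟩ | h
      · exact .inl ⟨x, .inr hx, h⟩
      · exact .inr h
  · rw [mem_meld] at hx
    rcases hx with hx | hx
    · exact h₁.I_ord x hx
    · exact h₂.I_ord x hx

/-- The first group is merged into the group under construction. -/
theorem absorb {l r : HTree} {x : ℕ} (h : Component D w s w₀ S (node l x r) O I B m key val)
    (hx : s x ≤ m) (hn : (node l x r).nodes.Nodup) :
    Component D w s w₀ S (meld s l r) O (Function.update I x nil) (meld key B (I x)) m key val := by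
  have hsub : ∀ y ∈ (meld s l r).nodes, y ∈ (node l x r).nodes ∧ y ≠ x := by
    intro y hy
    rw [mem_meld] at hy
    simp only [nodes, List.nodup_cons, List.mem_append] at hn
    refine ⟨by simp [nodes, hy], ?_⟩
    rintro rfl
    exact hn.1 hy
  have hxm : x ∈ (node l x r).nodes := by simp [nodes]
  refine ⟨fun y hy => h.M_sub y (hsub y hy).1, h.O_sub, fun y hy u hu => ?_, fun u hu => ?_,
    fun y hy hy' => ?_, fun y hy a u b e => ?_, fun u hu hu' => ?_, ord_meld h.M_ord.2.1 h.M_ord.2.2,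
    h.O_ord, fun y hy => ?_, ord_meld h.B_ord (h.I_ord x hxm)⟩
  · rw [Function.update_of_ne (hsub y hy).2] at hu
    exact h.I_sub y (hsub y hy).1 u hu
  · rw [mem_meld] at hu
    rcases hu with hu | hu
    · exact h.B_sub u hu
    · obtain ⟨h1, h2, h3⟩ := h.I_sub x hxm u hu
      exact ⟨h1, h2, fun y hy => (h3.1 y hy).trans hx⟩
  -- `x` has left `M` but not `O`: it has just become a dead group.
  · by_cases e : y = x
    · simp [e]
    · rw [Function.update_of_ne e]
      refine h.dead y hy fun hm => hy' ?_
      simp only [nodes, List.mem_cons, List.mem_append, e, false_or] at hm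
      rwa [mem_meld]
  · rw [Function.update_of_ne (hsub y hy).2] at e
    exact h.live y (hsub y hy).1 a u b e
  · rcases h.complete u hu hu' with ⟨y, hy, h1⟩ | h1 | h1
    · by_cases e : y = x
      · subst e
        exact .inr (.inl (mem_meld.2 (.inr h1)))
      · refine .inl ⟨y, ?_, by rwa [Function.update_of_ne e]⟩
        simp only [nodes, List.mem_cons, List.mem_append, e, false_or] at hy
        rwa [mem_meld]
    · exact .inr (.inl (mem_meld.2 (.inl h1)))
    · exact .inr (.inr h1)
  · rw [Function.update_of_ne (hsub y hy).2]
    exact h.I_ord y (hsub y hy).1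

/-- The node `v` is added to the paths of all candidates, and as a new candidate. -/
theorem insert {v : ℕ} (h : Component D w s w₀ S M O I B (s v) key val)
    (hv : v ∈ S) (hvD : ∀ u ∈ S, v ∉ D u) (hD0 : D v = ∅) (hD' : ∀ u ∈ S, D' u = Insert.insert v (D u))
    (hM : ∀ x ∈ M.nodes, s v < s x) (hw : 0 ≤ w v) (hI' : ∀ x, x ≠ v → I' x = I x)
    (hIv : I' v = meld key B (node nil v nil))
    (hval : ∀ x, x ≠ v → val' x = val x)
    (hvalv : ∀ l u r, I' v = node l u r → val' v = s v + key u) :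
    Component D' w s w₀ S (meld s M (node nil v nil)) (meld val' O (node nil v nil)) I' nil m
      key val' := by
  have hvM : ∀ x ∈ M.nodes, x ≠ v := by
    rintro x hx rfl
    exact hvD _ hv (h.M_sub _ hx).2
  have hvO : ∀ x ∈ O.nodes, x ≠ v := by
    rintro x hx rfl
    exact hvD _ hv (h.O_sub _ hx).2
  have hvv : v ∈ D' v := by rw [hD' v hv]; simp
  refine ⟨fun x hx => ?_, fun x hx => ?_, fun x hx u hu => ?_, by simp [nodes],
    fun x hx hx' => ?_, fun x hx l u r e => ?_, fun u hu hu' => ?_, ord_meld h.M_ord ?_,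
    ord_meld ?_ ?_, fun x hx => ?_, trivial⟩
  · simp only [mem_meld, nodes, List.append_nil, List.mem_singleton] at hx
    rcases hx with hx | rfl
    · have := h.M_sub x hx
      rw [hD' x this.1]
      exact ⟨this.1, Finset.mem_insert_of_mem this.2⟩
    · exact ⟨hv, hvv⟩
  · simp only [mem_meld, nodes, List.append_nil, List.mem_singleton] at hx
    rcases hx with hx | rfl
    · have := h.O_sub x hx
      rw [hD' x this.1]
      exact ⟨this.1, Finset.mem_insert_of_mem this.2⟩
    · exact ⟨hv, hvv⟩
  · simp only [mem_meld, nodes, List.append_nil, List.mem_singleton] at hx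
    rcases hx with hx | rfl
    · rw [hI' x (hvM x hx)] at hu
      obtain ⟨h1, h2, h3, y, hy, h4⟩ := h.I_sub x hx u hu
      rw [hD' u h1]
      -- A remaining group costs more than `s v`, so adding `v` to its paths leaves their maximum
      -- unchanged.
      refine ⟨h1, Finset.mem_insert_of_mem h2, fun z hz => ?_, y, Finset.mem_insert_of_mem hy, h4⟩
      rcases Finset.mem_insert.1 hz with rfl | hz
      · exact (hM x hx).le
      · exact h3 z hz
    · rw [hIv] at hu
      simp only [mem_meld, nodes, List.append_nil, List.mem_singleton] at hu
      rcases hu with hu | rfl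
      · obtain ⟨h1, h2, h3⟩ := h.B_sub u hu
        rw [hD' u h1]
        -- For the collected candidates all earlier costs are at most `s v`, so the new node itself
        -- attains the maximum.
        refine ⟨h1, Finset.mem_insert_of_mem h2, fun z hz => ?_, x, Finset.mem_insert_self _ _, rfl⟩
        rcases Finset.mem_insert.1 hz with rfl | hz
        · exact le_rfl
        · exact h3 z hz
      · refine ⟨hv, hvv, ?_⟩
        rw [hD' u hv, hD0]
        simp [IsMaxVal]
  · simp only [mem_meld, nodes, List.append_nil, List.mem_singleton] at hx hx'
    push Not at hx'
    rcases hx with hx | hx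
    · rw [hI' x hx'.2]
      exact h.dead x hx hx'.1
    · exact absurd hx hx'.2
  · simp only [mem_meld, nodes, List.append_nil, List.mem_singleton] at hx ⊢
    rcases hx with hx | rfl
    · rw [hI' x (hvM x hx)] at e
      rw [hval x (hvM x hx)]
      exact ⟨.inl (h.live x hx l u r e).1, (h.live x hx l u r e).2⟩
    · exact ⟨.inr rfl, hvalv l u r e⟩
  · simp only [mem_meld, nodes, List.append_nil, List.mem_singleton, List.not_mem_nil, false_or]
    by_cases e : u = v
    · subst e
      refine .inl ⟨u, .inr rfl, ?_⟩
      rw [hIv, mem_meld]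
      simp [nodes]
    · rw [hD' u hu, Finset.mem_insert] at hu'
      rcases h.complete u hu (hu'.resolve_left e) with ⟨x, hx, h1⟩ | h1 | h1
      · exact .inl ⟨x, .inl hx, by rwa [hI' x (hvM x hx)]⟩
      · refine .inl ⟨v, .inr rfl, ?_⟩
        rw [hIv, mem_meld]
        exact .inl h1
      -- Heavy stays heavy, because `w v` is non-negative.
      · right
        rw [hD' u hu, Finset.sum_insert (hvD u hu)]
        linarith
  · simp [HTree.Ord, nodes]
  · refine h.O_ord.congr fun x hx y hy hxy => ?_
    rwa [hval x (hvO x hx), hval y (hvO y hy)]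
  · simp [HTree.Ord, nodes]
  · simp only [mem_meld, nodes, List.append_nil, List.mem_singleton] at hx
    rcases hx with hx | rfl
    · rw [hI' x (hvM x hx)]
      exact h.I_ord x hx
    · rw [hIv]
      exact ord_meld h.B_ord (by simp [HTree.Ord, nodes])

/-- An empty group is removed. -/
theorem pop_dead {l r : HTree} {x : ℕ} (h : Component D w s w₀ S M (node l x r) I B m key val)
    (hx : I x = nil) : Component D w s w₀ S M (meld val l r) I B m key val := by
  have hsub : ∀ y ∈ (meld val l r).nodes, y ∈ (node l x r).nodes := by
    intro y hy
    rw [mem_meld] at hy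
    simp [nodes, hy]
  refine ⟨h.M_sub, fun y hy => h.O_sub y (hsub y hy), h.I_sub, h.B_sub, fun y hy => h.dead y (hsub y hy),
    fun y hy a u b e => ⟨?_, (h.live y hy a u b e).2⟩, h.complete, h.M_ord,
    ord_meld h.O_ord.2.1 h.O_ord.2.2, h.I_ord, h.B_ord⟩
  have h1 := (h.live y hy a u b e).1
  have h2 : y ≠ x := by
    rintro rfl
    simp [hx] at e
  simp only [nodes, List.mem_cons, List.mem_append, h2, false_or] at h1
  rwa [mem_meld]

/-- A candidate that is too heavy is removed; the group becomes empty. -/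
theorem pop_heavy_last {l r a b : HTree} {x u : ℕ}
    (h : Component D w s w₀ S M (node l x r) I nil m key val)
    (hx : I x = node a u b) (hu : w₀ < ∑ y ∈ D u, w y)
    (hab : meld key a b = nil) :
    Component D w s w₀ S M (meld val l r) (Function.update I x (meld key a b)) nil m key val := by
  -- A group of `O` outside `M` would have an empty candidate heap.
  have hxM : x ∈ M.nodes := by
    by_contra hM
    have := h.dead x (by simp [nodes]) hM
    simp [hx] at this
  have hsub : ∀ y ∈ (meld val l r).nodes, y ∈ (node l x r).nodes := by
    intro y hy
    rw [mem_meld] at hy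
    simp [nodes, hy]
  rw [hab]
  refine ⟨h.M_sub, fun y hy => h.O_sub y (hsub y hy), fun y hy z hz => ?_, h.B_sub,
    fun y hy hy' => ?_, fun y hy c z d e => ?_, fun z hz hz' => ?_, h.M_ord,
    ord_meld h.O_ord.2.1 h.O_ord.2.2, fun y hy => ?_, h.B_ord⟩
  · by_cases e : y = x
    · subst e; simp [nodes] at hz
    · rw [Function.update_of_ne e] at hz
      exact h.I_sub y hy z hz
  · by_cases e : y = x
    · subst e; simp
    · rw [Function.update_of_ne e]
      exact h.dead y (hsub y hy) hy'
  · by_cases e' : y = x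
    · subst e'; simp at e
    · rw [Function.update_of_ne e'] at e
      have h1 := h.live y hy c z d e
      refine ⟨?_, h1.2⟩
      have h2 := h1.1
      simp only [nodes, List.mem_cons, List.mem_append, e', false_or] at h2
      rwa [mem_meld]
  · rcases h.complete z hz hz' with ⟨y, hy, h1⟩ | h1
    · by_cases e : y = x
      · subst e
        rw [hx] at h1
        have h2 : ¬ (z ∈ a.nodes ∨ z ∈ b.nodes) := by
          rw [← mem_meld (key := key), hab]; simp [nodes]
        simp only [nodes, List.mem_cons, List.mem_append, h2, or_false] at h1
        subst h1
        exact .inr (.inr hu)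
      · exact .inl ⟨y, hy, by rwa [Function.update_of_ne e]⟩
    · exact .inr h1
  · by_cases e : y = x
    · subst e; simp [HTree.Ord]
    · rw [Function.update_of_ne e]
      exact h.I_ord y hy

/-- A candidate that is too heavy is removed, and the group gets a new value. -/
theorem pop_heavy {l r a b : HTree} {x u : ℕ}
    (h : Component D w s w₀ S M (node l x r) I nil m key val) (hn : (node l x r).nodes.Nodup)
    (hx : I x = node a u b) (hu : w₀ < ∑ y ∈ D u, w y)
    (hval : ∀ y, y ≠ x → val' y = val y)
    (hvalx : ∀ c z d, meld key a b = node c z d → val' x = s x + key z) :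
    Component D w s w₀ S M (meld val' (meld val l r) (node nil x nil))
      (Function.update I x (meld key a b)) nil m key val' := by
  have hxM : x ∈ M.nodes := by
    by_contra hM
    have := h.dead x (by simp [nodes]) hM
    simp [hx] at this
  have hsub : ∀ y ∈ (meld val' (meld val l r) (node nil x nil)).nodes, y ∈ (node l x r).nodes := by
    intro y hy
    simp only [mem_meld, nodes, List.append_nil, List.mem_singleton] at hy
    simp only [nodes, List.mem_cons, List.mem_append]
    tauto
  have hne : ∀ y ∈ (meld val l r).nodes, y ≠ x := by
    rintro y hy rfl
    simp only [nodes, List.nodup_cons, List.mem_append] at hn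
    rw [mem_meld] at hy
    exact hn.1 hy
  have hxI : ∀ z, z ∈ (meld key a b).nodes → z ∈ (I x).nodes := by
    intro z hz
    rw [mem_meld] at hz
    simp [hx, nodes, hz]
  refine ⟨h.M_sub, fun y hy => h.O_sub y (hsub y hy), fun y hy z hz => ?_, h.B_sub,
    fun y hy hy' => ?_, fun y hy c z d e => ?_, fun z hz hz' => ?_, h.M_ord,
    ord_meld ?_ ?_, fun y hy => ?_, h.B_ord⟩
  · by_cases e : y = x
    · subst e; simp only [Function.update_self] at hz
      exact h.I_sub y hy z (hxI z hz)
    · rw [Function.update_of_ne e] at hz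
      exact h.I_sub y hy z hz
  · by_cases e : y = x
    · subst e; exact absurd hxM hy'
    · rw [Function.update_of_ne e]
      exact h.dead y (hsub y hy) hy'
  · simp only [mem_meld, nodes, List.append_nil, List.mem_singleton]
    by_cases e' : y = x
    · subst e'
      exact ⟨.inr rfl, hvalx c z d (by simpa using e)⟩
    · rw [Function.update_of_ne e'] at e
      have h1 := h.live y hy c z d e
      refine ⟨.inl ?_, by rw [hval y e', h1.2]⟩
      have h2 := h1.1
      simpa only [nodes, List.mem_cons, List.mem_append, e', false_or] using h2
  · rcases h.complete z hz hz' with ⟨y, hy, h1⟩ | h1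
    · by_cases e : y = x
      · subst e
        by_cases ez : z = u
        · subst ez
          exact .inr (.inr hu)
        · refine .inl ⟨y, hy, ?_⟩
          rw [hx] at h1
          simp only [nodes, List.mem_cons, List.mem_append, ez, false_or] at h1
          rw [Function.update_self, mem_meld]
          exact h1
      · exact .inl ⟨y, hy, by rwa [Function.update_of_ne e]⟩
    · exact .inr h1
  -- The value of `x` changes while `x` is outside the heap; the nodes that remain keep their values
  -- and hence their order.
  · refine (ord_meld h.O_ord.2.1 h.O_ord.2.2).congr fun y hy z hz hyz => ?_
    rwa [hval y (hne y hy), hval z (hne z hz)]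
  · simp [HTree.Ord, nodes]
  · by_cases e : y = x
    · subst e
      rw [Function.update_self]
      have := h.I_ord y hy
      rw [hx] at this
      exact ord_meld this.2.1 this.2.2
    · rw [Function.update_of_ne e]
      exact h.I_ord y hy

theorem key_root_le {t : HTree} {l r : HTree} {u z : ℕ} (h : t.Ord key) (e : t = node l u r)
    (hz : z ∈ t.nodes) : key u ≤ key z := by
  subst e
  simp only [nodes, List.mem_cons] at hz
  rcases hz with rfl | hz
  · exact le_rfl
  · exact h.1 z hz

/-- Every light candidate has a value not below the smallest one. -/
theorem value_le {l r a b : HTree} {x u : ℕ}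
    (h : Component D w s w₀ S M (node l x r) I nil m key val) (hx : I x = node a u b)
    {z : ℕ} (hz : z ∈ S) (hzD : z ∈ D z) (hzw : ∑ y ∈ D z, w y ≤ w₀) {m' : ℝ}
    (hm : IsMaxVal s (D z) m') : s x + key u ≤ m' + key z := by
  have hxM : x ∈ M.nodes := by
    by_contra hM
    have := h.dead x (by simp [nodes]) hM
    simp [hx] at this
  rcases h.complete z hz hzD with ⟨y, hy, h1⟩ | h1 | h1
  · have h2 := (h.I_sub y hy z h1).2.2
    have h3 : s y = m' := by
      obtain ⟨p, hp, e⟩ := hm.2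
      obtain ⟨q, hq, e'⟩ := h2.2
      have := hm.1 q hq
      have := h2.1 p hp
      linarith
    cases e : I y with
    | nil => simp [e, nodes] at h1
    | node c q d =>
      have h4 := h.live y hy c q d e
      -- Two levels of minima: the top of `I y` bounds the key of `z`, and the top of `O` bounds the
      -- value of the group `y`.
      have h5 := key_root_le (h.I_ord y hy) e h1
      have h6 := key_root_le h.O_ord rfl h4.1
      have h7 := (h.live x hxM a u b hx).2
      linarith [h4.2]
  · simp [nodes] at h1
  · exact absurd hzw (not_le.2 h1)

/-- As long as there is a light candidate, the heap of groups is not empty. -/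
theorem O_ne_nil (h : Component D w s w₀ S M O I nil m key val)
    {z : ℕ} (hz : z ∈ S) (hzD : z ∈ D z) (hzw : ∑ y ∈ D z, w y ≤ w₀) : O ≠ nil := by
  rintro rfl
  rcases h.complete z hz hzD with ⟨y, hy, h1⟩ | h1 | h1
  · cases e : I y with
    | nil => simp [e, nodes] at h1
    | node c q d => simpa [nodes] using (h.live y hy c q d e).1
  · simp [nodes] at h1
  · exact absurd hzw (not_le.2 h1)

end Component

/-! ## The treatment of one node -/

/-- An instance of the chain partition problem, with an order in which children come before their
parents, and the weights `W` of the paths to the root. -/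
structure ChainData where
  n : ℕ
  root : ℕ
  par : ℕ → ℕ
  A : ℕ → Finset ℕ
  w : ℕ → ℝ
  s : ℕ → ℝ
  W : ℕ → ℝ
  w₀ : ℝ
  ord : ℕ → ℕ
  tree : AncTree n root par A
  w_nonneg : ∀ v < n, 0 ≤ w v
  w_le : ∀ v < n, w v ≤ w₀
  W_eq : ∀ v < n, W v = ∑ y ∈ A v, w y
  ord_lt : ∀ i < n, ord i < n
  ord_inj : ∀ i < n, ∀ j < n, ord i = ord j → i = j
  ord_par : ∀ i < n, ord i ≠ root → ∃ j < n, i < j ∧ ord j = par (ord i)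

namespace RAM

open HTree NExpr

/-- The memory holds the instance and the three families of heaps. -/
structure Core (P : ChainData) (σ : State) (tM tO tI : ℕ → HTree) : Prop where
  par : σ.narr 0 = P.par
  ord : σ.narr 3 = P.ord
  w₀ : σ.rvar 0 = P.w₀
  w : σ.rarr 0 = P.w
  s : σ.rarr 1 = P.s
  W : σ.rarr 6 = P.W
  hM : HeapsAt P.n 0 σ tM
  hO : HeapsAt P.n 4 σ tO
  hI : HeapsAt P.n 8 σ tI

/-- `τ` differs from `σ` only in the heaps and in auxiliary variables. -/
structure NodeFrame (σ τ : State) : Prop where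
  rvar : τ.rvar = σ.rvar
  nvar : ∀ x, x = 0 ∨ 10 ≤ x → x ≠ 12 → x ≠ 13 → τ.nvar x = σ.nvar x
  narr : ∀ a < 9, τ.narr a = σ.narr a
  rarr : ∀ a, a ≠ 3 → τ.rarr a = σ.rarr a

theorem NodeFrame.refl (σ : State) : NodeFrame σ σ :=
  ⟨rfl, fun _ _ _ _ => rfl, fun _ _ => rfl, fun _ _ => rfl⟩

theorem NodeFrame.trans {σ τ υ : State} (h : NodeFrame σ τ) (h' : NodeFrame τ υ) :
    NodeFrame σ υ where
  rvar := h'.rvar.trans h.rvar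
  nvar x h1 h2 h3 := (h'.nvar x h1 h2 h3).trans (h.nvar x h1 h2 h3)
  narr a ha := (h'.narr a ha).trans (h.narr a ha)
  rarr a ha := (h'.rarr a ha).trans (h.rarr a ha)

theorem HeapFrame.nodeFrame {k : ℕ} {σ τ : State} (h : HeapFrame k σ τ) : NodeFrame σ τ :=
  ⟨h.rvar, fun x h1 _ _ => h.nvar x (by omega), fun a ha => h.narr a (by omega) (by omega),
    fun _ _ => by rw [h.rarr]⟩

section

variable {P : ChainData} {σ τ : State} {tM tO tI t : ℕ → HTree}

/-- Relevant here are the natural arrays `0` (parents), `3` (order), `10` to `21` (heaps) and the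
real arrays `0`, `1`, `6` (weights, costs, path weights). The other data may vary: keys, values,
offsets and E in the real arrays `2` to `5`, path ends in the natural array `5`, list pointers in
`6` and `7`. -/
theorem Core.of_eq (h : Core P σ tM tO tI) (h0 : τ.nvar 0 = σ.nvar 0)
    (h1 : ∀ a, a = 0 ∨ a = 3 ∨ 10 ≤ a ∧ a ≤ 21 → τ.narr a = σ.narr a)
    (h2 : τ.rvar 0 = σ.rvar 0) (h3 : ∀ a, a = 0 ∨ a = 1 ∨ a = 6 → τ.rarr a = σ.rarr a) :
    Core P τ tM tO tI where
  par := by rw [h1 0 (by simp), h.par]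
  ord := by rw [h1 3 (by simp), h.ord]
  w₀ := by rw [h2, h.w₀]
  w := by rw [h3 0 (by simp), h.w]
  s := by rw [h3 1 (by simp), h.s]
  W := by rw [h3 6 (by simp), h.W]
  hM := h.hM.of_eq h0 fun a _ _ => h1 a (by omega)
  hO := h.hO.of_eq h0 fun a _ _ => h1 a (by omega)
  hI := h.hI.of_eq h0 fun a _ _ => h1 a (by omega)

theorem Core.of_frameM (h : Core P σ tM tO tI) (hF : HeapFrame 0 σ τ) (ht : HeapsAt P.n 0 τ t) :
    Core P τ t tO tI where
  par := by rw [hF.narr 0 (by omega) (by omega), h.par]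
  ord := by rw [hF.narr 3 (by omega) (by omega), h.ord]
  w₀ := by rw [hF.rvar, h.w₀]
  w := by rw [hF.rarr, h.w]
  s := by rw [hF.rarr, h.s]
  W := by rw [hF.rarr, h.W]
  hM := ht
  hO := hF.heapsAt h.hO (by omega)
  hI := hF.heapsAt h.hI (by omega)

theorem Core.of_frameO (h : Core P σ tM tO tI) (hF : HeapFrame 4 σ τ) (ht : HeapsAt P.n 4 τ t) :
    Core P τ tM t tI where
  par := by rw [hF.narr 0 (by omega) (by omega), h.par]
  ord := by rw [hF.narr 3 (by omega) (by omega), h.ord]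
  w₀ := by rw [hF.rvar, h.w₀]
  w := by rw [hF.rarr, h.w]
  s := by rw [hF.rarr, h.s]
  W := by rw [hF.rarr, h.W]
  hM := hF.heapsAt h.hM (by omega)
  hO := ht
  hI := hF.heapsAt h.hI (by omega)

theorem Core.of_frameI (h : Core P σ tM tO tI) (hF : HeapFrame 8 σ τ) (ht : HeapsAt P.n 8 τ t) :
    Core P τ tM tO t where
  par := by rw [hF.narr 0 (by omega) (by omega), h.par]
  ord := by rw [hF.narr 3 (by omega) (by omega), h.ord]
  w₀ := by rw [hF.rvar, h.w₀]
  w := by rw [hF.rarr, h.w]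
  s := by rw [hF.rarr, h.s]
  W := by rw [hF.rarr, h.W]
  hM := hF.heapsAt h.hM (by omega)
  hO := hF.heapsAt h.hO (by omega)
  hI := ht

end

/-! ### Fusing the groups of small cost -/

/-- Merge all groups whose cost is at most that of the node in variable `11`. -/
def absorbProg : Prog :=
  .loop (.and (.not (.eqN (get 13 (var 11)) (var 0)))
      (.leR (.get 1 (get 13 (var 11))) (.get 1 (var 11))))
    (.setN 12 (get 13 (var 11)) ;; moveProg 8 2 11 12 ;; popProg 0 1 11)

/-- The facts about the heaps and a component that hold while the groups of `v` are merged. -/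
structure Absorbing (P : ChainData) (D : ℕ → Finset ℕ) (S : List ℕ) (v : ℕ) (σ : State)
    (tM tO tI : ℕ → HTree) : Prop extends Core P σ tM tO tI where
  var : σ.nvar 11 = v
  lt : v < P.n
  fresh : v ∉ D v
  comp : Component D P.w P.s P.w₀ S (tM v) (tO v) tI (tI v) (P.s v) (σ.rarr 2) (σ.rarr 3)
  I_only : ∀ x, tI x ≠ .nil → x = v ∨ ∃ r, x ∈ (tM r).nodes

/-- Each round removes a node from the heap `M` of `v`, and the credit `2 * heapTime P.n + 40` of
that node pays for one move and one removal. The group under construction lives in the candidate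
heap of `v` itself. The loop stops correctly at the first top with cost above `P.s v`, as the top is
the minimum. -/
theorem absorbProg_spec {P : ChainData} {D : ℕ → Finset ℕ} {S : List ℕ} {v : ℕ} {σ : State}
    {tM tO tI : ℕ → HTree} {c : ℕ} (h : Absorbing P D S v σ tM tO tI) (d : ℕ)
    (hc : (2 * heapTime P.n + 40) * heapCount P.n tM + 20 + d ≤ c) :
    WP absorbProg (fun τ c' => NodeFrame σ τ ∧ τ.rarr = σ.rarr ∧ ∃ tM' tI',
      Absorbing P D S v τ tM' tO tI' ∧ (∀ y, y ≠ v → tM' y = tM y) ∧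
      (∀ y, y ≠ v → ¬ (y ∈ S ∧ y ∈ D y) → tI' y = tI y) ∧ (∀ x ∈ (tM' v).nodes, P.s v < P.s x) ∧
      heapCount P.n tI' = heapCount P.n tI ∧
      (2 * heapTime P.n + 40) * heapCount P.n tM' + d ≤ c') σ c := by
  refine WP.loop (fun τ c' => NodeFrame σ τ ∧ τ.rarr = σ.rarr ∧ ∃ tM' tI',
      Absorbing P D S v τ tM' tO tI' ∧ (∀ y, y ≠ v → tM' y = tM y) ∧
      (∀ y, y ≠ v → ¬ (y ∈ S ∧ y ∈ D y) → tI' y = tI y) ∧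
      heapCount P.n tI' = heapCount P.n tI ∧
      (2 * heapTime P.n + 40) * heapCount P.n tM' + 20 + d ≤ c') ?_
    ⟨NodeFrame.refl σ, rfl, tM, tI, h, fun _ _ => rfl, fun _ _ _ => rfl, rfl, hc⟩
  clear h hc c
  rintro τ c ⟨hF, hr, tM1, tI1, h, hM1, hI1, hcI, hc⟩
  have hst := h.hM.stored v h.lt
  have hnil := hst.eq_nil_iff
  simp only [Nat.zero_add] at hst hnil
  by_cases hb : tM1 v = .nil ∨ P.s v < P.s (τ.narr 13 v)
  · right
    refine ⟨?_, (2 * heapTime P.n + 40) * heapCount P.n tM1 + d, by simp; omega,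
      hF, hr, tM1, tI1, h, hM1, hI1, ?_, hcI, le_rfl⟩
    · simp only [Test.Holds, eval, RExpr.eval, h.var, h.s, hnil, not_and, not_le]
      intro h1
      exact hb.resolve_left h1
    · intro x hx
      rcases hb with hb | hb
      · simp [hb, nodes] at hx
      · obtain ⟨l, r, e, -⟩ := hst.exists_node (by
          rw [Ne, hnil]; rintro e; simp [e, nodes] at hx)
        exact hb.trans_le (Component.key_root_le h.comp.M_ord e hx)
  · left
    push Not at hb
    obtain ⟨hne, hle⟩ := hb
    obtain ⟨l, r, e, -⟩ := hst.exists_node (by rwa [Ne, hnil])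
    set x := τ.narr 13 v with hx
    have hxm : x ∈ (tM1 v).nodes := by simp [e, nodes]
    have hxn : x < P.n := h.hM.lt v x hxm
    have hxv : v ≠ x := by
      rintro e'
      rw [← e'] at hxm
      exact h.fresh (h.comp.M_sub v hxm).2
    have hcM := heapCount_popHeap (key := P.s) h.lt hne
    set N := heapCount P.n (popHeap P.s tM1 v) with hN
    rw [← hcM] at hc
    refine ⟨?_, (2 * heapTime P.n + 40) * N + 2 * heapTime P.n + 30 + d, ?_, ?_⟩
    · simp only [Test.Holds, eval, RExpr.eval, h.var, h.s, hnil]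
      exact ⟨fun e' => hne (hnil.1 e'), hle⟩
    · simp only [Test.cost, cost, RExpr.cost]
      have : (2 * heapTime P.n + 40) * (N + 1) = (2 * heapTime P.n + 40) * N + 2 * heapTime P.n + 40 := by
        ring
      omega
    refine WP.seq (WP.block (by simp) ((2 * heapTime P.n + 40) * N + 2 * heapTime P.n + 20 + d)
      (by simp; omega) ?_)
    set τ1 := Prog.run (.setN 12 (get 13 (var 11))) τ with hτ1
    have hc1 : Core P τ1 tM1 tO tI1 := h.toCore.of_eq (by simp [hτ1]) (fun _ _ => rfl) rfl
      (fun _ _ => rfl)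
    have ev : τ1.nvar 11 = v := by simp [hτ1, h.var]
    have ex : τ1.nvar 12 = x := by simp [hτ1, h.var, hx]
    have hF1 : NodeFrame τ τ1 := ⟨rfl, fun y _ h2 _ => by simp [hτ1, h2], fun _ _ => rfl,
      fun _ _ => rfl⟩
    refine WP.seq (WP.mono (moveProg_spec hc1.hI (by norm_num) (by norm_num) (by rw [ev]; exact h.lt)
      (by rw [ex]; exact hxn) (by rw [ev, ex]; exact hxv)
      ((2 * heapTime P.n + 40) * N + heapTime P.n + 20 + d) (by omega)) ?_)
    rintro τ2 c2 ⟨hc2, hF2, hI2⟩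
    rw [ev, ex] at hI2
    have hr1 : τ1.rarr = τ.rarr := rfl
    rw [hr1] at hI2
    have hco2 := hc1.of_frameI hF2 hI2
    have ev2 : τ2.nvar 11 = v := by rw [hF2.nvar _ (by omega), ev]
    refine WP.mono (popProg_spec hco2.hM (by norm_num) (by rw [ev2]; exact h.lt)
      (by rw [ev2]; exact hne) ((2 * heapTime P.n + 40) * N + 20 + d) (by omega)) ?_
    rintro τ3 c3 ⟨hc3, hF3, hM3⟩
    rw [ev2, hco2.s] at hM3
    have hco3 := hco2.of_frameM hF3 hM3
    have hrr : τ3.rarr = τ.rarr := by rw [hF3.rarr, hF2.rarr, hr1]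
    have hmv : ∀ y, y ≠ v → popHeap P.s tM1 v y = tM1 y := fun y hy => by simp [popHeap, hy]
    have hpv : popHeap P.s tM1 v v = meld P.s l r := by simp [popHeap, e]
    have hiv : moveHeap (τ.rarr 2) tI1 v x v = meld (τ.rarr 2) (tI1 v) (tI1 x) := by
      simp [moveHeap, hxv]
    have hvM := h.fresh
    refine ⟨((hF.trans hF1).trans hF2.nodeFrame).trans hF3.nodeFrame, by rw [hrr, hr], _, _,
      ⟨hco3, ?_, h.lt, h.fresh, ?_, ?_⟩, ?_, ?_, ?_, ?_⟩
    · rw [hF3.nvar _ (by omega), ev2]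
    · rw [hpv, hiv, hrr]
      have h1 := h.comp
      rw [e] at h1
      have h2 := h1.absorb hle (by rw [← e]; exact h.hM.nodup v)
      refine h2.congr (fun _ _ => rfl) (fun y hy hy' => ?_) (fun _ _ => rfl) (fun _ _ => rfl)
      have hyv : y ≠ v := by rintro rfl; exact h.fresh hy'
      by_cases hyx : y = x
      · subst hyx; simp [moveHeap]
      · simp [moveHeap, hyx, hyv]
    · intro y hy
      by_cases hyv : y = v
      · exact .inl hyv
      · right
        have hyx : y ≠ x := by rintro rfl; simp [moveHeap] at hy
        simp [moveHeap, hyx, hyv] at hy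
        obtain ⟨q, hq⟩ := (h.I_only y hy).resolve_left hyv
        by_cases hqv : q = v
        · subst hqv
          refine ⟨q, ?_⟩
          rw [hpv, mem_meld]
          simpa [e, nodes, hyx] using hq
        · exact ⟨q, by rwa [hmv q hqv]⟩
    · intro y hy
      rw [hmv y hy, hM1 y hy]
    · intro y hy hy'
      have hyx : y ≠ x := fun e' => hy' (e' ▸ h.comp.M_sub x hxm)
      rw [← hI1 y hy hy']
      simp [moveHeap, hyx, hy]
    · rw [heapCount_moveHeap h.lt hxn hxv, hcI]
    · omega

end RAM

/-! ### Inserting a node and finding the best light candidate -/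

namespace RAM

open HTree NExpr

/-- The facts about the heaps and a component that hold once `v` has been inserted. -/
structure Querying (P : ChainData) (D : ℕ → Finset ℕ) (S : List ℕ) (v : ℕ) (σ : State)
    (tM tO tI : ℕ → HTree) : Prop extends Core P σ tM tO tI where
  var : σ.nvar 11 = v
  lt : v < P.n
  comp : Component D P.w P.s P.w₀ S (tM v) (tO v) tI .nil 0 (σ.rarr 2) (σ.rarr 3)
  I_only : ∀ x, tI x ≠ .nil → ∃ r, x ∈ (tM r).nodes

/-- Insert the node in variable `11` into the three families of heaps. -/
def insertProg : Prog :=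
  insProg 8 2 11 11 ;;
    .putR 3 (var 11) (.add (.get 1 (var 11)) (.get 2 (get 21 (var 11)))) ;;
    insProg 0 1 11 11 ;; insProg 4 3 11 11

/-- No key is written for `v`: by the main invariant its cell plus the offset is already minus an
empty sum, that is `0`. The value of the group `v` is read off after `I v` is complete and before
`v` enters `O`, which is ordered by that value. -/
theorem insertProg_spec {P : ChainData} {D D' : ℕ → Finset ℕ} {S : List ℕ} {v : ℕ} {σ : State}
    {tM tO tI : ℕ → HTree} {c : ℕ} (h : Absorbing P D S v σ tM tO tI)
    (hM : ∀ x ∈ (tM v).nodes, P.s v < P.s x) (hv : v ∈ S) (hvD : ∀ u ∈ S, v ∉ D u) (hD0 : D v = ∅)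
    (hD' : ∀ u ∈ S, D' u = insert v (D u)) (hvM : ∀ y, v ∉ (tM y).nodes)
    (hvO : ∀ y, v ∉ (tO y).nodes) (hvI : ∀ y, v ∉ (tI y).nodes) (d : ℕ)
    (hc : 3 * heapTime P.n + 20 + d ≤ c) :
    WP insertProg (fun τ c' => d ≤ c' ∧ NodeFrame σ τ ∧ (∀ y, y ≠ v → τ.rarr 3 y = σ.rarr 3 y) ∧
      Querying P D' S v τ (insHeap P.s tM v v) (insHeap (τ.rarr 3) tO v v)
        (insHeap (σ.rarr 2) tI v v)) σ c := by
  refine WP.seq (WP.mono (insProg_spec h.hI (by norm_num) (by norm_num) (by rw [h.var]; exact h.lt)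
    (by rw [h.var]; exact h.lt) (by rw [h.var]; exact hvI) (2 * heapTime P.n + 20 + d) (by omega)) ?_)
  rintro σ1 c1 ⟨hc1, hF1, hI1⟩
  rw [h.var] at hI1
  have h1 := h.toCore.of_frameI hF1 hI1
  have ev1 : σ1.nvar 11 = v := by rw [hF1.nvar _ (by omega), h.var]
  refine WP.seq (WP.block (by simp) (2 * heapTime P.n + d) (by simp; omega) ?_)
  set σ2 := Prog.run (.putR 3 (var 11) (.add (.get 1 (var 11)) (.get 2 (get 21 (var 11))))) σ1 with hσ2
  have h2 : Core P σ2 (tM) tO (insHeap (σ.rarr 2) tI v v) := by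
    refine h1.of_eq rfl (fun _ _ => rfl) rfl fun a ha => ?_
    have : a ≠ 3 := by omega
    simp [hσ2, this]
  have ev2 : σ2.nvar 11 = v := ev1
  have hF2 : NodeFrame σ1 σ2 :=
    ⟨rfl, fun _ _ _ _ => rfl, fun _ _ => rfl, fun a ha => by simp [hσ2, ha]⟩
  refine WP.seq (WP.mono (insProg_spec h2.hM (by norm_num) (by norm_num) (by rw [ev2]; exact h.lt)
    (by rw [ev2]; exact h.lt) (by rw [ev2]; exact hvM) (heapTime P.n + d) (by omega)) ?_)
  rintro σ3 c3 ⟨hc3, hF3, hM3⟩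
  rw [ev2, h2.s] at hM3
  have h3 := h2.of_frameM hF3 hM3
  have ev3 : σ3.nvar 11 = v := by rw [hF3.nvar _ (by omega), ev2]
  refine WP.mono (insProg_spec h3.hO (by norm_num) (by norm_num) (by rw [ev3]; exact h.lt)
    (by rw [ev3]; exact h.lt) (by rw [ev3]; exact hvO) d (by omega)) ?_
  rintro σ4 c4 ⟨hc4, hF4, hO4⟩
  rw [ev3] at hO4
  have e43 : σ4.rarr = σ3.rarr := hF4.rarr
  rw [← e43] at hO4
  have h4 := h3.of_frameO hF4 hO4
  have e42 : σ4.rarr = σ2.rarr := by rw [e43, hF3.rarr]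
  have ek : σ4.rarr 2 = σ.rarr 2 := by rw [e42]; simp [hσ2, hF1.rarr]
  have ev : ∀ y, y ≠ v → σ4.rarr 3 y = σ.rarr 3 y := fun y hy => by
    rw [e42]; simp [hσ2, ev1, hy, hF1.rarr]
  have hIv : insHeap (σ.rarr 2) tI v v v = meld (σ.rarr 2) (tI v) (node nil v nil) := by
    simp [insHeap]
  refine ⟨hc4, ((hF1.nodeFrame.trans hF2).trans hF3.nodeFrame).trans hF4.nodeFrame, ev, h4,
    by rw [hF4.nvar _ (by omega), ev3], h.lt, ?_, ?_⟩
  · have := h.comp.insert (D' := D') (I' := insHeap (σ.rarr 2) tI v v) (val' := σ4.rarr 3) (m := 0)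
      hv hvD hD0 hD' hM (P.w_nonneg v h.lt) (fun x hx => by simp [insHeap, hx]) hIv ev ?_
    · rw [ek]
      convert this using 1
      · simp [insHeap]
      · simp [insHeap]
    · intro l u r e
      have hs := h1.hI.stored v h.lt
      rw [e] at hs
      have : σ1.narr 21 v = u := hs.1
      rw [e42]
      simp [hσ2, ev1, this, h1.s, hF1.rarr]
  · intro x hx
    by_cases hxv : x = v
    · refine ⟨v, ?_⟩
      simp [insHeap, mem_meld, nodes, hxv]
    · simp only [insHeap, ne_eq, hxv, not_false_eq_true, Function.update_of_ne] at hx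
      obtain ⟨r, hr⟩ := (h.I_only x hx).resolve_left hxv
      refine ⟨r, ?_⟩
      by_cases hrv : r = v
      · subst hrv; simp [insHeap, mem_meld, hr]
      · simpa [insHeap, hrv] using hr

/-- Load the best group and its best candidate into the variables `12` and `13`. -/
def peekProg : Prog := .setN 12 (get 17 (var 11)) ;; .setN 13 (get 21 (var 12))

/-- Give the group in variable `12` a new value and insert it again. -/
def reinsertProg : Prog :=
  .putR 3 (var 12) (.add (.get 1 (var 12)) (.get 2 (get 21 (var 12)))) ;; insProg 4 3 11 12

/-- The candidate in variable `13` exists and its path up to the node in variable `11` is light. -/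
def lightTest : Test :=
  .and (.not (.eqN (var 13) (var 0)))
    (.leR (.add (.sub (.get 6 (var 13)) (.get 6 (var 11))) (.get 0 (var 11))) (.var 0))

/-- Remove empty groups and heavy candidates until the best candidate is light. -/
def queryProg : Prog :=
  peekProg ;;
    .loop (.not lightTest)
      (popProg 4 3 11 ;;
        .ite (.eqN (var 13) (var 0)) .skip
          (popProg 8 2 12 ;; .ite (.eqN (get 21 (var 12)) (var 0)) .skip reinsertProg) ;;
        peekProg)

/-- What a query may change. -/
structure QueryFrame (D : ℕ → Finset ℕ) (S : List ℕ) (v : ℕ) (σ τ : State)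
    (tO tI tO' tI' : ℕ → HTree) : Prop extends NodeFrame σ τ where
  tO_eq : ∀ y, y ≠ v → tO' y = tO y
  tI_eq : ∀ y, ¬ (y ∈ S ∧ y ∈ D y) → tI' y = tI y
  val_eq : ∀ y ∉ S, τ.rarr 3 y = σ.rarr 3 y

theorem QueryFrame.trans {D : ℕ → Finset ℕ} {S : List ℕ} {v : ℕ} {σ τ υ : State}
    {tO tI tO' tI' tO'' tI'' : ℕ → HTree} (h : QueryFrame D S v σ τ tO tI tO' tI')
    (h' : QueryFrame D S v τ υ tO' tI' tO'' tI'') : QueryFrame D S v σ υ tO tI tO'' tI'' :=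
  ⟨h.toNodeFrame.trans h'.toNodeFrame, fun y hy => (h'.tO_eq y hy).trans (h.tO_eq y hy),
    fun y hy => (h'.tI_eq y hy).trans (h.tI_eq y hy),
    fun y hy => (h'.val_eq y hy).trans (h.val_eq y hy)⟩

theorem peek_spec {P : ChainData} {D : ℕ → Finset ℕ} {S : List ℕ} {v : ℕ} {σ : State}
    {tM tO tI : ℕ → HTree} (h : Querying P D S v σ tM tO tI) :
    Querying P D S v (peekProg.run σ) tM tO tI ∧
      QueryFrame D S v σ (peekProg.run σ) tO tI tO tI ∧
      (peekProg.run σ).nvar 12 = (peekProg.run σ).narr 17 v ∧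
      (peekProg.run σ).nvar 13 = (peekProg.run σ).narr 21 ((peekProg.run σ).nvar 12) := by
  refine ⟨⟨h.toCore.of_eq (by simp [peekProg]) (fun _ _ => rfl) rfl fun _ _ => rfl, ?_, h.lt, h.comp,
    h.I_only⟩, ⟨⟨rfl, fun x h1 h2 h3 => ?_, fun _ _ => rfl, fun _ _ => rfl⟩, fun _ _ => rfl,
      fun _ _ => rfl, fun _ _ => rfl⟩, ?_, ?_⟩
  · simp [peekProg, h.var]
  · simp [peekProg, h2, h3]
  · simp [peekProg, h.var]
  · simp [peekProg, h.var]

/-- The removal of a heavy candidate. -/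
theorem popHeavy_spec {P : ChainData} {D : ℕ → Finset ℕ} {S : List ℕ} {v x u : ℕ}
    {l r a b : HTree} {σ : State} {tM tO tI : ℕ → HTree} {c : ℕ} (h : Querying P D S v σ tM tO tI)
    (hx : σ.nvar 12 = x) (hu : σ.nvar 13 = u) (eO : tO v = node l x r) (eI : tI x = node a u b)
    (heavy : P.w₀ < ∑ y ∈ D u, P.w y) (d : ℕ) (hc : 3 * heapTime P.n + 40 + d ≤ c) :
    WP (popProg 4 3 11 ;;
        .ite (.eqN (var 13) (var 0)) .skip
          (popProg 8 2 12 ;; .ite (.eqN (get 21 (var 12)) (var 0)) .skip reinsertProg))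
      (fun τ c' => d ≤ c' ∧ ∃ tO' tI', Querying P D S v τ tM tO' tI' ∧
        QueryFrame D S v σ τ tO tI tO' tI' ∧
        heapCount P.n tO' + heapCount P.n tI' < heapCount P.n tO + heapCount P.n tI) σ c := by
  have hxO : x ∈ (tO v).nodes := by simp [eO, nodes]
  have hxn : x < P.n := h.hO.lt v x hxO
  have hxS := h.comp.O_sub x hxO
  have hun : u < P.n := h.hI.lt x u (by simp [eI, nodes])
  have cO := heapCount_popHeap (n := P.n) (key := σ.rarr 3) h.lt (show tO v ≠ .nil by simp [eO])
  have cI := heapCount_popHeap (n := P.n) (key := σ.rarr 2) hxn (show tI x ≠ .nil by simp [eI])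
  refine WP.seq (WP.mono (popProg_spec h.hO (by norm_num) (by rw [h.var]; exact h.lt)
    (by rw [h.var, eO]; simp) (2 * heapTime P.n + 40 + d) (by omega)) ?_)
  rintro σ1 c1 ⟨hc1, hF1, hO1⟩
  rw [h.var] at hO1
  have h1 := h.toCore.of_frameO hF1 hO1
  have ev1 : σ1.nvar 11 = v := by rw [hF1.nvar _ (by omega), h.var]
  have ex1 : σ1.nvar 12 = x := by rw [hF1.nvar _ (by omega), hx]
  have eu1 : σ1.nvar 13 = u := by rw [hF1.nvar _ (by omega), hu]
  have en1 : σ1.nvar 0 = P.n := h1.hO.size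
  refine WP.ite_false (d := 2 * heapTime P.n + 36 + d) ?_ (by simp; omega) ?_
  · simp [eu1, en1, hun.ne]
  refine WP.seq (WP.mono (popProg_spec h1.hI (by norm_num) (by rw [ex1]; exact hxn)
    (by rw [ex1, eI]; simp) (heapTime P.n + 36 + d) (by omega)) ?_)
  rintro σ2 c2 ⟨hc2, hF2, hI2⟩
  rw [ex1, hF1.rarr] at hI2
  have h2 := h1.of_frameI hF2 hI2
  have ev2 : σ2.nvar 11 = v := by rw [hF2.nvar _ (by omega), ev1]
  have ex2 : σ2.nvar 12 = x := by rw [hF2.nvar _ (by omega), ex1]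
  have en2 : σ2.nvar 0 = P.n := h2.hO.size
  have er2 : σ2.rarr = σ.rarr := by rw [hF2.rarr, hF1.rarr]
  have pO : popHeap (σ.rarr 3) tO v v = meld (σ.rarr 3) l r := by simp [popHeap, eO]
  have pI : popHeap (σ.rarr 2) tI x = Function.update tI x (meld (σ.rarr 2) a b) := by
    simp [popHeap, eI]
  have hcomp := h.comp
  rw [eO] at hcomp
  have hst := h2.hI.stored x hxn
  have hnil := hst.eq_nil_iff
  rw [en2] at hnil
  have hIx : popHeap (σ.rarr 2) tI x x = meld (σ.rarr 2) a b := by simp [pI]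
  rw [hIx] at hnil hst
  have hxM : x ∈ (tM v).nodes := by
    by_contra hM
    have := hcomp.dead x (by simp [nodes]) hM
    simp [eI] at this
  have hIo : ∀ y, popHeap (σ.rarr 2) tI x y ≠ nil → ∃ r, y ∈ (tM r).nodes := by
    intro y hy
    by_cases hyx : y = x
    · subst hyx; exact ⟨v, hxM⟩
    · rw [pI, Function.update_of_ne hyx] at hy
      exact h.I_only y hy
  have hIf : ∀ y, ¬ (y ∈ S ∧ y ∈ D y) → popHeap (σ.rarr 2) tI x y = tI y := by
    intro y hy
    have : y ≠ x := by rintro rfl; exact hy hxS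
    rw [pI, Function.update_of_ne this]
  by_cases hb : meld (σ.rarr 2) a b = nil
  · refine WP.ite_true (d := heapTime P.n + 25 + d) ?_ (by simp; omega) ?_
    · simp only [Test.Holds, eval, ex2, en2]
      exact hnil.2 hb
    refine WP.block (by simp) d (by simp) ⟨le_rfl, _, _, ⟨h2, ev2, h.lt, ?_, hIo⟩,
      ⟨hF1.nodeFrame.trans hF2.nodeFrame, fun y hy => by simp [popHeap, hy], hIf,
        fun y hy => by simp [er2]⟩, by omega⟩
    have := hcomp.pop_heavy_last eI heavy hb
    simp only [Prog.run]
    rw [er2, pO, pI]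
    exact this
  · refine WP.ite_false (d := heapTime P.n + 25 + d) ?_ (by simp; omega) ?_
    · simp only [Test.Holds, eval, ex2, en2]
      intro h'
      exact hb (hnil.1 h')
    refine WP.seq (WP.block (by simp) (heapTime P.n + d) (by simp; omega) ?_)
    set σ3 := Prog.run (.putR 3 (var 12) (.add (.get 1 (var 12)) (.get 2 (get 21 (var 12))))) σ2
      with hσ3
    have h3 : Core P σ3 tM (popHeap (σ.rarr 3) tO v) (popHeap (σ.rarr 2) tI x) := by
      refine h2.of_eq rfl (fun _ _ => rfl) rfl fun a ha => ?_
      have : a ≠ 3 := by omega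
      simp [hσ3, this]
    have ev3 : σ3.nvar 11 = v := ev2
    have ex3 : σ3.nvar 12 = x := ex2
    have hF3 : NodeFrame σ2 σ3 :=
      ⟨rfl, fun _ _ _ _ => rfl, fun _ _ => rfl, fun a ha => by simp [hσ3, ha]⟩
    have hxO' : ∀ y, x ∉ (popHeap (σ.rarr 3) tO v y).nodes := by
      intro y hy
      by_cases hyv : y = v
      · subst hyv
        rw [pO, mem_meld] at hy
        have := h.hO.nodup y
        simp only [eO, nodes, List.nodup_cons, List.mem_append] at this
        exact this.1 hy
      · simp only [popHeap, ne_eq, hyv, not_false_eq_true, Function.update_of_ne] at hy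
        exact hyv (h.hO.disj _ _ _ hy hxO)
    refine WP.mono (insProg_spec h3.hO (by norm_num) (by norm_num) (by rw [ev3]; exact h.lt)
      (by rw [ex3]; exact hxn) (by rw [ex3]; exact hxO') d (by omega)) ?_
    rintro σ4 c4 ⟨hc4, hF4, hO4⟩
    rw [ev3, ex3] at hO4
    have h4 := h3.of_frameO hF4 hO4
    have ev4 : ∀ y, y ≠ x → σ4.rarr 3 y = σ.rarr 3 y := fun y hy => by
      rw [hF4.rarr]; simp [hσ3, ex2, hy, er2]
    have cO' := heapCount_insHeap (n := P.n) (t := popHeap (σ.rarr 3) tO v) (key := σ3.rarr 3) (x := x)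
      h.lt
    refine ⟨hc4, _, _, ⟨h4, by rw [hF4.nvar _ (by omega), ev3], h.lt, ?_, hIo⟩,
      ⟨((hF1.nodeFrame.trans hF2.nodeFrame).trans hF3).trans hF4.nodeFrame,
        fun y hy => by simp [insHeap, popHeap, hy], hIf,
        fun y hy => ev4 y (by rintro rfl; exact hy hxS.1)⟩, by omega⟩
    have := hcomp.pop_heavy (val' := σ4.rarr 3) (by rw [← eO]; exact h.hO.nodup v) eI heavy ev4 ?_
    · have ek : σ4.rarr 2 = σ.rarr 2 := by rw [hF4.rarr]; simp [hσ3, er2]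
      rw [ek, pI]
      convert this using 1
      simp [insHeap, pO, hF4.rarr]
    · intro c z e hz
      rw [hz] at hst
      have : σ2.narr 21 x = z := hst.1
      rw [hF4.rarr]
      simp [hσ3, ex2, this, h2.s, er2]

/-- `v` itself is a light candidate, so `O` never runs empty and the loop ends at a light top. Each
round decreases the number of nodes in `O` and `I` together: a dead group leaves `O`, or a heavy
candidate leaves `I` while its group leaves `O` or is put back. So `3 * heapTime P.n + 100` credits
per node suffice. -/
theorem queryProg_spec {P : ChainData} {D : ℕ → Finset ℕ} {S : List ℕ} {v : ℕ} {σ : State}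
    {tM tO tI : ℕ → HTree} {c : ℕ} (h : Querying P D S v σ tM tO tI) (hv : v ∈ S) (hvD : v ∈ D v)
    (hvw : ∑ y ∈ D v, P.w y ≤ P.w₀)
    (hW : ∀ u ∈ S, P.W u - P.W v + P.w v = ∑ y ∈ D u, P.w y) (d : ℕ)
    (hc : (3 * heapTime P.n + 100) * (heapCount P.n tO + heapCount P.n tI) + 40 + d ≤ c) :
    WP queryProg (fun τ c' => ∃ tO' tI', Querying P D S v τ tM tO' tI' ∧
      QueryFrame D S v σ τ tO tI tO' tI' ∧
      (∃ l r a b, tO' v = node l (τ.nvar 12) r ∧ tI' (τ.nvar 12) = node a (τ.nvar 13) b) ∧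
      ∑ y ∈ D (τ.nvar 13), P.w y ≤ P.w₀ ∧
      (3 * heapTime P.n + 100) * (heapCount P.n tO' + heapCount P.n tI') + d ≤ c') σ c := by
  obtain ⟨p1, p2, p3, p4⟩ := peek_spec h
  refine WP.seq (WP.block (by simp [peekProg])
    ((3 * heapTime P.n + 100) * (heapCount P.n tO + heapCount P.n tI) + 20 + d)
    (by simp [peekProg]; omega) ?_)
  refine WP.loop (fun τ c' => ∃ tO' tI', Querying P D S v τ tM tO' tI' ∧
      QueryFrame D S v σ τ tO tI tO' tI' ∧ τ.nvar 12 = τ.narr 17 v ∧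
      τ.nvar 13 = τ.narr 21 (τ.nvar 12) ∧
      (3 * heapTime P.n + 100) * (heapCount P.n tO' + heapCount P.n tI') + 20 + d ≤ c') ?_
    ⟨tO, tI, p1, p2, p3, p4, le_rfl⟩
  clear h hc p1 p2 p3 p4 c
  rintro τ c ⟨tO1, tI1, h, hF, h12, h13, hc⟩
  have hstO := h.hO.stored v h.lt
  have hne := h.comp.O_ne_nil hv hvD hvw
  obtain ⟨l, x, r, eO⟩ : ∃ l x r, tO1 v = node l x r := by
    cases e : tO1 v with
    | nil => exact absurd e hne
    | node l x r => exact ⟨l, x, r, rfl⟩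
  have hx : τ.nvar 12 = x := by
    rw [h12]
    rw [eO] at hstO
    exact hstO.1
  have hxO : x ∈ (tO1 v).nodes := by simp [eO, nodes]
  have hxn : x < P.n := h.hO.lt v x hxO
  have hstI := h.hI.stored x hxn
  have hnilI := hstI.eq_nil_iff
  have en : τ.nvar 0 = P.n := h.hO.size
  set u := τ.nvar 13 with hudef
  rw [hx] at h13
  have hnil : u = P.n ↔ tI1 x = nil := by rw [h13, ← en]; exact hnilI
  have hnode : u ≠ P.n → ∃ a b, tI1 x = node a u b := by
    intro hu
    rw [← en, h13] at hu
    obtain ⟨a, b, e, -⟩ := hstI.exists_node hu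
    exact ⟨a, b, by rw [h13]; exact e⟩
  -- If `u = P.n` there is no candidate and the comparison of weights reads meaningless cells; the
  -- first conjunct makes this harmless.
  have hlight : lightTest.Holds τ ↔ u ≠ P.n ∧ ∑ y ∈ D u, P.w y ≤ P.w₀ := by
    have e1 : lightTest.Holds τ ↔ u ≠ P.n ∧ P.W u - P.W v + P.w v ≤ P.w₀ := by
      simp [lightTest, h.W, h.w, h.w₀, h.var, en, hudef]
    rw [e1]
    refine and_congr_right fun hu => ?_
    obtain ⟨a, b, e⟩ := hnode hu
    have hxM : x ∈ (tM v).nodes := by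
      by_contra hM
      have := h.comp.dead x hxO hM
      simp [e] at this
    rw [hW u (h.comp.I_sub x hxM u (by simp [e, nodes])).1]
  by_cases hb : lightTest.Holds τ
  · right
    refine ⟨by simpa using hb, (3 * heapTime P.n + 100) * (heapCount P.n tO1 + heapCount P.n tI1) + d,
      by simp [lightTest]; omega, tO1, tI1, h, hF, ?_, (hlight.1 hb).2, le_rfl⟩
    obtain ⟨a, b, e⟩ := hnode (hlight.1 hb).1
    exact ⟨l, r, a, b, by rw [hx]; exact eO, by rw [hx]; exact e⟩
  · left
    obtain ⟨N, hN⟩ : ∃ N, heapCount P.n tO1 + heapCount P.n tI1 = N + 1 := by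
      have := heapCount_popHeap (n := P.n) (key := τ.rarr 3) h.lt (show tO1 v ≠ .nil by simp [eO])
      exact ⟨heapCount P.n (popHeap (τ.rarr 3) tO1 v) + heapCount P.n tI1, by omega⟩
    rw [hN] at hc
    have hexp : (3 * heapTime P.n + 100) * (N + 1) =
        (3 * heapTime P.n + 100) * N + 3 * heapTime P.n + 100 := by ring
    refine ⟨by simpa using hb, (3 * heapTime P.n + 100) * N + 3 * heapTime P.n + 90 + d,
      by simp [lightTest]; omega, ?_⟩
    -- the rest of the iteration once the heaps have been updated
    have hrest : ∀ τ1 tO2 tI2 c1, Querying P D S v τ1 tM tO2 tI2 →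
        QueryFrame D S v τ τ1 tO1 tI1 tO2 tI2 →
        heapCount P.n tO2 + heapCount P.n tI2 < heapCount P.n tO1 + heapCount P.n tI1 →
        (3 * heapTime P.n + 100) * N + 40 + d ≤ c1 →
        WP peekProg (fun τ c' => ∃ tO' tI', Querying P D S v τ tM tO' tI' ∧
          QueryFrame D S v σ τ tO tI tO' tI' ∧ τ.nvar 12 = τ.narr 17 v ∧
          τ.nvar 13 = τ.narr 21 (τ.nvar 12) ∧
          (3 * heapTime P.n + 100) * (heapCount P.n tO' + heapCount P.n tI') + 20 + d ≤ c') τ1 c1 := by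
      intro τ1 tO2 tI2 c1 hq hf hlt hc1
      obtain ⟨p1, p2, p3, p4⟩ := peek_spec hq
      refine WP.block (by simp [peekProg]) ((3 * heapTime P.n + 100) * N + 20 + d)
        (by simp [peekProg]; omega) ⟨tO2, tI2, p1, (hF.trans hf).trans p2, p3, p4, ?_⟩
      have : (3 * heapTime P.n + 100) * (heapCount P.n tO2 + heapCount P.n tI2) ≤
          (3 * heapTime P.n + 100) * N := Nat.mul_le_mul_left _ (by omega)
      omega
    by_cases hu : u = P.n
    · refine WP.seq (WP.mono (popProg_spec h.hO (by norm_num) (by rw [h.var]; exact h.lt)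
        (by rw [h.var, eO]; simp) ((3 * heapTime P.n + 100) * N + 90 + d) (by omega)) ?_)
      rintro τ1 c1 ⟨hc1, hF1, hO1⟩
      rw [h.var] at hO1
      refine WP.seq (WP.ite_true (d := (3 * heapTime P.n + 100) * N + 60 + d) ?_ (by simp; omega)
        (WP.block (by simp) ((3 * heapTime P.n + 100) * N + 40 + d) (by simp; omega) ?_))
      · simp only [Test.Holds, eval]
        rw [hF1.nvar _ (by omega), hF1.nvar _ (by omega), en, ← hudef, hu]
      · have cO := heapCount_popHeap (n := P.n) (key := τ.rarr 3) h.lt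
          (show tO1 v ≠ .nil by simp [eO])
        refine hrest _ (popHeap (τ.rarr 3) tO1 v) tI1 _ ⟨h.toCore.of_frameO hF1 hO1, ?_, h.lt, ?_,
          h.I_only⟩ ⟨hF1.nodeFrame, fun y hy => by simp [popHeap, hy], fun _ _ => rfl,
            fun y hy => by simp [hF1.rarr]⟩ (by omega) le_rfl
        · simp only [Prog.run]
          rw [hF1.nvar _ (by omega), h.var]
        · have hcomp := h.comp
          rw [eO] at hcomp
          have := hcomp.pop_dead (hnil.1 hu)
          simp only [Prog.run]
          rw [hF1.rarr]
          simpa [popHeap, eO] using this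
    · obtain ⟨a, b, eI⟩ := hnode hu
      have heavy : P.w₀ < ∑ y ∈ D u, P.w y := by
        by_contra hlt
        exact hb (hlight.2 ⟨hu, not_lt.1 hlt⟩)
      have := popHeavy_spec h hx hudef.symm eO eI heavy ((3 * heapTime P.n + 100) * N + 40 + d)
        (c := (3 * heapTime P.n + 100) * N + 3 * heapTime P.n + 90 + d) (by omega)
      obtain ⟨t, υ, c', hE, ht, hc', tO2, tI2, hq, hf, hlt⟩ := this
      obtain ⟨t2, υ2, c2, hE2, ht2, hQ2⟩ := hrest υ tO2 tI2 c' hq hf hlt hc'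
      -- `popHeavy_spec` runs the first two parts of the loop body as one program, whereas the body
      -- groups the second part with `peekProg`; the run is cut and reassembled.
      cases hE with
      | seq hA hB => exact ⟨_, υ2, c2, .seq hA (.seq hB hE2), by omega, hQ2⟩

end RAM

/-! ## Linked lists -/

/-- `nxt` links the elements of the list `a :: l`, whose last element is `last`. -/
def Linked (nxt : ℕ → ℕ) (last : ℕ) : ℕ → List ℕ → Prop
  | a, [] => a = last
  | a, b :: l => nxt a = b ∧ Linked nxt last b l

namespace Linked

variable {nxt nxt' : ℕ → ℕ} {last a : ℕ} {l : List ℕ}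

theorem last_mem (h : Linked nxt last a l) : last ∈ a :: l := by
  induction l generalizing a with
  | nil => rw [show a = last from h]; simp
  | cons b l ih => exact List.mem_cons_of_mem _ (ih h.2)

/-- Distinctness makes comparison with `last` a valid test for the end of the list, so no end marker
is stored. -/
theorem eq_last_iff (h : Linked nxt last a l) (hn : (a :: l).Nodup) : a = last ↔ l = [] := by
  cases l with
  | nil => exact iff_of_true h rfl
  | cons b l =>
    refine iff_of_false ?_ (by simp)
    rintro rfl
    exact (List.nodup_cons.1 hn).1 h.2.last_mem

/-- The pointer of the last element is never followed, so it may be overwritten; this is what allows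
concatenation in constant time. -/
theorem congr (h : Linked nxt last a l) (hn : ∀ x ∈ a :: l, x ≠ last → nxt' x = nxt x)
    (hd : (a :: l).Nodup) : Linked nxt' last a l := by
  induction l generalizing a with
  | nil => exact h
  | cons b l ih =>
    refine ⟨?_, ih h.2 (fun x hx => hn x (List.mem_cons_of_mem _ hx)) (List.nodup_cons.1 hd).2⟩
    rw [hn a (by simp) fun e => by simpa using (h.eq_last_iff hd).1 e, h.1]

theorem append {b last' : ℕ} {l' : List ℕ} (h : Linked nxt last a l)
    (h' : Linked nxt last' b l') (hn : (a :: l ++ b :: l').Nodup) :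
    Linked (Function.update nxt last b) last' a (l ++ b :: l') := by
  induction l generalizing a with
  | nil =>
    have ha : a = last := h
    subst ha
    refine ⟨by simp, h'.congr (fun x hx _ => ?_) (List.nodup_cons.1 hn).2⟩
    rw [Function.update_of_ne]
    rintro rfl
    exact (List.nodup_cons.1 hn).1 hx
  | cons c l ih =>
    have hd := (List.nodup_append.1 hn).1
    refine ⟨?_, ih h.2 (List.nodup_cons.1 hn).2⟩
    rw [Function.update_of_ne fun e => by simpa using (h.eq_last_iff hd).1 e, h.1]

end Linked

/-! ### Joining two components by rekeying the shorter one -/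

namespace RAM

open HTree NExpr

/-- Walk along the lists of the nodes in the variables `11` and `14` until one of them ends. -/
def walkProg : Prog :=
  (.setN 15 (var 11) ;; .setN 16 (var 14)) ;;
    .loop (.and (.not (.eqN (var 15) (get 7 (var 11)))) (.not (.eqN (var 16) (get 7 (var 14)))))
      (.setN 15 (get 6 (var 15)) ;; .setN 16 (get 6 (var 16)))

/-- Walking along both lists in step finds the shorter one in time proportional to its length. No
lengths are stored; the machine does not add natural numbers. -/
theorem walkProg_spec {σ : State} {v p c : ℕ} {lv lp : List ℕ} (hv : σ.nvar 11 = v)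
    (hp : σ.nvar 14 = p) (h1 : Linked (σ.narr 6) (σ.narr 7 v) v lv)
    (h2 : Linked (σ.narr 6) (σ.narr 7 p) p lp) (hn1 : (v :: lv).Nodup) (hn2 : (p :: lp).Nodup)
    (d : ℕ) (hc : 30 * min (v :: lv).length (p :: lp).length + 30 + d ≤ c) :
    WP walkProg (fun τ c' => d ≤ c' ∧ (∃ a b, τ = (σ.setN 15 a).setN 16 b) ∧
      (τ.nvar 15 = σ.narr 7 v → lv.length ≤ lp.length) ∧
      (τ.nvar 15 ≠ σ.narr 7 v → lp.length ≤ lv.length)) σ c := by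
  refine WP.seq (WP.block (by simp) (30 * min (v :: lv).length (p :: lp).length + 20 + d)
    (by simp only [Prog.steps, cost]; omega) ?_)
  refine WP.loop (fun τ c' => ∃ a b l l', τ = (σ.setN 15 a).setN 16 b ∧
    Linked (σ.narr 6) (σ.narr 7 v) a l ∧ Linked (σ.narr 6) (σ.narr 7 p) b l' ∧ (a :: l).Nodup ∧
    (b :: l').Nodup ∧ lv.length + l'.length = lp.length + l.length ∧
    30 * min l.length l'.length + 20 + d ≤ c') ?_
    ⟨v, p, lv, lp, ?_, h1, h2, hn1, hn2, by omega, by simp only [List.length_cons]; omega⟩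
  · clear hc c
    rintro τ c ⟨a, b, l, l', rfl, ha, hb, hna, hnb, hlen, hc⟩
    have ea := ha.eq_last_iff hna
    have eb := hb.eq_last_iff hnb
    cases l with
    | nil =>
      right
      refine ⟨by simp [hv, hp, ea], d, by simp at hc ⊢; omega, le_rfl, ⟨a, b, rfl⟩, ?_, ?_⟩
      · simp at hlen ⊢; omega
      · simp [ea]
    | cons a' l =>
    cases l' with
    | nil =>
      right
      refine ⟨by simp [hv, hp, eb], d, by simp at hc ⊢; omega, le_rfl, ⟨a, b, rfl⟩, ?_, ?_⟩
      · simp [ea]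
      · simp at hlen ⊢; omega
    | cons b' l' =>
      left
      simp only [List.length_cons] at hc hlen
      refine ⟨by simp [hv, hp, ea, eb], 30 * min l.length l'.length + 30 + d,
        by simp; omega, WP.block (by simp) (30 * min l.length l'.length + 20 + d) (by simp; omega) ?_⟩
      refine ⟨a', b', l, l', ?_, ha.2, hb.2, (List.nodup_cons.1 hna).2, (List.nodup_cons.1 hnb).2,
        by omega, le_rfl⟩
      simp only [Prog.run, eval, State.narr_setN, State.nvar_setN]
      simp [State.setN, ha.1, hb.1]
      funext y
      simp [Function.update_apply]
      split_ifs <;> simp_all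
  · simp [hv, hp]

/-- Add the number in real variable `2` to the key and the value of the node in variable `15`. -/
def bumpProg : Prog :=
  .putR 2 (var 15) (.add (.get 2 (var 15)) (.var 2)) ;;
    .putR 3 (var 15) (.add (.get 3 (var 15)) (.var 2))

/-- Add the number in real variable `2` to the keys and values of all nodes of a list, from the one
in variable `15` to the one in variable `16`. -/
def rekeyProg : Prog :=
  bumpProg ;; .loop (.not (.eqN (var 15) (var 16))) (.setN 15 (get 6 (var 15)) ;; bumpProg)

/-- `τ` differs from `σ` only in variable `15` and in that `δ` has been added to the keys and values
of the nodes in `X`. -/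
structure Rekeyed (σ τ : State) (X : ℕ → Prop) (δ : ℝ) : Prop where
  rvar : τ.rvar = σ.rvar
  narr : τ.narr = σ.narr
  nvar : ∀ x, x ≠ 15 → τ.nvar x = σ.nvar x
  rarr : ∀ a, a ≠ 2 → a ≠ 3 → τ.rarr a = σ.rarr a
  key : ∀ x, X x → τ.rarr 2 x = σ.rarr 2 x + δ
  val : ∀ x, X x → τ.rarr 3 x = σ.rarr 3 x + δ
  key_out : ∀ x, ¬ X x → τ.rarr 2 x = σ.rarr 2 x
  val_out : ∀ x, ¬ X x → τ.rarr 3 x = σ.rarr 3 x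

theorem bump_spec {σ τ : State} {X : ℕ → Prop} {a : ℕ} (h : Rekeyed σ τ X (σ.rvar 2))
    (ha : τ.nvar 15 = a) (hX : ¬ X a) :
    Rekeyed σ (bumpProg.run τ) (fun x => X x ∨ x = a) (σ.rvar 2) where
  rvar := h.rvar
  narr := h.narr
  nvar := h.nvar
  rarr b h2 h3 := by simp [bumpProg, h2, h3, h.rarr b h2 h3]
  key x hx := by
    by_cases e : x = a
    · subst e; simp [bumpProg, ha, h.key_out _ hX, h.rvar]
    · simp [bumpProg, ha, e, h.key x (hx.resolve_right e)]
  val x hx := by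
    by_cases e : x = a
    · subst e; simp [bumpProg, ha, h.val_out _ hX, h.rvar]
    · simp [bumpProg, ha, e, h.val x (hx.resolve_right e)]
  key_out x hx := by
    push Not at hx
    simp [bumpProg, ha, hx.2, h.key_out x hx.1]
  val_out x hx := by
    push Not at hx
    simp [bumpProg, ha, hx.2, h.val_out x hx.1]

theorem rekeyProg_spec {σ : State} {a c : ℕ} {l : List ℕ} (ha : σ.nvar 15 = a)
    (h : Linked (σ.narr 6) (σ.nvar 16) a l) (hn : (a :: l).Nodup) (d : ℕ)
    (hc : 40 * (a :: l).length + 10 + d ≤ c) :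
    WP rekeyProg (fun τ c' => d ≤ c' ∧ Rekeyed σ τ (· ∈ a :: l) (σ.rvar 2)) σ c := by
  simp only [List.length_cons] at hc
  refine WP.seq (WP.block (by simp [bumpProg]) (40 * l.length + 10 + d) (by simp [bumpProg]; omega) ?_)
  -- The node in variable `15` has already been changed when the test is made, so exactly the nodes
  -- of `l'` are outstanding.
  refine WP.loop (fun τ c' => ∃ b l', τ.nvar 15 = b ∧ Linked (σ.narr 6) (σ.nvar 16) b l' ∧
    (b :: l').Nodup ∧ (∀ x ∈ b :: l', x ∈ a :: l) ∧
    Rekeyed σ τ (fun x => x ∈ a :: l ∧ x ∉ l') (σ.rvar 2) ∧ 40 * l'.length + 10 + d ≤ c') ?_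
    ⟨a, l, ?_, h, hn, fun _ h => h, ?_, le_rfl⟩
  · clear hc c
    rintro τ c ⟨b, l', eb, hl, hnd, hsub, hR, hc⟩
    have hlast := hl.eq_last_iff hnd
    have e16 : τ.nvar 16 = σ.nvar 16 := hR.nvar _ (by norm_num)
    cases l' with
    | nil =>
      right
      exact ⟨by simp [eb, e16, hlast], d, by simp at hc ⊢; omega, le_rfl, by simpa using hR⟩
    | cons b' l' =>
      left
      simp only [List.length_cons] at hc
      refine ⟨by simp [eb, e16, hlast], 40 * l'.length + 40 + d, by simp; omega, ?_⟩
      refine WP.seq (WP.block (by simp) (40 * l'.length + 35 + d) (by simp; omega) ?_)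
      refine WP.block (by simp [bumpProg]) (40 * l'.length + 10 + d) (by simp [bumpProg]; omega) ?_
      have hR' : Rekeyed σ (Prog.run (.setN 15 (get 6 (var 15))) τ)
          (fun x => x ∈ a :: l ∧ x ∉ b' :: l') (σ.rvar 2) :=
        ⟨hR.rvar, hR.narr, fun x hx => by simp [hx, hR.nvar x hx], hR.rarr, hR.key, hR.val,
          hR.key_out, hR.val_out⟩
      have e15 : (Prog.run (.setN 15 (get 6 (var 15))) τ).nvar 15 = b' := by
        simp [eb, hR.narr, hl.1]
      have hb := bump_spec hR' e15 (by simp)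
      have hnd' := (List.nodup_cons.1 hnd).2
      refine ⟨b', l', e15, hl.2, hnd', fun x hx => hsub x (List.mem_cons_of_mem _ hx), ?_, le_rfl⟩
      convert hb using 2 with x
      refine ⟨fun hx => ?_, fun hx => ?_⟩
      · by_cases e : x = b'
        · exact .inr e
        · exact .inl ⟨hx.1, by simp [e, hx.2]⟩
      · rcases hx with hx | rfl
        · exact ⟨hx.1, fun h => hx.2 (List.mem_cons_of_mem _ h)⟩
        · exact ⟨hsub x (by simp), (List.nodup_cons.1 hnd').1⟩
  · simp [bumpProg, ha]
  · have h0 : Rekeyed σ σ (fun _ => False) (σ.rvar 2) :=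
      ⟨rfl, rfl, fun _ _ => rfl, fun _ _ _ => rfl, fun _ h => h.elim, fun _ h => h.elim,
        fun _ _ => rfl, fun _ _ => rfl⟩
    have hb := bump_spec h0 ha (by simp)
    convert hb using 2 with x
    simp only [List.mem_cons, false_or, eq_iff_iff]
    refine ⟨fun hx => hx.1.resolve_right hx.2, ?_⟩
    rintro rfl
    exact ⟨.inl rfl, (List.nodup_cons.1 hn).1⟩

/-- Prepare the change of the keys of the shorter of the two lists. -/
def chooseProg : Prog :=
  .ite (.eqN (var 15) (get 7 (var 11)))
    (.setN 15 (var 11) ;; .setN 16 (get 7 (var 11)) ;;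
      .setR 2 (.sub (.get 4 (var 11)) (.get 4 (var 14))))
    (.setN 15 (var 14) ;; .setN 16 (get 7 (var 14)) ;;
      .setR 2 (.sub (.get 4 (var 14)) (.get 4 (var 11))) ;; .putR 4 (var 14) (.get 4 (var 11)))

/-- Join the components of the nodes `v` and `p` in the variables `11` and `14`. -/
def joinProg : Prog :=
  walkProg ;; chooseProg ;; rekeyProg ;; moveProg 0 1 14 11 ;; moveProg 4 3 14 11 ;;
    (.putN 6 (get 7 (var 14)) (var 11) ;; .putN 7 (var 14) (get 7 (var 11)))

/-- The effect of joining the components of `v` and `p`. -/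
structure Joined (P : ChainData) (σ τ : State) (v p : ℕ) (lv lp : List ℕ)
    (tM tO tI : ℕ → HTree) (δv δp : ℝ) : Prop where
  core : Core P τ (moveHeap P.s tM p v) (moveHeap (τ.rarr 3) tO p v) tI
  nvar : ∀ x, x = 0 ∨ 10 ≤ x → x ≠ 15 → x ≠ 16 → τ.nvar x = σ.nvar x
  rvar : ∀ x, x ≠ 2 → τ.rvar x = σ.rvar x
  narr : ∀ a < 9, a ≠ 6 → a ≠ 7 → τ.narr a = σ.narr a
  rarr : ∀ a, a ≠ 2 → a ≠ 3 → a ≠ 4 → τ.rarr a = σ.rarr a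
  key_v : ∀ x ∈ v :: lv, τ.rarr 2 x = σ.rarr 2 x + δv
  val_v : ∀ x ∈ v :: lv, τ.rarr 3 x = σ.rarr 3 x + δv
  key_p : ∀ x ∈ p :: lp, τ.rarr 2 x = σ.rarr 2 x + δp
  val_p : ∀ x ∈ p :: lp, τ.rarr 3 x = σ.rarr 3 x + δp
  key_out : ∀ x, x ∉ v :: lv → x ∉ p :: lp → τ.rarr 2 x = σ.rarr 2 x
  val_out : ∀ x, x ∉ v :: lv → x ∉ p :: lp → τ.rarr 3 x = σ.rarr 3 x
  off : ∀ x, x ≠ p → τ.rarr 4 x = σ.rarr 4 x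
  off_v : τ.rarr 4 p + δv = σ.rarr 4 v
  off_p : τ.rarr 4 p + δp = σ.rarr 4 p
  linked : Linked (τ.narr 6) (τ.narr 7 p) p (lp ++ v :: lv)
  nxt : ∀ x, x ≠ σ.narr 7 p → τ.narr 6 x = σ.narr 6 x
  last : ∀ x, x ≠ p → τ.narr 7 x = σ.narr 7 x

/-- Adding δ to the keys of a list and subtracting it from the offset keeps their sum. The shorter
list is adapted to the offset of the other one, so one of `δv`, `δp` is zero. This precedes the
melding of the heaps `O`, as values are comparable only under a common offset. The heaps `I` belong
to groups and are left alone. Of the 70 credits per node, 30 pay for the walk and 40 for the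
rekeying. -/
theorem joinProg_spec {P : ChainData} {σ : State} {v p c : ℕ} {lv lp : List ℕ}
    {tM tO tI : ℕ → HTree} (h : Core P σ tM tO tI) (hv : σ.nvar 11 = v) (hp : σ.nvar 14 = p)
    (hvn : v < P.n) (hpn : p < P.n)
    (h1 : Linked (σ.narr 6) (σ.narr 7 v) v lv) (h2 : Linked (σ.narr 6) (σ.narr 7 p) p lp)
    (hnd : (p :: lp ++ v :: lv).Nodup) (d : ℕ)
    (hc : 70 * min (v :: lv).length (p :: lp).length + 2 * heapTime P.n + 120 + d ≤ c) :
    WP joinProg (fun τ c' => d ≤ c' ∧ ∃ δv δp, Joined P σ τ v p lv lp tM tO tI δv δp) σ c := by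
  have hnp := (List.nodup_append.1 hnd).1
  have hnv := (List.nodup_append.1 hnd).2.1
  have hdis : ∀ x ∈ p :: lp, x ∉ v :: lv := fun x hx hx' =>
    (List.nodup_append.1 hnd).2.2 x hx x hx' rfl
  have hvp : v ≠ p := by
    rintro rfl
    exact hdis v (by simp) (by simp)
  set m := min (v :: lv).length (p :: lp).length with hm
  simp only [List.length_cons] at hm
  refine WP.seq (WP.mono (walkProg_spec hv hp h1 h2 hnv hnp (40 * m + 2 * heapTime P.n + 90 + d)
    (by simp only [List.length_cons]; omega)) ?_)
  rintro τ c1 ⟨hc1, ⟨a, b, rfl⟩, hw1, hw2⟩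
  refine WP.seq (WP.block (by simp [chooseProg]) (40 * m + 2 * heapTime P.n + 40 + d)
    (by simp [chooseProg]; omega) ?_)
  -- after the shorter list has been chosen
  have hrest : ∀ (υ : State) (q : ℕ) (lq : List ℕ) (δv δp : ℝ),
      υ.narr = σ.narr → (∀ x, x ≠ 15 → x ≠ 16 → υ.nvar x = σ.nvar x) →
      (∀ x, x ≠ 2 → υ.rvar x = σ.rvar x) → (∀ a, a ≠ 4 → υ.rarr a = σ.rarr a) →
      υ.nvar 15 = q → Linked (σ.narr 6) (υ.nvar 16) q lq → (q :: lq).Nodup → lq.length + 1 ≤ m →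
      (∀ x, x ≠ p → υ.rarr 4 x = σ.rarr 4 x) → υ.rarr 4 p + δv = σ.rarr 4 v →
      υ.rarr 4 p + δp = σ.rarr 4 p →
      (q :: lq = v :: lv ∧ υ.rvar 2 = δv ∧ δp = 0 ∨ q :: lq = p :: lp ∧ υ.rvar 2 = δp ∧ δv = 0) →
      WP (rekeyProg ;; moveProg 0 1 14 11 ;; moveProg 4 3 14 11 ;;
        (.putN 6 (get 7 (var 14)) (var 11) ;; .putN 7 (var 14) (get 7 (var 11))))
        (fun τ c' => d ≤ c' ∧ ∃ δv δp, Joined P σ τ v p lv lp tM tO tI δv δp) υ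
        (40 * m + 2 * heapTime P.n + 40 + d) := by
    intro υ q lq δv δp en ev er ea e15 hlq hnq hlen eo eov eop hcase
    refine WP.seq (WP.mono (rekeyProg_spec e15 (by rw [en]; exact hlq) hnq
      (2 * heapTime P.n + 30 + d) (by simp only [List.length_cons]; omega)) ?_)
    rintro τ1 c2 ⟨hc2, hR⟩
    have k1 : Core P τ1 tM tO tI := by
      refine h.of_eq ?_ (fun a _ => by rw [hR.narr, en]) ?_ fun a ha => ?_
      · rw [hR.nvar _ (by norm_num), ev _ (by norm_num) (by norm_num)]
      · rw [hR.rvar, er _ (by norm_num)]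
      · rw [hR.rarr a (by omega) (by omega), ea a (by omega)]
    have v1 : τ1.nvar 11 = v := by rw [hR.nvar _ (by norm_num), ev _ (by norm_num) (by norm_num), hv]
    have p1 : τ1.nvar 14 = p := by rw [hR.nvar _ (by norm_num), ev _ (by norm_num) (by norm_num), hp]
    refine WP.seq (WP.mono (moveProg_spec k1.hM (by norm_num) (by norm_num) (by rw [p1]; exact hpn)
      (by rw [v1]; exact hvn) (by rw [p1, v1]; exact hvp.symm) (heapTime P.n + 30 + d) (by omega)) ?_)
    rintro τ2 c3 ⟨hc3, hF2, hM2⟩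
    rw [p1, v1, k1.s] at hM2
    have k2 := k1.of_frameM hF2 hM2
    have v2 : τ2.nvar 11 = v := by rw [hF2.nvar _ (by omega), v1]
    have p2 : τ2.nvar 14 = p := by rw [hF2.nvar _ (by omega), p1]
    refine WP.seq (WP.mono (moveProg_spec k2.hO (by norm_num) (by norm_num) (by rw [p2]; exact hpn)
      (by rw [v2]; exact hvn) (by rw [p2, v2]; exact hvp.symm) (30 + d) (by omega)) ?_)
    rintro τ3 c4 ⟨hc4, hF3, hO3⟩
    rw [p2, v2] at hO3
    have k3 := k2.of_frameO hF3 hO3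
    have v3 : τ3.nvar 11 = v := by rw [hF3.nvar _ (by omega), v2]
    have p3 : τ3.nvar 14 = p := by rw [hF3.nvar _ (by omega), p2]
    have n6 : ∀ a < 9, τ3.narr a = σ.narr a := fun a ha => by
      rw [hF3.narr _ (by omega) (by omega), hF2.narr _ (by omega) (by omega), hR.narr, en]
    have r3 : τ3.rarr = τ1.rarr := by rw [hF3.rarr, hF2.rarr]
    refine WP.block (by simp) d (by simp; omega) ⟨le_rfl, δv, δp, ?_⟩
    have hkv : (∀ x ∈ v :: lv, τ3.rarr 2 x = σ.rarr 2 x + δv ∧ τ3.rarr 3 x = σ.rarr 3 x + δv) ∧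
        (∀ x ∈ p :: lp, τ3.rarr 2 x = σ.rarr 2 x + δp ∧ τ3.rarr 3 x = σ.rarr 3 x + δp) ∧
        (∀ x, x ∉ v :: lv → x ∉ p :: lp → τ3.rarr 2 x = σ.rarr 2 x ∧ τ3.rarr 3 x = σ.rarr 3 x) := by
      rw [r3, ← ea 2 (by norm_num), ← ea 3 (by norm_num)]
      rcases hcase with ⟨hq, hδ, h0⟩ | ⟨hq, hδ, h0⟩
      · rw [hq, hδ] at hR
        rw [h0]
        simp only [add_zero]
        exact ⟨fun x hx => ⟨hR.key x hx, hR.val x hx⟩,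
          fun x hx => ⟨hR.key_out x (hdis x hx), hR.val_out x (hdis x hx)⟩,
          fun x hx _ => ⟨hR.key_out x hx, hR.val_out x hx⟩⟩
      · rw [hq, hδ] at hR
        rw [h0]
        simp only [add_zero]
        exact ⟨fun x hx => ⟨hR.key_out x fun h => hdis x h hx, hR.val_out x fun h => hdis x h hx⟩,
          fun x hx => ⟨hR.key x hx, hR.val x hx⟩,
          fun x _ hx => ⟨hR.key_out x hx, hR.val_out x hx⟩⟩
    have r4 : τ3.rarr 4 = υ.rarr 4 := by rw [r3, hR.rarr 4 (by norm_num) (by norm_num)]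
    refine ⟨?_, ?_, ?_, ?_, ?_, fun x hx => (hkv.1 x hx).1, fun x hx => (hkv.1 x hx).2,
      fun x hx => (hkv.2.1 x hx).1, fun x hx => (hkv.2.1 x hx).2, fun x hx hx' => (hkv.2.2 x hx hx').1,
      fun x hx hx' => (hkv.2.2 x hx hx').2, ?_, ?_, ?_, ?_, ?_, ?_⟩
    · have := k3.of_eq (τ := Prog.run (.putN 6 (get 7 (var 14)) (var 11) ;;
        .putN 7 (var 14) (get 7 (var 11))) τ3) rfl (fun a ha => ?_) rfl (fun _ _ => rfl)
      · convert this using 1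
        simp [hF3.rarr]
      · have : a ≠ 6 := by omega
        have : a ≠ 7 := by omega
        simp [*]
    · intro x hx h15 h16
      simp only [Prog.run, State.nvar_putN]
      rw [hF3.nvar _ (by omega), hF2.nvar _ (by omega), hR.nvar _ h15, ev _ h15 h16]
    · intro x hx
      simp only [Prog.run, State.rvar_putN]
      rw [hF3.rvar, hF2.rvar, hR.rvar, er _ hx]
    · intro a ha h6 h7
      simp [h6, h7, n6 a ha]
    · intro a h2 h3 h4
      simp only [Prog.run, State.rarr_putN]
      rw [r3, hR.rarr a h2 h3, ea a h4]
    · intro x hx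
      simp only [Prog.run, State.rarr_putN]
      rw [r4, eo x hx]
    · simp only [Prog.run, State.rarr_putN]
      rw [r4, eov]
    · simp only [Prog.run, State.rarr_putN]
      rw [r4, eop]
    · have := h2.append h1 hnd
      simpa [v3, p3, n6] using this
    · intro x hx
      simp [v3, p3, n6, hx]
    · intro x hx
      simp [v3, p3, n6, hx]
  by_cases hb : a = σ.narr 7 v
  · subst hb
    refine hrest _ v lv (σ.rarr 4 v - σ.rarr 4 p) 0 ?_ ?_ ?_ ?_ ?_ ?_ hnv ?_ ?_ ?_ ?_ ?_
    · simp [chooseProg, hv, hp]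
    · intro x h15 h16
      simp [chooseProg, hv, hp, h15, h16]
    · intro x hx
      simp [chooseProg, hv, hp, hx]
    · intro a ha
      simp [chooseProg, hv, hp, ha]
    · simp [chooseProg, hv, hp]
    · simpa [chooseProg, hv, hp] using h1
    · have := hw1 (by simp)
      omega
    · simp [chooseProg, hv, hp]
    · simp [chooseProg, hv, hp]
    · simp [chooseProg, hv, hp]
    · left
      simp [chooseProg, hv, hp]
  · refine hrest _ p lp 0 (σ.rarr 4 p - σ.rarr 4 v) ?_ ?_ ?_ ?_ ?_ ?_ hnp ?_ ?_ ?_ ?_ ?_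
    · simp [chooseProg, hv, hp, hb]
    · intro x h15 h16
      simp [chooseProg, hv, hp, h15, h16, hb]
    · intro x hx
      simp [chooseProg, hv, hp, hx, hb]
    · intro a ha
      simp [chooseProg, hv, hp, ha, hb]
    · simp [chooseProg, hv, hp, hb]
    · simpa [chooseProg, hv, hp, hb] using h2
    · have := hw2 (by simpa using hb)
      omega
    · intro x hx
      simp [chooseProg, hv, hp, hb, hx]
    · simp [chooseProg, hv, hp, hb]
    · simp [chooseProg, hv, hp, hb]
    · right
      simp [chooseProg, hv, hp, hb]

end RAM

/-! ## Treated nodes and components -/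

namespace ChainData

variable (P : ChainData)

/-- The first `i` nodes in the order. -/
def treated (i : ℕ) : Finset ℕ := (Finset.range i).image P.ord

/-- The ancestors of `u` among the first `i` nodes in the order. -/
def below (i u : ℕ) : Finset ℕ := P.A u ∩ P.treated i

variable {P} {i : ℕ}

theorem exists_ord {z : ℕ} (hz : z < P.n) : ∃ j < P.n, P.ord j = z := by
  have h1 : ((Finset.range P.n).image P.ord) = Finset.range P.n := by
    refine Finset.eq_of_subset_of_card_le ?_ ?_
    · intro x hx
      obtain ⟨j, hj, rfl⟩ := Finset.mem_image.1 hx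
      exact Finset.mem_range.2 (P.ord_lt j (Finset.mem_range.1 hj))
    · rw [Finset.card_image_of_injOn]
      intro a ha b hb h
      exact P.ord_inj a (by simpa using ha) b (by simpa using hb) h
  have h2 : z ∈ (Finset.range P.n).image P.ord := by rw [h1]; simpa using hz
  obtain ⟨j, hj, e⟩ := Finset.mem_image.1 h2
  exact ⟨j, by simpa using hj, e⟩

/-- Each step to the parent moves to a later position in the order; induct from the root downwards.
-/
theorem ord_le_of_anc {j k : ℕ} (hj : j < P.n) (hk : k < P.n) (h : P.ord k ∈ P.A (P.ord j)) :
    j ≤ k := by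
  have key : ∀ z < P.n, ∀ j < P.n, P.ord j = z → P.ord k ∈ P.A z → j ≤ k := by
    intro z hz
    refine P.tree.induct (motive := fun z => ∀ j < P.n, P.ord j = z → P.ord k ∈ P.A z → j ≤ k)
      ?_ ?_ hz
    · intro j hj e h
      rw [P.tree.anc_root, Finset.mem_singleton] at h
      exact (P.ord_inj j hj k hk (e.trans h.symm)).le
    · intro v hv hr ih j hj e h
      rw [P.tree.anc_step v hv hr, Finset.mem_insert] at h
      rcases h with h | h
      · exact (P.ord_inj j hj k hk (e.trans h.symm)).le
      · subst e
        obtain ⟨j', hj', hlt, e'⟩ := P.ord_par j hj hr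
        have := ih j' hj' e' h
        omega
  exact key _ (P.ord_lt j hj) j hj rfl h

theorem mem_treated {z : ℕ} : z ∈ P.treated i ↔ ∃ j < i, P.ord j = z := by
  simp [treated]

theorem treated_succ : P.treated (i + 1) = insert (P.ord i) (P.treated i) := by
  simp [treated, Finset.range_add_one]

theorem treated_lt (hi : i ≤ P.n) {z : ℕ} (hz : z ∈ P.treated i) : z < P.n := by
  obtain ⟨j, hj, rfl⟩ := mem_treated.1 hz
  exact P.ord_lt j (by omega)

theorem ord_notMem (hi : i < P.n) : P.ord i ∉ P.treated i := by
  intro h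
  obtain ⟨j, hj, e⟩ := mem_treated.1 h
  have := P.ord_inj j (by omega) i hi e
  omega

theorem treated_closed (hi : i ≤ P.n) {y z : ℕ} (hz : z < P.n) (hy : y ∈ P.treated i)
    (h : y ∈ P.A z) : z ∈ P.treated i := by
  obtain ⟨k, hk, rfl⟩ := mem_treated.1 hy
  obtain ⟨j, hj, rfl⟩ := exists_ord hz
  have := ord_le_of_anc hj (by omega) h
  exact mem_treated.2 ⟨j, by omega, rfl⟩

theorem ready (hi : i < P.n) {z : ℕ} (hz : z < P.n) (h : P.ord i ∈ P.A z) (hne : z ≠ P.ord i) :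
    z ∈ P.treated i := by
  obtain ⟨j, hj, rfl⟩ := exists_ord hz
  have := ord_le_of_anc hj hi h
  refine mem_treated.2 ⟨j, ?_, rfl⟩
  rcases this.lt_or_eq with h | rfl
  · exact h
  · exact absurd rfl hne

theorem below_ord (hi : i < P.n) : P.below i (P.ord i) = ∅ := by
  rw [Finset.eq_empty_iff_forall_notMem]
  intro y hy
  rw [below, Finset.mem_inter] at hy
  exact ord_notMem hi (treated_closed hi.le (P.ord_lt i hi) hy.2 hy.1)

theorem below_succ_of_mem {u : ℕ} (h : P.ord i ∈ P.A u) :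
    P.below (i + 1) u = insert (P.ord i) (P.below i u) := by
  rw [below, treated_succ, Finset.inter_insert_of_mem h, below]

theorem below_succ_of_notMem {u : ℕ} (h : P.ord i ∉ P.A u) : P.below (i + 1) u = P.below i u := by
  rw [below, treated_succ, Finset.inter_insert_of_notMem h, below]

/-- Descendants of a node precede it, ancestors follow it. So once `P.ord i` is treated, the treated
ancestors of `u` form exactly the path up to it. This links the sets `D` of the component invariant
with the paths of `PathCert`. -/
theorem below_succ_eq_pathSet (hi : i < P.n) {u : ℕ} (hu : u < P.n) (h : P.ord i ∈ P.A u) :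
    P.below (i + 1) u = pathSet P.A (P.ord i) u := by
  rw [below_succ_of_mem h]
  ext y
  simp only [below, pathSet, Finset.mem_insert, Finset.mem_inter, Finset.mem_filter]
  constructor
  · rintro (rfl | ⟨h1, h2⟩)
    · exact ⟨h, P.tree.self_mem (P.ord_lt i hi)⟩
    · refine ⟨h1, (P.tree.anc_total hu h1 h).resolve_left fun h3 => ?_⟩
      exact ord_notMem hi (treated_closed hi.le (P.ord_lt i hi) h2 h3)
  · rintro ⟨h1, h2⟩
    by_cases e : y = P.ord i
    · exact .inl e
    · exact .inr ⟨h1, ready hi (P.tree.anc_lt hu h1) h2 e⟩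

theorem par_ord_notMem (hi : i < P.n) (hr : P.ord i ≠ P.root) :
    P.par (P.ord i) ∉ P.treated (i + 1) := by
  rw [treated_succ, Finset.mem_insert, not_or]
  have hv := P.ord_lt i hi
  exact ⟨P.tree.par_ne hv hr, fun h =>
    ord_notMem hi (treated_closed hi.le hv h (P.tree.par_mem hv))⟩

end ChainData

/-! ### Components as lists, and the potential that pays for rekeying -/

/-- The nodes of a component: a node `r` that has not been treated, and those nodes below it all of
whose ancestors below `r` have been treated. -/
structure CompLists (P : ChainData) (i : ℕ) (cl : ℕ → List ℕ) : Prop where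
  mem : ∀ r < P.n, r ∉ P.treated i → ∀ u,
    u ∈ r :: cl r ↔ u < P.n ∧ r ∈ P.A u ∧ P.A u ⊆ P.A r ∪ P.treated i
  nodup : ∀ r < P.n, r ∉ P.treated i → (r :: cl r).Nodup

/-- The size potential of the components. -/
def listPot (P : ChainData) (i : ℕ) (cl : ℕ → List ℕ) : ℕ :=
  ∑ r ∈ Finset.range P.n \ P.treated i, (r :: cl r).length * Nat.log 2 (r :: cl r).length

/-- When two sets are united, the set containing an element of the smaller one at least doubles, so
each such element gains at least 1 in its logarithm. -/
theorem mul_log_add_le {a b : ℕ} (ha : 0 < a) (hb : 0 < b) :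
    a * Nat.log 2 a + b * Nat.log 2 b + min a b ≤ (a + b) * Nat.log 2 (a + b) := by
  wlog h : a ≤ b generalizing a b
  · have := this hb ha (by omega)
    rw [Nat.min_comm, Nat.add_comm a b]
    omega
  have h1 : Nat.log 2 a + 1 ≤ Nat.log 2 (a + b) := by
    rw [← Nat.log_mul_base (by norm_num) ha.ne']
    exact Nat.log_mono_right (by omega)
  have h2 : Nat.log 2 b ≤ Nat.log 2 (a + b) := Nat.log_mono_right (by omega)
  rw [Nat.min_eq_left h]
  nlinarith

namespace CompLists

variable {P : ChainData} {i : ℕ} {cl : ℕ → List ℕ}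

/-- All proper descendants of the next node have been treated, so its component has become its whole
subtree. -/
theorem mem_ord (h : CompLists P i cl) (hi : i < P.n) (u : ℕ) :
    u ∈ P.ord i :: cl (P.ord i) ↔ u < P.n ∧ P.ord i ∈ P.A u := by
  rw [h.mem _ (P.ord_lt i hi) (ChainData.ord_notMem hi)]
  refine ⟨fun h => ⟨h.1, h.2.1⟩, fun h => ⟨h.1, h.2, fun y hy => ?_⟩⟩
  rw [Finset.mem_union]
  rcases P.tree.anc_total h.1 hy h.2 with h1 | h1
  · exact .inl h1
  · by_cases e : y = P.ord i
    · exact .inl (by rw [e]; exact P.tree.self_mem (P.ord_lt i hi))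
    · exact .inr (ChainData.ready hi (P.tree.anc_lt h.1 hy) h1 e)

theorem disjoint (h : CompLists P i cl) {r r' u : ℕ} (hr : r < P.n) (hr' : r' < P.n)
    (hrt : r ∉ P.treated i) (hrt' : r' ∉ P.treated i) (hu : u ∈ r :: cl r) (hu' : u ∈ r' :: cl r') :
    r = r' := by
  rw [h.mem r hr hrt] at hu
  rw [h.mem r' hr' hrt'] at hu'
  have h1 := hu'.2.2 hu.2.1
  have h2 := hu.2.2 hu'.2.1
  rw [Finset.mem_union] at h1 h2
  exact P.tree.anc_antisymm hr' (h1.resolve_right hrt) (h2.resolve_right hrt')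

/-- Shows that treating `P.ord i` changes no path in another component. If it were an untreated
ancestor of `u`, it would lie above `r`, and then `r` would have been treated earlier. -/
theorem notMem_anc (h : CompLists P i cl) (hi : i < P.n) {r u : ℕ} (hr : r < P.n)
    (hrt : r ∉ P.treated i) (hne : r ≠ P.ord i) (hu : u ∈ r :: cl r) : P.ord i ∉ P.A u := by
  intro hv
  rw [h.mem r hr hrt] at hu
  have h1 := hu.2.2 hv
  rw [Finset.mem_union] at h1
  exact hrt (ChainData.ready hi hr (h1.resolve_right (ChainData.ord_notMem hi)) hne)

/-- Treating a node removes the barrier between it and its parent, and nothing else: its list is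
appended to that of the parent. -/
theorem step (h : CompLists P i cl) (hi : i < P.n) (hroot : P.ord i ≠ P.root) :
    CompLists P (i + 1) (Function.update cl (P.par (P.ord i))
      (cl (P.par (P.ord i)) ++ P.ord i :: cl (P.ord i))) := by
  set v := P.ord i with hvdef
  set p := P.par v with hpdef
  have hv : v < P.n := P.ord_lt i hi
  have hp : p < P.n := P.tree.par_lt v hv
  have hpt : p ∉ P.treated i := fun h => ChainData.par_ord_notMem hi hroot (by
    rw [ChainData.treated_succ]; exact Finset.mem_insert_of_mem h)
  have hvt : v ∉ P.treated i := ChainData.ord_notMem hi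
  have hpv : p ≠ v := P.tree.par_ne hv hroot
  have hAv : P.A v = insert v (P.A p) := P.tree.anc_step v hv hroot
  constructor
  · intro r hr hrt u
    rw [ChainData.treated_succ, Finset.mem_insert, not_or] at hrt
    rw [ChainData.treated_succ]
    by_cases hrp : r = p
    · subst hrp
      rw [Function.update_self, ← List.cons_append, List.mem_append, h.mem _ hr hrt.2,
        h.mem v hv hvt]
      constructor
      · rintro (⟨h1, h2, h3⟩ | ⟨h1, h2, h3⟩)
        · exact ⟨h1, h2, h3.trans (Finset.union_subset_union_right (Finset.subset_insert _ _))⟩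
        · refine ⟨h1, P.tree.anc_subset h1 h2 (P.tree.par_mem hv), h3.trans ?_⟩
          rw [hAv, ← hvdef]
          intro y
          simp only [Finset.mem_union, Finset.mem_insert]
          tauto
      · rintro ⟨h1, h2, h3⟩
        by_cases hvu : v ∈ P.A u
        · refine .inr ⟨h1, hvu, h3.trans ?_⟩
          rw [hAv, ← hvdef]
          intro y
          simp only [Finset.mem_union, Finset.mem_insert]
          tauto
        · refine .inl ⟨h1, h2, fun y hy => ?_⟩
          have := h3 hy
          simp only [Finset.mem_union, Finset.mem_insert] at this ⊢
          rcases this with h | h | h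
          · exact .inl h
          · exact absurd (by rw [hvdef, ← h]; exact hy) hvu
          · exact .inr h
    · rw [Function.update_of_ne hrp, h.mem r hr hrt.2]
      refine and_congr_right fun hu => and_congr_right fun hru => ⟨fun h1 => h1.trans
        (Finset.union_subset_union_right (Finset.subset_insert _ _)), fun h1 y hy => ?_⟩
      have h2 := h1 hy
      simp only [Finset.mem_union, Finset.mem_insert] at h2 ⊢
      rcases h2 with h2 | h2 | h2
      · exact .inl h2
      · left
        subst h2
        -- Otherwise `r` lies properly above `v`, hence at or above `p`. Then `p` is an untreated
        -- ancestor of `u`, so it must lie in `P.A r`, which forces `r = p`.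
        by_contra hvr
        have hrv := (P.tree.anc_total hu hy hru).resolve_left hvr
        have hrp' : r ∈ P.A p := P.tree.mem_par_of_ne hv hrv hrt.1
        have hpu : p ∈ P.A u := P.tree.anc_subset hu hy (P.tree.par_mem hv)
        have h3 := h1 hpu
        simp only [Finset.mem_union, Finset.mem_insert] at h3
        rcases h3 with h3 | h3 | h3
        · exact hrp (P.tree.anc_antisymm hp hrp' h3)
        · exact hpv h3
        · exact hpt h3
      · exact .inr h2
  · intro r hr hrt
    rw [ChainData.treated_succ, Finset.mem_insert, not_or] at hrt
    by_cases hrp : r = p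
    · subst hrp
      rw [Function.update_self, ← List.cons_append]
      refine List.Nodup.append (h.nodup _ hr hrt.2) (h.nodup v hv hvt) fun u hu hu' => ?_
      exact hpv (h.disjoint hp hv hpt hvt hu hu')
    · rw [Function.update_of_ne hrp]
      exact h.nodup r hr hrt.2

theorem sum_length_le (h : CompLists P i cl) :
    ∑ r ∈ Finset.range P.n \ P.treated i, (r :: cl r).length ≤ P.n := by
  have h1 : ∀ r ∈ Finset.range P.n \ P.treated i,
      (r :: cl r).length = (r :: cl r).toFinset.card := by
    intro r hr
    rw [Finset.mem_sdiff, Finset.mem_range] at hr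
    rw [List.toFinset_card_of_nodup (h.nodup r hr.1 hr.2)]
  rw [Finset.sum_congr rfl h1, ← Finset.card_biUnion]
  · calc _ ≤ (Finset.range P.n).card := by
          refine Finset.card_le_card fun u hu => ?_
          simp only [Finset.mem_biUnion, Finset.mem_sdiff, Finset.mem_range, List.mem_toFinset] at hu
          obtain ⟨r, ⟨h1, h2⟩, h3⟩ := hu
          exact Finset.mem_range.2 ((h.mem r h1 h2 u).1 h3).1
      _ = P.n := Finset.card_range _
  · intro r hr r' hr' hne
    rw [Finset.mem_coe, Finset.mem_sdiff, Finset.mem_range] at hr hr'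
    refine Finset.disjoint_left.2 fun u hu hu' => hne ?_
    rw [List.mem_toFinset] at hu hu'
    exact h.disjoint hr.1 hr'.1 hr.2 hr'.2 hu hu'

theorem listPot_le (h : CompLists P i cl) : listPot P i cl ≤ P.n * Nat.log 2 P.n := by
  have hs := h.sum_length_le
  calc listPot P i cl
      ≤ ∑ r ∈ Finset.range P.n \ P.treated i, (r :: cl r).length * Nat.log 2 P.n := by
        refine Finset.sum_le_sum fun r hr => Nat.mul_le_mul_left _ (Nat.log_mono_right ?_)
        exact (Finset.single_le_sum (f := fun r => (r :: cl r).length) (fun _ _ => Nat.zero_le _)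
          hr).trans hs
    _ = (∑ r ∈ Finset.range P.n \ P.treated i, (r :: cl r).length) * Nat.log 2 P.n := by
        rw [Finset.sum_mul]
    _ ≤ P.n * Nat.log 2 P.n := Nat.mul_le_mul_right _ hs

/-- Only the two united components contribute a change, and `mul_log_add_le` bounds their gain from
below by the length of the shorter list. -/
theorem listPot_step (hi : i < P.n) (hroot : P.ord i ≠ P.root) :
    listPot P i cl + min (P.ord i :: cl (P.ord i)).length
        (P.par (P.ord i) :: cl (P.par (P.ord i))).length ≤
      listPot P (i + 1) (Function.update cl (P.par (P.ord i))
        (cl (P.par (P.ord i)) ++ P.ord i :: cl (P.ord i))) := by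
  set v := P.ord i with hvdef
  set p := P.par v with hpdef
  have hv : v < P.n := P.ord_lt i hi
  have hp : p < P.n := P.tree.par_lt v hv
  have hpv : p ≠ v := P.tree.par_ne hv hroot
  have hpt := ChainData.par_ord_notMem hi hroot
  have hset : Finset.range P.n \ P.treated (i + 1) = (Finset.range P.n \ P.treated i).erase v := by
    rw [ChainData.treated_succ]
    ext y
    simp only [Finset.mem_sdiff, Finset.mem_insert, Finset.mem_erase, not_or]
    tauto
  have hvm : v ∈ Finset.range P.n \ P.treated i := by
    rw [Finset.mem_sdiff, Finset.mem_range]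
    exact ⟨hv, ChainData.ord_notMem hi⟩
  have hpm : p ∈ (Finset.range P.n \ P.treated i).erase v := by
    rw [← hset, Finset.mem_sdiff, Finset.mem_range]
    exact ⟨hp, hpt⟩
  unfold listPot
  rw [hset, ← Finset.add_sum_erase _ _ hvm, ← Finset.add_sum_erase _ _ hpm,
    ← Finset.add_sum_erase _ _ hpm]
  have hrest : ∀ r ∈ ((Finset.range P.n \ P.treated i).erase v).erase p,
      (r :: Function.update cl p (cl p ++ v :: cl v) r).length *
        Nat.log 2 (r :: Function.update cl p (cl p ++ v :: cl v) r).length =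
      (r :: cl r).length * Nat.log 2 (r :: cl r).length := by
    intro r hr
    rw [Function.update_of_ne (Finset.ne_of_mem_erase hr)]
  rw [Finset.sum_congr rfl hrest, Function.update_self]
  have := mul_log_add_le (a := (v :: cl v).length) (b := (p :: cl p).length) (by simp) (by simp)
  have e : (p :: (cl p ++ v :: cl v)).length = (v :: cl v).length + (p :: cl p).length := by
    simp only [List.length_cons, List.length_append]; omega
  rw [e]
  omega

end CompLists

/-! ## The main loop -/

theorem PathCert.congr {n : ℕ} {A : ℕ → Finset ℕ} {w s E E' : ℕ → ℝ} {w₀ : ℝ} {v u : ℕ}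
    (h : PathCert n A w s E w₀ v u) (hE : ∀ x < n, v ∈ A x → ∀ y ∈ pathSet A v x, E' y = E y) :
    PathCert n A w s E' w₀ v u := by
  refine ⟨h.lt, h.anc, h.light, ?_, fun x hx hvx hw m hm => ?_⟩
  · rw [Finset.sum_congr rfl (hE u h.lt h.anc)]
    exact h.tight
  · rw [Finset.sum_congr rfl (hE x hx hvx)]
    exact h.feasible x hx hvx hw m hm

namespace RAM

open HTree NExpr

/-- The invariant of the main loop, after `i` nodes have been treated. -/
structure MainInv (P : ChainData) (i : ℕ) (σ : State) (tM tO tI : ℕ → HTree) (cl : ℕ → List ℕ) :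
    Prop extends Core P σ tM tO tI where
  lists : CompLists P i cl
  linked : ∀ r < P.n, r ∉ P.treated i → Linked (σ.narr 6) (σ.narr 7 r) r (cl r)
  comp : ∀ r < P.n, r ∉ P.treated i → Component (P.below i) P.w P.s P.w₀ (r :: cl r) (tM r) (tO r)
    tI .nil 0 (σ.rarr 2) (σ.rarr 3)
  -- Lazy updates: a stored key is meaningful only together with the offset of its component.
  key : ∀ r < P.n, r ∉ P.treated i → ∀ u ∈ r :: cl r,
    σ.rarr 2 u + σ.rarr 4 r = -∑ y ∈ P.below i u, σ.rarr 5 y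
  -- The heaps of a treated node have been moved to its parent. The root is exempt, having nowhere
  -- to move them.
  empty : ∀ r, r ∈ P.treated i ∧ r ≠ P.root ∨ P.n ≤ r → tM r = .nil ∧ tO r = .nil
  I_only : ∀ x, tI x ≠ .nil → ∃ r, x ∈ (tM r).nodes
  cert : ∀ v ∈ P.treated i, PathCert P.n P.A P.w P.s (σ.rarr 5) P.w₀ v (σ.narr 5 v)
  total : σ.rvar 1 = ∑ v ∈ P.treated i, σ.rarr 5 v

/-- Record the best candidate of the node in variable `11`. -/
def recordProg : Prog :=
  .setR 3 (.add (.add (.get 1 (var 12)) (.get 2 (var 13))) (.get 4 (var 11))) ;;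
    .putR 5 (var 11) (.var 3) ;; .putN 5 (var 11) (var 13) ;; .setR 1 (.add (.var 1) (.var 3)) ;;
    .putR 4 (var 11) (.sub (.get 4 (var 11)) (.var 3))

/-- Compute the value of the node in variable `11`. -/
def valueProg : Prog := absorbProg ;; insertProg ;; queryProg ;; recordProg

/-- The state after the value of the node `v = ord i` has been computed. -/
structure Valued (P : ChainData) (i v : ℕ) (σ τ : State) (tM tO tI : ℕ → HTree) (cl : ℕ → List ℕ)
    (tM' tO' tI' : ℕ → HTree) : Prop extends Core P τ tM' tO' tI' where
  nvar : ∀ x, x = 0 ∨ 10 ≤ x → x ≠ 12 → x ≠ 13 → x ≠ 14 → τ.nvar x = σ.nvar x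
  narr : ∀ a < 9, a ≠ 5 → τ.narr a = σ.narr a
  tM_eq : ∀ y, y ≠ v → tM' y = tM y
  tO_eq : ∀ y, y ≠ v → tO' y = tO y
  tI_eq : ∀ y, y ∉ v :: cl v → tI' y = tI y
  key_eq : τ.rarr 2 = σ.rarr 2
  val_eq : ∀ y, y ∉ v :: cl v → τ.rarr 3 y = σ.rarr 3 y
  off_eq : ∀ y, y ≠ v → τ.rarr 4 y = σ.rarr 4 y
  E_eq : ∀ y, y ≠ v → τ.rarr 5 y = σ.rarr 5 y
  comp : Component (P.below (i + 1)) P.w P.s P.w₀ (v :: cl v) (tM' v) (tO' v) tI' .nil 0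
    (τ.rarr 2) (τ.rarr 3)
  key : ∀ u ∈ v :: cl v, τ.rarr 2 u + τ.rarr 4 v = -∑ y ∈ P.below (i + 1) u, τ.rarr 5 y
  I_only : ∀ x, tI' x ≠ .nil → ∃ r, x ∈ (tM' r).nodes
  cert : ∀ v ∈ P.treated (i + 1), PathCert P.n P.A P.w P.s (τ.rarr 5) P.w₀ v (τ.narr 5 v)
  total : τ.rvar 1 = ∑ v ∈ P.treated (i + 1), τ.rarr 5 v

/-- The credits reserved for the nodes in the heaps. -/
def heapCredit (n : ℕ) (tM tO tI : ℕ → HTree) : ℕ :=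
  (2 * heapTime n + 40) * heapCount n tM +
    (3 * heapTime n + 100) * (heapCount n tO + heapCount n tI)

/-- The top of the heaps after the query is a minimiser in the recursion for E(v): minimality gives
feasibility of all light paths with top `v`, and the minimiser gives tightness. The eleven
`heapTime` are three insertions, two in credit for the new node of `M`, and three each for those of
`O` and `I`. -/
theorem valueProg_spec {P : ChainData} {i v : ℕ} {σ : State} {tM tO tI : ℕ → HTree}
    {cl : ℕ → List ℕ} {c : ℕ} (h : MainInv P i σ tM tO tI cl) (hi : i < P.n) (hv : P.ord i = v)
    (hvar : σ.nvar 11 = v) (d : ℕ)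
    (hc : heapCredit P.n tM tO tI + 11 * heapTime P.n + 400 + d ≤ c) :
    WP valueProg (fun τ c' => ∃ tM' tO' tI', Valued P i v σ τ tM tO tI cl tM' tO' tI' ∧
      heapCredit P.n tM' tO' tI' + d ≤ c') σ c := by
  have hvn : v < P.n := hv ▸ P.ord_lt i hi
  have hvt : v ∉ P.treated i := hv ▸ ChainData.ord_notMem hi
  have hmem : ∀ u, u ∈ v :: cl v ↔ u < P.n ∧ v ∈ P.A u := hv ▸ h.lists.mem_ord hi
  have hD0 : P.below i v = ∅ := hv ▸ ChainData.below_ord hi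
  have hvD : ∀ u ∈ v :: cl v, v ∉ P.below i u := fun u _ hm =>
    hvt (Finset.mem_inter.1 hm).2
  have hD' : ∀ u ∈ v :: cl v, P.below (i + 1) u = insert v (P.below i u) := fun u hu => by
    have := ((hmem u).1 hu).2
    subst hv
    exact ChainData.below_succ_of_mem this
  have hDp : ∀ u ∈ v :: cl v, P.below (i + 1) u = pathSet P.A v u := fun u hu => by
    have := (hmem u).1 hu
    subst hv
    exact ChainData.below_succ_eq_pathSet hi this.1 this.2
  have hvv : v ∈ v :: cl v := by simp
  have hDself : ∀ u ∈ v :: cl v, u ∈ P.below (i + 1) u := fun u hu => by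
    rw [hDp u hu]
    exact P.tree.mem_pathSet_bot ((hmem u).1 hu).1 ((hmem u).1 hu).2
  -- no heap contains `v`
  have hroot : P.root ∉ P.treated i := fun hr =>
    hvt (ChainData.treated_closed hi.le hvn hr (P.tree.root_mem hvn))
  have hcases : ∀ y, (y < P.n ∧ y ∉ P.treated i) ∨ tM y = nil ∧ tO y = nil := by
    intro y
    by_cases h1 : y < P.n
    · by_cases h2 : y ∈ P.treated i
      · exact .inr (h.empty y (.inl ⟨h2, fun e => hroot (e ▸ h2)⟩))
      · exact .inl ⟨h1, h2⟩
    · exact .inr (h.empty y (.inr (not_lt.1 h1)))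
  have hself : v ∉ P.below i v := by rw [hD0]; simp
  have hvM : ∀ y, v ∉ (tM y).nodes := by
    intro y hy
    rcases hcases y with ⟨h1, h2⟩ | h1
    · exact hself ((h.comp y h1 h2).M_sub v hy).2
    · simp [h1.1, nodes] at hy
  have hvO : ∀ y, v ∉ (tO y).nodes := by
    intro y hy
    rcases hcases y with ⟨h1, h2⟩ | h1
    · exact hself ((h.comp y h1 h2).O_sub v hy).2
    · simp [h1.2, nodes] at hy
  -- The candidate heap of `v` starts out empty and can serve for the group under construction.
  have hIv : tI v = nil := by
    by_contra hne
    obtain ⟨r, hr⟩ := h.I_only v hne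
    exact hvM r hr
  unfold heapCredit at hc ⊢
  have habs : Absorbing P (P.below i) (v :: cl v) v σ tM tO tI :=
    ⟨h.toCore, hvar, hvn, hself, by
      rw [hIv]
      have := h.comp v hvn hvt
      exact ⟨this.M_sub, this.O_sub, this.I_sub, by simp [nodes], this.dead, this.live,
        this.complete, this.M_ord, this.O_ord, this.I_ord, trivial⟩,
      fun x hx => .inr (h.I_only x hx)⟩
  refine WP.seq (WP.mono (absorbProg_spec habs ((3 * heapTime P.n + 100) * (heapCount P.n tO +
    heapCount P.n tI) + 11 * heapTime P.n + 380 + d) (by omega)) ?_)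
  rintro σ1 c1 ⟨hF1, hr1, tM1, tI1, h1, hM1, hI1, hlt1, hcI1, hc1⟩
  have hvM1 : ∀ y, v ∉ (tM1 y).nodes := by
    intro y hy
    by_cases e : y = v
    · subst e
      exact hself (h1.comp.M_sub _ hy).2
    · rw [hM1 y e] at hy
      exact hvM y hy
  have hvI1 : ∀ y, v ∉ (tI1 y).nodes := by
    intro y hy
    have hne : tI1 y ≠ nil := fun e => by simp [e, nodes] at hy
    by_cases e : y = v
    · subst e
      exact hself (h1.comp.B_sub _ hy).2.1
    · obtain ⟨r, hr⟩ := (h1.I_only y hne).resolve_left e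
      by_cases er : r = v
      · subst er
        exact hself (h1.comp.I_sub y hr _ hy).2.1
      · rw [hM1 r er] at hr
        rcases hcases r with ⟨g1, g2⟩ | g1
        · have hyS := (h.comp r g1 g2).M_sub y hr
          have hyn : ¬ (y ∈ v :: cl v ∧ y ∈ P.below i y) := fun hh =>
            er (h.lists.disjoint g1 hvn g2 hvt hyS.1 hh.1)
          rw [hI1 y e hyn] at hy
          exact hself ((h.comp r g1 g2).I_sub y hr v hy).2.1
        · simp [g1.1, nodes] at hr
  refine WP.seq (WP.mono (insertProg_spec (D' := P.below (i + 1)) h1 hlt1 hvv hvD hD0 hD' hvM1 hvO hvI1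
    ((2 * heapTime P.n + 40) * heapCount P.n tM1 + (3 * heapTime P.n + 100) * (heapCount P.n tO + heapCount P.n tI) +
      8 * heapTime P.n + 360 + d) (by omega)) ?_)
  rintro σ2 c2 ⟨hc2, hF2, hval2, h2⟩
  have cM := heapCount_insHeap (t := tM1) (key := P.s) (x := v) hvn
  have cO := heapCount_insHeap (t := tO) (key := σ2.rarr 3) (x := v) hvn
  have cI := heapCount_insHeap (t := tI1) (key := σ1.rarr 2) (x := v) hvn
  set tM2 := insHeap P.s tM1 v v with htM2
  set tO2 := insHeap (σ2.rarr 3) tO v v with htO2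
  set tI2 := insHeap (σ1.rarr 2) tI1 v v with htI2
  have hw0 : ∑ y ∈ P.below (i + 1) v, P.w y ≤ P.w₀ := by
    rw [hD' v hvv, hD0]
    simpa using P.w_le v hvn
  have hW : ∀ u ∈ v :: cl v, P.W u - P.W v + P.w v = ∑ y ∈ P.below (i + 1) u, P.w y := by
    intro u hu
    have := (hmem u).1 hu
    rw [hDp u hu, P.W_eq u this.1, P.W_eq v hvn, P.tree.sum_anc P.w this.1 this.2]
    ring
  have hexp : (3 * heapTime P.n + 100) * (heapCount P.n tO2 + heapCount P.n tI2) =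
      (3 * heapTime P.n + 100) * (heapCount P.n tO + heapCount P.n tI) + 6 * heapTime P.n + 200 := by
    rw [cO, cI, hcI1]; ring
  have hexpM : (2 * heapTime P.n + 40) * heapCount P.n tM2 =
      (2 * heapTime P.n + 40) * heapCount P.n tM1 + 2 * heapTime P.n + 40 := by
    rw [cM]; ring
  refine WP.seq (WP.mono (queryProg_spec h2 hvv (hDself v hvv) hw0 hW
    ((2 * heapTime P.n + 40) * heapCount P.n tM2 + 60 + d) (by omega)) ?_)
  rintro σ3 c3 ⟨tO3, tI3, h3, hF3, ⟨l, r, a, b, eO, eI⟩, hlight, hc3⟩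
  refine WP.block (by simp [recordProg]) ((2 * heapTime P.n + 40) * heapCount P.n tM2 +
    (3 * heapTime P.n + 100) * (heapCount P.n tO3 + heapCount P.n tI3) + d) (by simp [recordProg]; omega) ?_
  set x := σ3.nvar 12 with hx
  set u := σ3.nvar 13 with hu
  set e := P.s x + σ3.rarr 2 u + σ3.rarr 4 v with he
  set τ := recordProg.run σ3 with hτ
  have hFF : NodeFrame σ σ3 := (hF1.trans hF2).trans hF3.toNodeFrame
  have v3 : σ3.nvar 11 = v := h3.var
  have eE : τ.rarr 5 = Function.update (σ.rarr 5) v e := by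
    simp [hτ, recordProg, v3, h3.s, ← hx, ← hu, hFF.rarr 5, he]
  have ech : τ.narr 5 = Function.update (σ.narr 5) v u := by
    simp [hτ, recordProg, v3, ← hx, ← hu, hFF.narr 5]
  have eoff : τ.rarr 4 = Function.update (σ.rarr 4) v (σ.rarr 4 v - e) := by
    simp [hτ, recordProg, v3, h3.s, ← hx, ← hu, he, hFF.rarr 4]
  have e4 : σ3.rarr 4 = σ.rarr 4 := hFF.rarr 4 (by norm_num)
  have e2 : σ3.rarr 2 = σ.rarr 2 := hFF.rarr 2 (by norm_num)
  have ek : τ.rarr 2 = σ.rarr 2 := by simp [hτ, recordProg, e2]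
  have ev : τ.rarr 3 = σ3.rarr 3 := by simp [hτ, recordProg]
  have ekey := h.key v hvn hvt
  have hxO : x ∈ (tO3 v).nodes := by simp [eO, nodes]
  have hxM : x ∈ (tM2 v).nodes := by
    by_contra hM
    have := h3.comp.dead x hxO hM
    simp [eI] at this
  have huS := h3.comp.I_sub x hxM u (by simp [eI, nodes])
  have hsumE : ∀ z ∈ v :: cl v, ∑ y ∈ P.below (i + 1) z, τ.rarr 5 y =
      e + ∑ y ∈ P.below i z, σ.rarr 5 y := by
    intro z hz
    rw [hD' z hz, Finset.sum_insert (hvD z hz), eE, Function.update_self]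
    congr 1
    refine Finset.sum_congr rfl fun y hy => Function.update_of_ne ?_ _ _
    rintro rfl
    exact hvD z hz hy
  -- With the offset added back, `e` is the largest cost on the path minus the values fixed below
  -- `v`.
  have heu : e = P.s x - ∑ y ∈ P.below i u, σ.rarr 5 y := by
    have := ekey u huS.1
    rw [he, e2, e4]
    linarith
  refine ⟨tM2, tO3, tI3, ⟨?_, ?_, ?_, ?_, fun y hy => ?_, ?_, ek, ?_, ?_, ?_, ?_, ?_, h3.I_only, ?_, ?_⟩,
    le_rfl⟩
  · refine h3.toCore.of_eq (by simp [hτ, recordProg]) (fun a ha => ?_) (by simp [hτ, recordProg])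
      fun a ha => ?_
    · have : a ≠ 5 := by omega
      simp [hτ, recordProg, this]
    · have : a ≠ 5 := by omega
      have : a ≠ 4 := by omega
      simp [hτ, recordProg, *]
  · intro y h1 h2 h3 _
    rw [← hFF.nvar y h1 h2 h3]
    simp [hτ, recordProg]
  · intro a ha h5
    rw [← hFF.narr a ha]
    simp [hτ, recordProg, h5]
  · intro y hy
    rw [← hM1 y hy]
    simp [htM2, insHeap, hy]
  · rw [hF3.tO_eq y hy]
    simp [htO2, insHeap, hy]
  · intro y hy
    have hyv : y ≠ v := by rintro rfl; exact hy hvv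
    rw [hF3.tI_eq y fun hh => hy hh.1, ← hI1 y hyv fun hh => hy hh.1]
    simp [htI2, insHeap, hyv]
  · intro y hy
    have hyv : y ≠ v := by rintro rfl; exact hy hvv
    rw [ev, hF3.val_eq y hy, hval2 y hyv, hr1]
  · intro y hy
    rw [eoff, Function.update_of_ne hy]
  · intro y hy
    rw [eE, Function.update_of_ne hy]
  · have := h3.comp
    rwa [ek, ev, ← e2]
  -- `v` joins every path of the component, so all sums grow by `e`; lowering the offset by `e`
  -- accounts for it without touching a key.
  · intro z hz
    rw [hsumE z hz, ek, eoff, Function.update_self]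
    have := ekey z hz
    linarith
  · intro z hz
    rw [ChainData.treated_succ, Finset.mem_insert, hv] at hz
    by_cases hzv : z = v
    · subst hzv
      rw [ech, Function.update_self]
      have hun := (hmem u).1 huS.1
      refine ⟨hun.1, hun.2, by rw [← hDp u huS.1]; exact hlight, ?_, fun q hq hzq hw m hm => ?_⟩
      -- The value of `v` cancels the other values on the path, and what remains is the largest cost
      -- `P.s x`.
      · rw [← hDp u huS.1, hsumE u huS.1, heu]
        simpa using huS.2.2
      · have hqS : q ∈ z :: cl z := (hmem q).2 ⟨hq, hzq⟩
        rw [← hDp q hqS] at hw hm ⊢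
        rw [hsumE q hqS]
        have hcomp := h3.comp
        rw [eO] at hcomp
        have h5 := hcomp.value_le eI hqS (hDself q hqS) hw hm
        have h6 := ekey q hqS
        rw [e2] at h5
        rw [he, e2, e4]
        linarith
    · have hzt := hz.resolve_left hzv
      have := h.cert z hzt
      rw [ech, Function.update_of_ne hzv]
      -- An earlier certificate involves only values at or below its node, and `v` is not among
      -- those.
      refine this.congr fun q hq hzq y hy => ?_
      rw [eE, Function.update_of_ne]
      rintro rfl
      simp only [pathSet, Finset.mem_filter] at hy
      exact hvt (ChainData.treated_closed hi.le hvn hzt hy.2)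
  · rw [ChainData.treated_succ, hv, Finset.sum_insert hvt]
    have h5 : τ.rvar 1 = σ.rvar 1 + e := by
      simp [hτ, recordProg, v3, h3.s, ← hx, ← hu, he, hFF.rvar]
    rw [h5, h.total, eE, Function.update_self, add_comm]
    congr 1
    refine Finset.sum_congr rfl fun y hy => ?_
    rw [Function.update_of_ne]
    rintro rfl
    exact hvt hy

/-- Join the component of the node in variable `11` to that of its parent. -/
def mergeProg : Prog :=
  .setN 14 (get 0 (var 11)) ;; .ite (.eqN (var 14) (var 11)) .skip joinProg

/-- The credits reserved for rekeying. -/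
def walkCredit (P : ChainData) (i : ℕ) (cl : ℕ → List ℕ) : ℕ :=
  if i < P.n then 70 * (P.n * Nat.log 2 P.n - listPot P i cl) else 0

/-- The root is an ancestor of every node and hence comes last. No component is left afterwards, so
the invariants of the components hold vacuously. -/
theorem MainInv.of_valued_root {P : ChainData} {i v : ℕ} {σ τ : State}
    {tM tO tI tM' tO' tI' : ℕ → HTree} {cl : ℕ → List ℕ} (h : MainInv P i σ tM tO tI cl)
    (hi : i < P.n) (hv : P.ord i = v) (hroot : v = P.root)
    (hV : Valued P i v σ τ tM tO tI cl tM' tO' tI') :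
    MainInv P (i + 1) τ tM' tO' tI' cl ∧ ¬ i + 1 < P.n := by
  have hvn : v < P.n := hv ▸ P.ord_lt i hi
  have htr : P.treated (i + 1) = insert v (P.treated i) := hv ▸ ChainData.treated_succ
  have hall : ∀ r < P.n, r ∈ P.treated (i + 1) := by
    intro r hr
    rw [htr, Finset.mem_insert]
    by_cases e : r = v
    · exact .inl e
    · have : P.ord i ∈ P.A r := by rw [hv, hroot]; exact P.tree.root_mem hr
      exact .inr (ChainData.ready hi hr this (by rwa [hv]))
  refine ⟨⟨hV.toCore, ⟨fun r hr hrt => absurd (hall r hr) hrt,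
      fun r hr hrt => absurd (hall r hr) hrt⟩, fun r hr hrt => absurd (hall r hr) hrt,
      fun r hr hrt => absurd (hall r hr) hrt, fun r hr hrt => absurd (hall r hr) hrt, ?_,
      hV.I_only, hV.cert, hV.total⟩, fun hlt => ChainData.ord_notMem hlt (hall _ (P.ord_lt _ hlt))⟩
  intro r hr
  have hrv : r ≠ v := by
    rintro rfl
    rcases hr with hr | hr
    · exact hr.2 hroot
    · omega
  rw [hV.tM_eq r hrv, hV.tO_eq r hrv]
  refine h.empty r (hr.imp_left fun hh => ⟨?_, hh.2⟩)
  have := hh.1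
  rw [htr, Finset.mem_insert] at this
  exact this.resolve_left hrv

/-- Components other than those of `v` and `p` are carried over by `Component.congr`. The new
component of `p` is the union of the two old ones, each made compatible with the common offset by
`Component.shift`. -/
theorem MainInv.of_joined {P : ChainData} {i v p : ℕ} {σ τ υ : State}
    {tM tO tI tM' tO' tI' : ℕ → HTree} {cl : ℕ → List ℕ} {δv δp : ℝ}
    (h : MainInv P i σ tM tO tI cl)
    (hi : i < P.n) (hv : P.ord i = v) (hroot : v ≠ P.root) (hp : P.par v = p)
    (hV : Valued P i v σ τ tM tO tI cl tM' tO' tI')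
    (hJ : Joined P τ υ v p (cl v) (cl p) tM' tO' tI' δv δp) :
    MainInv P (i + 1) υ (moveHeap P.s tM' p v) (moveHeap (υ.rarr 3) tO' p v) tI'
      (Function.update cl p (cl p ++ v :: cl v)) := by
  have hvn : v < P.n := hv ▸ P.ord_lt i hi
  have hvt : v ∉ P.treated i := hv ▸ ChainData.ord_notMem hi
  have htr : P.treated (i + 1) = insert v (P.treated i) := hv ▸ ChainData.treated_succ
  have hpn : p < P.n := hp ▸ P.tree.par_lt v hvn
  have hpt' : p ∉ P.treated (i + 1) := by
    subst hp hv
    exact ChainData.par_ord_notMem hi hroot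
  have hpv : p ≠ v := by rw [← hp]; exact P.tree.par_ne hvn hroot
  have hpt : p ∉ P.treated i := fun hh => hpt' (by rw [htr]; exact Finset.mem_insert_of_mem hh)
  have hlist : CompLists P (i + 1) (Function.update cl p (cl p ++ v :: cl v)) := by
    subst hp hv
    exact h.lists.step hi hroot
  have hnt : ∀ r, r ∉ P.treated (i + 1) → r ∉ P.treated i ∧ r ≠ v := fun r hr => by
    rw [htr, Finset.mem_insert, not_or] at hr
    exact ⟨hr.2, hr.1⟩
  -- the components that are not touched
  have hout : ∀ r < P.n, r ∉ P.treated i → r ≠ v → ∀ u ∈ r :: cl r, u ∉ v :: cl v :=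
    fun r hr hrt hne u hu hu' => hne (h.lists.disjoint hr hvn hrt hvt hu hu')
  have hbelow : ∀ r < P.n, r ∉ P.treated i → r ≠ v → ∀ u ∈ r :: cl r,
      P.below (i + 1) u = P.below i u := by
    intro r hr hrt hne u hu
    subst hv
    exact ChainData.below_succ_of_notMem (h.lists.notMem_anc hi hr hrt hne hu)
  have hcomp : ∀ r < P.n, r ∉ P.treated i → r ≠ v → Component (P.below (i + 1)) P.w P.s P.w₀
      (r :: cl r) (tM' r) (tO' r) tI' .nil 0 (τ.rarr 2) (τ.rarr 3) := by
    intro r hr hrt hne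
    rw [hV.tM_eq r hne, hV.tO_eq r hne]
    exact (h.comp r hr hrt).congr (hbelow r hr hrt hne)
      (fun x hx _ => hV.tI_eq x (hout r hr hrt hne x hx))
      (fun u _ => by rw [hV.key_eq]) fun u hu => hV.val_eq u (hout r hr hrt hne u hu)
  have hE : υ.rarr 5 = τ.rarr 5 := hJ.rarr 5 (by norm_num) (by norm_num) (by norm_num)
  have hkey : ∀ r < P.n, r ∉ P.treated i → r ≠ v → ∀ u ∈ r :: cl r,
      τ.rarr 2 u + τ.rarr 4 r = -∑ y ∈ P.below (i + 1) u, υ.rarr 5 y := by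
    intro r hr hrt hne u hu
    rw [hE, hbelow r hr hrt hne u hu, hV.key_eq, hV.off_eq r hne, h.key r hr hrt u hu]
    congr 1
    refine Finset.sum_congr rfl fun y hy => (hV.E_eq y ?_).symm
    rintro rfl
    exact hvt (Finset.mem_inter.1 hy).2
  have hmp : (moveHeap P.s tM' p v) p = meld P.s (tM' p) (tM' v) := by
    simp [moveHeap, Function.update_apply, hpv]
  have hop : (moveHeap (υ.rarr 3) tO' p v) p = meld (υ.rarr 3) (tO' p) (tO' v) := by
    simp [moveHeap, Function.update_apply, hpv]
  have hne2 : ∀ (key : ℕ → ℝ) (t : ℕ → HTree) r, r ≠ v → r ≠ p → moveHeap key t p v r = t r := by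
    intro key t r h1 h2
    simp [moveHeap, Function.update_apply, h1, h2]
  have hlast : τ.narr 7 p = σ.narr 7 p := by rw [hV.narr 7 (by norm_num) (by norm_num)]
  have h7p : σ.narr 7 p ∈ p :: cl p := (h.linked p hpn hpt).last_mem
  refine ⟨hJ.core, hlist, fun r hr hrt => ?_, fun r hr hrt => ?_, fun r hr hrt u hu => ?_,
    fun r hr => ?_, fun x hx => ?_, fun z hz => ?_, ?_⟩
  · obtain ⟨hrt, hrv⟩ := hnt r hrt
    by_cases hrp : r = p
    · subst hrp
      rw [Function.update_self]
      exact hJ.linked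
    · rw [Function.update_of_ne hrp, hJ.last r hrp, hV.narr 7 (by norm_num) (by norm_num)]
      refine (h.linked r hr hrt).congr (fun x hx _ => ?_) (h.lists.nodup r hr hrt)
      rw [hJ.nxt x, hV.narr 6 (by norm_num) (by norm_num)]
      rw [hlast]
      rintro rfl
      exact hrp (h.lists.disjoint hr hpn hrt hpt hx h7p)
  · obtain ⟨hrt, hrv⟩ := hnt r hrt
    by_cases hrp : r = p
    · subst hrp
      rw [Function.update_self, hmp, hop]
      refine ((hcomp r hr hrt hrv).shift δp hJ.key_p hJ.val_p).union
        (hV.comp.shift δv hJ.key_v hJ.val_v) fun x => ?_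
      rw [← List.cons_append, List.mem_append]
    · rw [Function.update_of_ne hrp, hne2 _ _ r hrv hrp, hne2 _ _ r hrv hrp]
      have hd : ∀ u ∈ r :: cl r, u ∉ p :: cl p := fun u hu hu' =>
        hrp (h.lists.disjoint hr hpn hrt hpt hu hu')
      exact (hcomp r hr hrt hrv).congr (fun _ _ => rfl) (fun _ _ _ => rfl)
        (fun u hu => hJ.key_out u (hout r hr hrt hrv u hu) (hd u hu))
        fun u hu => hJ.val_out u (hout r hr hrt hrv u hu) (hd u hu)
  · obtain ⟨hrt, hrv⟩ := hnt r hrt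
    by_cases hrp : r = p
    · subst hrp
      rw [Function.update_self, ← List.cons_append, List.mem_append] at hu
      rcases hu with hu | hu
      · rw [← hkey r hr hrt hrv u hu, hJ.key_p u hu, ← hJ.off_p]
        ring
      · rw [hE, ← hV.key u hu, hJ.key_v u hu, ← hJ.off_v]
        ring
    · rw [Function.update_of_ne hrp] at hu
      rw [← hkey r hr hrt hrv u hu, hJ.off r hrp, hJ.key_out u (hout r hr hrt hrv u hu) fun hu' =>
        hrp (h.lists.disjoint hr hpn hrt hpt hu hu')]
  · by_cases hrv : r = v
    · subst hrv
      simp [moveHeap]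
    have hrp : r ≠ p := by
      rintro rfl
      rcases hr with hr | hr
      · exact hpt' hr.1
      · omega
    rw [hne2 _ _ r hrv hrp, hne2 _ _ r hrv hrp, hV.tM_eq r hrv, hV.tO_eq r hrv]
    refine h.empty r (hr.imp_left fun hh => ⟨?_, hh.2⟩)
    have := hh.1
    rw [htr, Finset.mem_insert] at this
    exact this.resolve_left hrv
  · obtain ⟨r, hr⟩ := hV.I_only x hx
    by_cases hrv : r = v
    · subst hrv
      exact ⟨p, by rw [hmp, mem_meld]; exact .inr hr⟩
    by_cases hrp : r = p
    · subst hrp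
      exact ⟨r, by rw [hmp, mem_meld]; exact .inl hr⟩
    · exact ⟨r, by rwa [hne2 _ _ r hrv hrp]⟩
  · rw [hE, hJ.narr 5 (by norm_num) (by norm_num) (by norm_num)]
    exact hV.cert z hz
  · rw [hE, hJ.rvar 1 (by norm_num), hV.total]

theorem mergeProg_spec {P : ChainData} {i v : ℕ} {σ τ : State} {tM tO tI tM' tO' tI' : ℕ → HTree}
    {cl : ℕ → List ℕ} {c : ℕ} (h : MainInv P i σ tM tO tI cl) (hi : i < P.n) (hv : P.ord i = v)
    (hvar : σ.nvar 11 = v) (hV : Valued P i v σ τ tM tO tI cl tM' tO' tI') (d : ℕ)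
    (hc : walkCredit P i cl + 2 * heapTime P.n + 200 + d ≤ c) :
    WP mergeProg (fun υ c' => ∃ tM'' tO'' cl', MainInv P (i + 1) υ tM'' tO'' tI' cl' ∧
      υ.nvar 10 = σ.nvar 10 ∧ heapCredit P.n tM'' tO'' tI' = heapCredit P.n tM' tO' tI' ∧
      υ.narr 1 = σ.narr 1 ∧ walkCredit P (i + 1) cl' + d ≤ c') τ c := by
  have hvn : v < P.n := hv ▸ P.ord_lt i hi
  have hvt : v ∉ P.treated i := hv ▸ ChainData.ord_notMem hi
  have e11 : τ.nvar 11 = v := by rw [hV.nvar _ (by omega) (by norm_num) (by norm_num) (by norm_num), hvar]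
  refine WP.seq (WP.block (by simp) (walkCredit P i cl + 2 * heapTime P.n + 190 + d)
    (by simp; omega) ?_)
  set τ1 := Prog.run (.setN 14 (get 0 (var 11))) τ with hτ1
  have e14 : τ1.nvar 14 = P.par v := by simp [hτ1, e11, hV.par]
  have e11' : τ1.nvar 11 = v := by simp [hτ1, e11]
  have hV1 : Valued P i v σ τ1 tM tO tI cl tM' tO' tI' := by
    refine ⟨hV.toCore.of_eq (by simp [hτ1]) (fun _ _ => rfl) rfl fun _ _ => rfl,
      fun x h1 h2 h3 h4 => ?_, hV.narr, hV.tM_eq, hV.tO_eq, hV.tI_eq, hV.key_eq, hV.val_eq,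
      hV.off_eq, hV.E_eq, hV.comp, hV.key, hV.I_only, hV.cert, hV.total⟩
    simp [hτ1, h4, hV.nvar x h1 h2 h3 h4]
  have e10 : τ1.nvar 10 = σ.nvar 10 :=
    hV1.nvar 10 (by norm_num) (by norm_num) (by norm_num) (by norm_num)
  have en1 : τ1.narr 1 = σ.narr 1 := hV1.narr 1 (by norm_num) (by norm_num)
  by_cases hroot : v = P.root
  · refine WP.ite_true (d := 10 + d) ?_ (by simp; omega) ?_
    · simp [e14, e11', hroot, P.tree.par_root]
    obtain ⟨h1, h2⟩ := h.of_valued_root hi hv hroot hV1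
    -- With all nodes treated `listPot` falls back to zero; the case distinction in `walkCredit`
    -- prevents the credit from jumping up again here.
    exact WP.block (by simp) d (by simp) ⟨tM', tO', cl, h1, e10, rfl, en1, by
      simp [walkCredit, h2]⟩
  · have hpv : P.par v ≠ v := P.tree.par_ne hvn hroot
    have hpn : P.par v < P.n := P.tree.par_lt v hvn
    refine WP.ite_false (d := walkCredit P i cl + 2 * heapTime P.n + 170 + d) ?_
      (by simp; omega) ?_
    · simp [e14, e11', hpv]
    have hpt' : P.par v ∉ P.treated (i + 1) := by
      subst hv
      exact ChainData.par_ord_notMem hi hroot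
    have hpt : P.par v ∉ P.treated i := fun hh => hpt' (by
      rw [ChainData.treated_succ]; exact Finset.mem_insert_of_mem hh)
    have hlink : ∀ r < P.n, r ∉ P.treated i → Linked (τ1.narr 6) (τ1.narr 7 r) r (cl r) := by
      intro r hr hrt
      rw [hV1.narr 6 (by norm_num) (by norm_num), hV1.narr 7 (by norm_num) (by norm_num)]
      exact h.linked r hr hrt
    have hnd : (P.par v :: cl (P.par v) ++ v :: cl v).Nodup := by
      refine List.Nodup.append (h.lists.nodup _ hpn hpt) (h.lists.nodup v hvn hvt) fun u hu hu' => ?_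
      exact hpv (h.lists.disjoint hpn hvn hpt hvt hu hu')
    set cl' := Function.update cl (P.par v) (cl (P.par v) ++ v :: cl v) with hcl'
    have hpot : listPot P i cl + min (v :: cl v).length (P.par v :: cl (P.par v)).length ≤
        listPot P (i + 1) cl' := by
      subst hv
      exact CompLists.listPot_step hi hroot
    have hle : listPot P (i + 1) cl' ≤ P.n * Nat.log 2 P.n := by
      subst hv
      exact (h.lists.step hi hroot).listPot_le
    -- The growth of the potential pays 70 per element of the shorter list; `hle` keeps the
    -- truncated subtraction exact.
    have hw : walkCredit P (i + 1) cl' +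
        70 * min (v :: cl v).length (P.par v :: cl (P.par v)).length ≤ walkCredit P i cl := by
      simp only [walkCredit, hi, if_true]
      split_ifs <;> omega
    refine WP.mono (joinProg_spec hV1.toCore e11' e14 hvn hpn (hlink v hvn hvt) (hlink _ hpn hpt) hnd
      (walkCredit P (i + 1) cl' + d) (by omega)) ?_
    rintro υ c1 ⟨hc1, δv, δp, hJ⟩
    refine ⟨_, _, cl', h.of_joined hi hv hroot rfl hV1 hJ, ?_, ?_, ?_, hc1⟩
    · rw [hJ.nvar 10 (by norm_num) (by norm_num) (by norm_num), e10]
    · rw [heapCredit, heapCount_moveHeap hpn hvn hpv, heapCount_moveHeap hpn hvn hpv, heapCredit]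
    · rw [hJ.narr 1 (by norm_num) (by norm_num) (by norm_num), en1]

/-- Treat the next node of the order. -/
def nodeProg : Prog :=
  .setN 11 (get 3 (var 10)) ;; valueProg ;; mergeProg ;; .setN 10 (succ (var 10))

/-- Treat all nodes. -/
def mainProg : Prog := .setN 10 (.const 0) ;; .loop (.not (.eqN (var 10) (var 0))) nodeProg

theorem MainInv.setN {P : ChainData} {i : ℕ} {σ : State} {tM tO tI : ℕ → HTree} {cl : ℕ → List ℕ}
    (h : MainInv P i σ tM tO tI cl) {x : ℕ} (hx : 10 ≤ x) (a : ℕ) :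
    MainInv P i (σ.setN x a) tM tO tI cl :=
  have hx' : 0 ≠ x := by omega
  ⟨h.toCore.of_eq (by simp [hx']) (fun _ _ => rfl) rfl fun _ _ => rfl, h.lists, h.linked, h.comp,
    h.key, h.empty, h.I_only, h.cert, h.total⟩

theorem nodeProg_spec {P : ChainData} {i : ℕ} {σ : State} {tM tO tI : ℕ → HTree}
    {cl : ℕ → List ℕ} {c : ℕ} (h : MainInv P i σ tM tO tI cl) (hi : i < P.n)
    (hvar : σ.nvar 10 = i) (d : ℕ)
    (hc : heapCredit P.n tM tO tI + walkCredit P i cl + 13 * heapTime P.n + 620 + d ≤ c) :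
    WP nodeProg (fun τ c' => ∃ tM' tO' tI' cl', MainInv P (i + 1) τ tM' tO' tI' cl' ∧
      τ.nvar 10 = i + 1 ∧ τ.narr 1 = σ.narr 1 ∧
      heapCredit P.n tM' tO' tI' + walkCredit P (i + 1) cl' + d ≤ c') σ c := by
  refine WP.seq (WP.block (by simp) (heapCredit P.n tM tO tI + walkCredit P i cl +
    13 * heapTime P.n + 615 + d) (by simp; omega) ?_)
  simp only [Prog.run, NExpr.eval]
  have h1 := h.setN (x := 11) (by norm_num) (σ.narr 3 (σ.nvar 10))
  set σ1 := σ.setN 11 (σ.narr 3 (σ.nvar 10)) with hσ1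
  have e11 : σ1.nvar 11 = P.ord i := by simp [hσ1, hvar, h.ord]
  have e10 : σ1.nvar 10 = i := by simp [hσ1, hvar]
  refine WP.seq (WP.mono (valueProg_spec h1 hi rfl e11 (walkCredit P i cl + 2 * heapTime P.n + 210 + d)
    (by omega)) ?_)
  rintro σ2 c2 ⟨tM2, tO2, tI2, hV, hc2⟩
  refine WP.seq (WP.mono (mergeProg_spec h1 hi rfl e11 hV (heapCredit P.n tM2 tO2 tI2 + 10 + d)
    (by omega)) ?_)
  rintro σ3 c3 ⟨tM3, tO3, cl3, h3, e3, hh3, en, hc3⟩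
  refine WP.block (by simp) (heapCredit P.n tM2 tO2 tI2 + walkCredit P (i + 1) cl3 + d)
    (by simp; omega) ⟨tM3, tO3, tI2, cl3, ?_, ?_, ?_, by rw [hh3]⟩
  · exact h3.setN (by norm_num) _
  · simp [e3, e10]
  · simp [en, hσ1]

/-- The running time of the main loop. -/
def mainTime (n : ℕ) : ℕ := n * (13 * heapTime n + 630) + 70 * (n * Nat.log 2 n) + 10

/-- Per node, eleven `heapTime` go to `valueProg` and two to the moves in `joinProg`, which makes
13. The heaps start without credit, and all rekeying is paid from the initial `70 * (n * Nat.log 2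
n)`. -/
theorem mainProg_spec {P : ChainData} {σ : State} {c : ℕ} 
    (h : MainInv P 0 σ (fun _ => nil) (fun _ => nil) (fun _ => nil) (fun _ => []))
    (hn : σ.nvar 0 = P.n) (d : ℕ) (hc : mainTime P.n + d ≤ c) :
    WP mainProg (fun τ c' => d ≤ c' ∧ τ.nvar 0 = P.n ∧ τ.narr 1 = σ.narr 1 ∧
      ∃ tM tO tI cl, MainInv P P.n τ tM tO tI cl) σ c := by
  have h0 : heapCount P.n (fun _ => nil) = 0 := by simp [heapCount, nodes]
  unfold mainTime at hc
  refine WP.seq (WP.block (by simp) (P.n * (13 * heapTime P.n + 630) + 70 * (P.n * Nat.log 2 P.n) +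
    8 + d) (by simp only [Prog.steps, cost]; omega) ?_)
  refine WP.loop (fun τ c' => ∃ i tM tO tI cl, i ≤ P.n ∧ MainInv P i τ tM tO tI cl ∧
    τ.nvar 10 = i ∧ τ.narr 1 = σ.narr 1 ∧ heapCredit P.n tM tO tI + walkCredit P i cl +
      (P.n - i) * (13 * heapTime P.n + 630) + 8 + d ≤ c') ?_
    ⟨0, _, _, _, _, by omega, h.setN (x := 10) (by norm_num) 0, by simp, rfl, ?_⟩
  · rintro τ c ⟨i, tM, tO, tI, cl, hi, hI, e10, en, hc⟩
    have e0 : τ.nvar 0 = P.n := hI.hM.size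
    by_cases hlt : i < P.n
    · left
      obtain ⟨k, hk⟩ : ∃ k, P.n - i = k + 1 := ⟨P.n - i - 1, by omega⟩
      have hk' : P.n - (i + 1) = k := by omega
      rw [hk, add_mul, one_mul] at hc
      set K := k * (13 * heapTime P.n + 630) with hK
      refine ⟨by simp [e10, e0, hlt.ne], heapCredit P.n tM tO tI + walkCredit P i cl +
        13 * heapTime P.n + 620 + (K + 8 + d), by simp only [Test.cost, cost]; omega, ?_⟩
      refine WP.mono (nodeProg_spec hI hlt e10 (K + 8 + d) le_rfl) ?_
      rintro υ c' ⟨tM', tO', tI', cl', h1, h2, h3, h4⟩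
      exact ⟨i + 1, tM', tO', tI', cl', hlt, h1, h2, h3.trans en, by rw [hk']; omega⟩
    · right
      have : i = P.n := by omega
      subst this
      exact ⟨by simp [e10, e0], d, by simp; omega, le_rfl, e0, en, tM, tO, tI, cl, hI⟩
  · have : walkCredit P 0 (fun _ => []) ≤ 70 * (P.n * Nat.log 2 P.n) := by
      unfold walkCredit; split_ifs <;> omega
    simp only [heapCredit, h0, Nat.sub_zero]
    omega

/-- The empty components at the start. -/
theorem MainInv.of_empty {P : ChainData} {σ : State}
    (h : Core P σ (fun _ => nil) (fun _ => nil) (fun _ => nil)) (h2 : ∀ v < P.n, σ.rarr 2 v = 0)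
    (h4 : ∀ v < P.n, σ.rarr 4 v = 0) (h7 : ∀ v < P.n, σ.narr 7 v = v) (h1 : σ.rvar 1 = 0) :
    MainInv P 0 σ (fun _ => nil) (fun _ => nil) (fun _ => nil) (fun _ => []) := by
  have ht : P.treated 0 = ∅ := by simp [ChainData.treated]
  have hb : ∀ u, P.below 0 u = ∅ := by simp [ChainData.below, ht]
  refine ⟨h, ⟨fun r hr _ u => ?_, by simp⟩, fun r hr _ => (h7 r hr).symm, fun r hr _ => ?_,
    fun r hr _ u hu => ?_, fun _ _ => ⟨rfl, rfl⟩, by simp, by simp [ht], by simp [ht, h1]⟩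
  · simp only [List.mem_singleton, ht, Finset.union_empty]
    constructor
    · rintro rfl
      exact ⟨hr, P.tree.self_mem hr, subset_rfl⟩
    · rintro ⟨h1, h2, h3⟩
      exact P.tree.anc_antisymm hr (h3 (P.tree.self_mem h1)) h2
  · constructor <;> simp [nodes, hb, HTree.Ord]
  · rw [hb]
    simp only [List.mem_singleton] at hu
    simp [hu, h2 r hr, h4 r hr]

end RAM

/-! ## Preparation: an order with children before parents, and path weights -/

/-- The number of children of `p` in the set `X`. -/
def childCount (par : ℕ → ℕ) (X : Finset ℕ) (p : ℕ) : ℕ :=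
  (X.filter fun u => par u = p ∧ u ≠ p).card

theorem childCount_insert (par : ℕ → ℕ) {X : Finset ℕ} {x : ℕ} (hx : x ∉ X) (p : ℕ) :
    childCount par (insert x X) p =
      childCount par X p + if par x = p ∧ x ≠ p then 1 else 0 := by
  unfold childCount
  rw [Finset.filter_insert]
  split_ifs with h
  · rw [Finset.card_insert_of_notMem (by simp [hx])]
  · rfl

theorem childCount_eq_zero {par : ℕ → ℕ} {X : Finset ℕ} {p : ℕ} :
    childCount par X p = 0 ↔ ∀ u ∈ X, par u = p → u = p := by
  simp only [childCount, Finset.card_eq_zero, Finset.filter_eq_empty_iff]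
  constructor
  · intro h u hu e
    by_contra hne
    exact h hu ⟨e, hne⟩
  · intro h u hu hh
    exact hh.2 (h u hu hh.1)

/-! ### Set-up, topological sorting and path weights -/

namespace RAM

open HTree NExpr

/-- Set up the lists, the heaps and the numbers of children. -/
def initProg : Prog :=
  .setN 10 (.const 0) ;; .loop (.not (.eqN (var 10) (var 0)))
    (.putN 7 (var 10) (var 10) ;; .putN 13 (var 10) (var 0) ;; .putN 17 (var 10) (var 0) ;;
      .putN 21 (var 10) (var 0) ;; .setN 14 (get 0 (var 10)) ;;
      .ite (.eqN (var 14) (var 10)) .skip (.putN 2 (var 14) (succ (get 2 (var 14)))) ;;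
      .setN 10 (succ (var 10)))

/-- The memory after the first `i` nodes have been set up. -/
structure SetUp (n i : ℕ) (σ τ : State) : Prop where
  size : τ.nvar 0 = n
  rvar : τ.rvar = σ.rvar
  rarr : τ.rarr = σ.rarr
  narr : ∀ a, a ≠ 2 → a ≠ 7 → a ≠ 13 → a ≠ 17 → a ≠ 21 → τ.narr a = σ.narr a
  deg : ∀ p, τ.narr 2 p = childCount (σ.narr 0) (Finset.range i) p
  last : ∀ v < i, τ.narr 7 v = v
  heapM : ∀ v < i, τ.narr 13 v = n
  heapO : ∀ v < i, τ.narr 17 v = n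
  heapI : ∀ v < i, τ.narr 21 v = n

theorem initProg_spec {n c : ℕ} {σ : State} (hn : σ.nvar 0 = n) (h2 : ∀ p, σ.narr 2 p = 0) (d : ℕ)
    (hc : 50 * n + 10 + d ≤ c) : WP initProg (fun τ c' => d ≤ c' ∧ SetUp n n σ τ) σ c := by
  refine WP.seq (WP.block (by simp) (50 * n + 8 + d) (by simp; omega) ?_)
  refine WP.loop (fun τ c' => ∃ i ≤ n, τ.nvar 10 = i ∧ SetUp n i σ τ ∧ 50 * (n - i) + 8 + d ≤ c') ?_
    ⟨0, by omega, by simp, ⟨by simp [hn], rfl, rfl, fun _ _ _ _ _ _ => rfl, ?_, ?_, ?_, ?_, ?_⟩,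
      by simp⟩
  · rintro τ c ⟨i, hi, e10, h, hc⟩
    by_cases hlt : i < n
    · left
      refine ⟨by simp [e10, h.size, hlt.ne], 50 * (n - i) + d, by simp; omega, ?_⟩
      refine WP.block (by simp) (50 * (n - (i + 1)) + 8 + d) (by simp; omega) ?_
      have e0 : τ.narr 0 = σ.narr 0 := h.narr 0 (by norm_num) (by norm_num) (by norm_num)
        (by norm_num) (by norm_num)
      have hcount : ∀ p, childCount (σ.narr 0) (Finset.range (i + 1)) p =
          τ.narr 2 p + if σ.narr 0 i = p ∧ i ≠ p then 1 else 0 := by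
        intro p
        rw [Finset.range_add_one, childCount_insert _ (by simp), h.deg]
      have hup : ∀ (f : ℕ → ℕ) (g : ℕ → ℕ), (∀ v < i, f v = g v) →
          ∀ v < i + 1, Function.update f i (g i) v = g v := by
        intro f g hf v hv
        by_cases e : v = i
        · subst e; simp
        · rw [Function.update_of_ne e, hf v (by omega)]
      by_cases hp : σ.narr 0 i = i
      · refine ⟨i + 1, hlt, by simp [e10, e0, hp], ⟨?_, ?_, ?_, ?_, ?_, ?_, ?_, ?_, ?_⟩, le_rfl⟩
        · simp [e10, e0, hp, h.size]
        · simp [e10, e0, hp, h.rvar]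
        · simp [e10, e0, hp, h.rarr]
        · intro a h1 h2 h3 h4 h5
          simp [e10, e0, hp, h1, h2, h3, h4, h5, h.narr a h1 h2 h3 h4 h5]
        · intro p
          rw [hcount]
          have : ¬ (i = p ∧ i ≠ p) := fun hh => hh.2 hh.1
          simp [e10, e0, hp, this]
        · simpa [e10, e0, hp, h.size] using hup _ (fun v => v) h.last
        · simpa [e10, e0, hp, h.size] using hup _ (fun _ => n) h.heapM
        · simpa [e10, e0, hp, h.size] using hup _ (fun _ => n) h.heapO
        · simpa [e10, e0, hp, h.size] using hup _ (fun _ => n) h.heapI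
      · refine ⟨i + 1, hlt, by simp [e10, e0, hp], ⟨?_, ?_, ?_, ?_, ?_, ?_, ?_, ?_, ?_⟩, le_rfl⟩
        · simp [e10, e0, hp, h.size]
        · simp [e10, e0, hp, h.rvar]
        · simp [e10, e0, hp, h.rarr]
        · intro a h1 h2 h3 h4 h5
          simp [e10, e0, hp, h1, h2, h3, h4, h5, h.narr a h1 h2 h3 h4 h5]
        · intro p
          rw [hcount]
          by_cases hpp : σ.narr 0 i = p
          · subst hpp
            simp [e10, e0, hp, Ne.symm hp]
          · simp [e10, e0, hp, hpp, Function.update_apply, Ne.symm hpp]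
        · simpa [e10, e0, hp, h.size] using hup _ (fun v => v) h.last
        · simpa [e10, e0, hp, h.size] using hup _ (fun _ => n) h.heapM
        · simpa [e10, e0, hp, h.size] using hup _ (fun _ => n) h.heapO
        · simpa [e10, e0, hp, h.size] using hup _ (fun _ => n) h.heapI
    · right
      have : i = n := by omega
      subst this
      exact ⟨by simp [e10, h.size], d, by simp; omega, le_rfl, h⟩
  · intro p
    simp [h2, childCount]
  all_goals simp

/-- Collect the leaves. -/
def collectProg : Prog :=
  .setN 10 (.const 0) ;; .setN 13 (.const 0) ;; .loop (.not (.eqN (var 10) (var 0)))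
    (.ite (.eqN (get 2 (var 10)) (.const 0))
      (.putN 3 (var 13) (var 10) ;; .setN 13 (succ (var 13))) .skip ;;
      .setN 10 (succ (var 10)))

/-- Treat the queued nodes, and queue a node when all its children have been treated. -/
def sortProg : Prog :=
  .setN 10 (.const 0) ;; .loop (.not (.eqN (var 10) (var 13)))
    (.setN 11 (get 3 (var 10)) ;; .setN 14 (get 0 (var 11)) ;;
      .ite (.eqN (var 14) (var 11)) .skip
        (.putN 2 (var 14) (.pred (get 2 (var 14))) ;;
          .ite (.eqN (get 2 (var 14)) (.const 0))
            (.putN 3 (var 13) (var 14) ;; .setN 13 (succ (var 13))) .skip) ;;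
      .setN 10 (succ (var 10)))

/-- The first `i` entries of the queue `ord`, as a set. -/
def firsts (ord : ℕ → ℕ) (i : ℕ) : Finset ℕ := (Finset.range i).image ord

theorem mem_firsts {ord : ℕ → ℕ} {i x : ℕ} : x ∈ firsts ord i ↔ ∃ a < i, ord a = x := by
  simp [firsts]

/-- A queue of length `q` of which `i` entries have been treated; `deg` counts the children that
have not been treated, and of the nodes in `X` exactly those without such children are queued. -/
structure Queue (n : ℕ) (par : ℕ → ℕ) (X : ℕ → Prop) (ord deg : ℕ → ℕ) (i q : ℕ) : Prop where
  le : i ≤ q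
  lt : ∀ a < q, ord a < n
  inj : ∀ a < q, ∀ b < q, ord a = ord b → a = b
  count : ∀ p, deg p = childCount par (Finset.range n \ firsts ord i) p
  queued : ∀ v < n, X v → deg v = 0 → ∃ a < q, ord a = v
  only : ∀ a < q, X (ord a) ∧ deg (ord a) = 0
  early : ∀ b < q, ∀ u < n, par u = ord b → u ≠ ord b → ∃ a < b, ord a = u

namespace Queue

variable {n : ℕ} {par : ℕ → ℕ} {X : ℕ → Prop} {ord deg : ℕ → ℕ} {i q : ℕ}

theorem length_le (h : Queue n par X ord deg i q) : q ≤ n := by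
  have h1 : (firsts ord q).card = q := by
    rw [firsts, Finset.card_image_of_injOn, Finset.card_range]
    intro a ha b hb e
    exact h.inj a (by simpa using ha) b (by simpa using hb) e
  have h2 : firsts ord q ⊆ Finset.range n := by
    intro x hx
    obtain ⟨a, ha, rfl⟩ := mem_firsts.1 hx
    exact Finset.mem_range.2 (h.lt a ha)
  simpa [h1] using Finset.card_le_card h2

theorem firsts_update (hiq : i ≤ q) (v : ℕ) :
    firsts (Function.update ord q v) i = firsts ord i := by
  unfold firsts
  refine Finset.image_congr fun a ha => Function.update_of_ne ?_ _ _
  have : a < i := by simpa using ha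
  omega

theorem split (h : Queue n par X ord deg i q) (hi : i < q) :
    Finset.range n \ firsts ord i = insert (ord i) (Finset.range n \ firsts ord (i + 1)) := by
  ext x
  have hlt := h.lt i hi
  simp only [Finset.mem_sdiff, Finset.mem_insert, Finset.mem_range, mem_firsts, not_exists, not_and]
  constructor
  · rintro ⟨h1, h2⟩
    by_cases e : x = ord i
    · exact .inl e
    · refine .inr ⟨h1, fun a ha => ?_⟩
      by_cases e' : a = i
      · exact fun hh => e (by rw [← hh, e'])
      · exact h2 a (by omega)
  · rintro (rfl | ⟨h1, h2⟩)
    · refine ⟨hlt, fun a ha e => ?_⟩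
      have := h.inj a (by omega) i hi e
      omega
    · exact ⟨h1, fun a ha => h2 a (by omega)⟩

theorem notMem_split : ord i ∉ Finset.range n \ firsts ord (i + 1) := by
  simp only [Finset.mem_sdiff, Finset.mem_range, mem_firsts, not_and, not_not]
  exact fun _ => ⟨i, by omega, rfl⟩

/-- Append a node all of whose children have been treated. -/
theorem push (h : Queue n par X ord deg i q) {v : ℕ} {X' : ℕ → Prop} (hv : v < n)
    (hX : ∀ u, X' u ↔ X u ∨ u = v) (hdeg : deg v = 0) (hnew : ∀ a < q, ord a ≠ v) :
    Queue n par X' (Function.update ord q v) deg i (q + 1) := by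
  have e : ∀ a < q, Function.update ord q v a = ord a := fun a ha =>
    Function.update_of_ne (by omega) _ _
  have hcase : ∀ a < q + 1, a < q ∨ a = q := fun a ha => by omega
  refine ⟨by have := h.le; omega, fun a ha => ?_, fun a ha b hb hab => ?_, fun p => ?_,
    fun u hu hXu hd => ?_, fun a ha => ?_, fun b hb u hu hpu hne => ?_⟩
  · rcases hcase a ha with h1 | rfl
    · rw [e a h1]; exact h.lt a h1
    · simpa using hv
  · rcases hcase a ha with h1 | rfl <;> rcases hcase b hb with h2 | rfl
    · rw [e a h1, e b h2] at hab
      exact h.inj a h1 b h2 hab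
    · rw [e a h1, Function.update_self] at hab
      exact absurd hab (hnew a h1)
    · rw [e b h2, Function.update_self] at hab
      exact absurd hab.symm (hnew b h2)
    · rfl
  · rw [firsts_update h.le, h.count]
  · rcases (hX u).1 hXu with h1 | rfl
    · obtain ⟨a, ha, rfl⟩ := h.queued u hu h1 hd
      exact ⟨a, by omega, e a ha⟩
    · exact ⟨q, by omega, by simp⟩
  · rcases hcase a ha with h1 | rfl
    · rw [e a h1, hX]
      exact ⟨.inl (h.only a h1).1, (h.only a h1).2⟩
    · rw [Function.update_self, hX]
      exact ⟨.inr rfl, hdeg⟩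
  · rcases hcase b hb with h1 | rfl
    · rw [e b h1] at hpu hne
      obtain ⟨a, ha, rfl⟩ := h.early b h1 u hu hpu hne
      exact ⟨a, ha, e a (by omega)⟩
    · rw [Function.update_self] at hpu hne
      -- Degree zero means that no child lies outside the treated prefix, so every child stands
      -- before the new entry.
      rw [h.count, childCount_eq_zero] at hdeg
      by_contra hno
      refine hne (hdeg u ?_ hpu)
      rw [Finset.mem_sdiff, Finset.mem_range, mem_firsts]
      refine ⟨hu, ?_⟩
      rintro ⟨a, ha, rfl⟩
      have := h.le
      exact hno ⟨a, by omega, e a (by omega)⟩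

/-- Treat a root. -/
theorem skip (h : Queue n par X ord deg i q) (hi : i < q) (hp : par (ord i) = ord i) :
    Queue n par X ord deg (i + 1) q := by
  refine ⟨hi, h.lt, h.inj, fun p => ?_, h.queued, h.only, h.early⟩
  rw [h.count, h.split hi, childCount_insert _ notMem_split, hp, if_neg, Nat.add_zero]
  exact fun hh => hh.2 hh.1

/-- Treat a node with a parent. -/
theorem decrease (h : Queue n par (fun _ => True) ord deg i q) (hi : i < q)
    (hp : par (ord i) ≠ ord i) :
    Queue n par (· ≠ par (ord i)) ord
      (Function.update deg (par (ord i)) (deg (par (ord i)) - 1)) (i + 1) q := by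
  set p := par (ord i) with hpdef
  have hcount : ∀ x, deg x = childCount par (Finset.range n \ firsts ord (i + 1)) x +
      if p = x ∧ ord i ≠ x then 1 else 0 := fun x => by
    rw [h.count, h.split hi, childCount_insert _ notMem_split]
  have hpos : deg p ≠ 0 := by
    rw [hcount, if_pos ⟨rfl, hp.symm⟩]
    omega
  -- Queued nodes have degree zero, while `p` still had the child `ord i`; so `p` is not in the
  -- queue and can later be appended without repetition.
  have hpq : ∀ a < q, ord a ≠ p := fun a ha e => hpos (e ▸ (h.only a ha).2)
  refine ⟨hi, h.lt, h.inj, fun x => ?_, fun u hu hup hd => ?_, fun a ha => ⟨hpq a ha, ?_⟩, h.early⟩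
  · by_cases hx : x = p
    · subst hx
      rw [Function.update_self, hcount, if_pos ⟨rfl, hp.symm⟩]
      omega
    · rw [Function.update_of_ne hx, hcount, if_neg fun hh => hx hh.1.symm]
      omega
  · rw [Function.update_of_ne hup] at hd
    exact h.queued u hu trivial hd
  · rw [Function.update_of_ne (hpq a ha)]
    exact (h.only a ha).2

/-- At the end all nodes have been queued. -/
theorem complete {root : ℕ} {A : ℕ → Finset ℕ} (T : AncTree n root par A)
    (h : Queue n par (fun _ => True) ord deg q q) : q = n := by
  have hall : ∀ v < n, ∃ a < q, ord a = v := by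
    by_contra! hne
    -- Take an unqueued node of greatest depth, measured by its number of ancestors. Its degree is
    -- not zero, so it has an unqueued child, which is deeper.
    have hex : ∃ k v, v < n ∧ (∀ a < q, ord a ≠ v) ∧ n - (A v).card = k := by
      obtain ⟨v, hv, hno⟩ := hne
      exact ⟨_, v, hv, hno, rfl⟩
    classical
    obtain ⟨v, hv, hno, hk⟩ := Nat.find_spec hex
    have hd : deg v ≠ 0 := fun hd => by
      obtain ⟨a, ha, e⟩ := h.queued v hv trivial hd
      exact hno a ha e
    rw [h.count, Ne, childCount_eq_zero] at hd
    push Not at hd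
    obtain ⟨u, hu, hpu, hne⟩ := hd
    rw [Finset.mem_sdiff, Finset.mem_range, mem_firsts] at hu
    push Not at hu
    have hur : u ≠ root := by
      rintro rfl
      exact hne (by rw [← hpu, T.par_root])
    have hlt := T.card_par_lt hu.1 hur
    have hle : (A u).card ≤ n := by
      have : A u ⊆ Finset.range n := fun x hx => Finset.mem_range.2 (T.anc_lt hu.1 hx)
      simpa using Finset.card_le_card this
    rw [hpu] at hlt
    have hmin := Nat.find_min' hex ⟨u, hu.1, hu.2, rfl⟩
    rw [← hk] at hmin
    omega
  refine le_antisymm h.length_le ?_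
  have : Finset.range n ⊆ firsts ord q := fun v hv => by
    obtain ⟨a, ha, e⟩ := hall v (Finset.mem_range.1 hv)
    exact mem_firsts.2 ⟨a, ha, e⟩
  have h1 := Finset.card_le_card this
  have h2 : (firsts ord q).card ≤ q := by
    simpa [firsts] using Finset.card_image_le (s := Finset.range q) (f := ord)
  simp only [Finset.card_range] at h1
  omega

end Queue

/-- In the queue invariant, `X` is the set of nodes already scanned: a leaf is required to be queued
only once the scan has passed it. -/
theorem collectProg_spec {n c : ℕ} {σ : State} (hn : σ.nvar 0 = n) 
    (hdeg : ∀ p, σ.narr 2 p = childCount (σ.narr 0) (Finset.range n) p) (d : ℕ)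
    (hc : 30 * n + 10 + d ≤ c) :
    WP collectProg (fun τ c' => d ≤ c' ∧ τ.nvar 0 = n ∧ τ.rvar = σ.rvar ∧ τ.rarr = σ.rarr ∧
      (∀ a, a ≠ 3 → τ.narr a = σ.narr a) ∧
      Queue n (σ.narr 0) (fun _ => True) (τ.narr 3) (τ.narr 2) 0 (τ.nvar 13)) σ c := by
  refine WP.seq (WP.block (by simp) (30 * n + 8 + d) (by simp; omega) ?_)
  refine WP.seq (WP.block (by simp) (30 * n + 6 + d) (by simp; omega) ?_)
  refine WP.loop (fun τ c' => ∃ i ≤ n, τ.nvar 10 = i ∧ τ.nvar 0 = n ∧ τ.rvar = σ.rvar ∧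
    τ.rarr = σ.rarr ∧ (∀ a, a ≠ 3 → τ.narr a = σ.narr a) ∧
    Queue n (σ.narr 0) (· < i) (τ.narr 3) (τ.narr 2) 0 (τ.nvar 13) ∧
    30 * (n - i) + 6 + d ≤ c') ?_
    ⟨0, by omega, by simp, by simp [hn], rfl, rfl, fun _ _ => rfl,
      ⟨by simp, by simp, by simp, ?_, by simp, by simp, by simp⟩, by simp⟩
  · rintro τ c ⟨i, hi, e10, e0, hrv, hra, hna, hQ, hc⟩
    by_cases hlt : i < n
    · left
      refine ⟨by simp [e10, e0, hlt.ne], 30 * (n - i) + d, by simp; omega, ?_⟩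
      refine WP.block (by simp) (30 * (n - (i + 1)) + 6 + d) (by simp; omega) ?_
      by_cases hd : τ.narr 2 i = 0
      · refine ⟨i + 1, hlt, ?_⟩
        simp only [Prog.run, Test.Holds, NExpr.eval, e10, hd, if_true]
        refine ⟨by simp [e10], by simp [e0], by simp [hrv], by simp [hra], fun a ha => by
          simp [ha, hna], ?_, le_rfl⟩
        simpa using hQ.push (v := i) (X' := (· < i + 1)) hlt (fun u => by omega) hd fun a ha e => by
          have := (hQ.only a ha).1
          omega
      · refine ⟨i + 1, hlt, ?_⟩
        simp only [Prog.run, Test.Holds, NExpr.eval, e10, hd, if_false]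
        refine ⟨by simp [e10], by simp [e0], by simp [hrv], by simp [hra], fun a ha => by
          simp [ha, hna], ?_, le_rfl⟩
        refine ⟨hQ.le, hQ.lt, hQ.inj, hQ.count, fun v hv hvi h0 => hQ.queued v hv ?_ h0, fun a ha =>
          ⟨Nat.lt_succ_of_lt (hQ.only a ha).1, (hQ.only a ha).2⟩, hQ.early⟩
        have : v ≠ i := by rintro rfl; exact hd h0
        have : v < i + 1 := hvi
        omega
    · right
      have : i = n := by omega
      subst this
      exact ⟨by simp [e10, e0], d, by simp; omega, le_rfl, e0, hrv, hra, hna, hQ.le, hQ.lt, hQ.inj,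
        hQ.count, fun v hv _ => hQ.queued v hv hv, fun a ha => ⟨trivial, (hQ.only a ha).2⟩, hQ.early⟩
  · intro p
    simp [hdeg, firsts]

/-- Counting down untreated children, each round treats one queue entry and queues its parent when
the last child is done. The final queue has length `n` because a nonempty set of unqueued nodes
would contain one without untreated children. -/
theorem sortProg_spec {n c root : ℕ} {σ : State} {A : ℕ → Finset ℕ}
    (T : AncTree n root (σ.narr 0) A) (hn : σ.nvar 0 = n)
    (hQ : Queue n (σ.narr 0) (fun _ => True) (σ.narr 3) (σ.narr 2) 0 (σ.nvar 13)) (d : ℕ)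
    (hc : 50 * n + 10 + d ≤ c) :
    WP sortProg (fun τ c' => d ≤ c' ∧ τ.nvar 0 = n ∧ τ.rvar = σ.rvar ∧ τ.rarr = σ.rarr ∧
      (∀ a, a ≠ 2 → a ≠ 3 → τ.narr a = σ.narr a) ∧
      Queue n (σ.narr 0) (fun _ => True) (τ.narr 3) (τ.narr 2) n n) σ c := by
  refine WP.seq (WP.block (by simp) (50 * n + 8 + d) (by simp; omega) ?_)
  refine WP.loop (fun τ c' => ∃ i, τ.nvar 10 = i ∧ τ.nvar 0 = n ∧ τ.rvar = σ.rvar ∧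
    τ.rarr = σ.rarr ∧ (∀ a, a ≠ 2 → a ≠ 3 → τ.narr a = σ.narr a) ∧
    Queue n (σ.narr 0) (fun _ => True) (τ.narr 3) (τ.narr 2) i (τ.nvar 13) ∧
    50 * (n - i) + 8 + d ≤ c') ?_
    ⟨0, by simp, by simp [hn], rfl, rfl, fun _ _ _ => rfl, by simpa using hQ, by simp⟩
  rintro τ c ⟨i, e10, e0, hrv, hra, hna, hQ, hc⟩
  have hqn := hQ.length_le
  have hle := hQ.le
  have ep : τ.narr 0 = σ.narr 0 := hna 0 (by norm_num) (by norm_num)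
  by_cases hlt : i < τ.nvar 13
  · left
    refine ⟨by simp [e10, hlt.ne], 50 * (n - i) + d, by simp; omega, ?_⟩
    refine WP.block (by simp) (50 * (n - (i + 1)) + 8 + d) (by simp; omega) ?_
    set v := τ.narr 3 i with hv
    refine ⟨i + 1, ?_⟩
    by_cases hroot : σ.narr 0 v = v
    · refine ⟨by simp [e10, ep, ← hv, hroot], by simp [e10, ep, ← hv, hroot, e0],
        by simp [e10, ep, ← hv, hroot, hrv], by simp [e10, ep, ← hv, hroot, hra], fun a h1 h2 => by
          simp [e10, ep, ← hv, hroot, h1, h2, hna], ?_, le_rfl⟩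
      simpa [e10, ep, ← hv, hroot] using hQ.skip hlt hroot
    · have hD := hQ.decrease hlt hroot
      rw [← hv] at hD
      set p := σ.narr 0 v with hp
      have hpn : p < n := T.par_lt v (hQ.lt i hlt)
      by_cases hz : τ.narr 2 p - 1 = 0
      · refine ⟨by simp [e10, ep, ← hv, ← hp, hroot, hz], by simp [e10, ep, ← hv, ← hp, hroot, hz, e0],
          by simp [e10, ep, ← hv, ← hp, hroot, hz, hrv], by simp [e10, ep, ← hv, ← hp, hroot, hz, hra],
          fun a h1 h2 => by simp [e10, ep, ← hv, ← hp, hroot, hz, h1, h2, hna], ?_, le_rfl⟩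
        have := hD.push (v := p) (X' := fun _ => True) hpn (fun u => by simp [em']) (by simpa using hz)
          fun a ha => (hD.only a ha).1
        simpa [e10, ep, ← hv, ← hp, hroot, hz] using this
      · refine ⟨by simp [e10, ep, ← hv, ← hp, hroot, hz], by simp [e10, ep, ← hv, ← hp, hroot, hz, e0],
          by simp [e10, ep, ← hv, ← hp, hroot, hz, hrv], by simp [e10, ep, ← hv, ← hp, hroot, hz, hra],
          fun a h1 h2 => by simp [e10, ep, ← hv, ← hp, hroot, hz, h1, h2, hna], ?_, le_rfl⟩
        have : Queue n (σ.narr 0) (fun _ => True) (τ.narr 3)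
            (Function.update (τ.narr 2) p (τ.narr 2 p - 1)) (i + 1) (τ.nvar 13) := by
          refine ⟨hD.le, hD.lt, hD.inj, hD.count, fun u hu _ hd => hD.queued u hu ?_ hd, fun a ha =>
            ⟨trivial, (hD.only a ha).2⟩, hD.early⟩
          rintro rfl
          exact hz (by simpa using hd)
        simpa [e10, ep, ← hv, ← hp, hroot, hz] using this
  · right
    have hiq : τ.nvar 13 = i := by omega
    rw [hiq] at hQ
    have := hQ.complete T
    subst this
    exact ⟨by simp [e10, hiq], d, by simp; omega, le_rfl, e0, hrv, hra, hna, hQ⟩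

/-- Compute the weights of the paths to the root. -/
def weightProg : Prog :=
  .setN 10 (var 0) ;; .loop (.not (.eqN (var 10) (.const 0)))
    (.setN 10 (.pred (var 10)) ;; .setN 11 (get 3 (var 10)) ;; .setN 14 (get 0 (var 11)) ;;
      .ite (.eqN (var 14) (var 11)) (.putR 6 (var 11) (.get 0 (var 11)))
        (.putR 6 (var 11) (.add (.get 0 (var 11)) (.get 6 (var 14)))))

/-- Running through the order backwards, a parent comes before its children, so its path weight is
available when needed. -/
theorem weightProg_spec {n c root : ℕ} {σ : State} {A : ℕ → Finset ℕ}
    (T : AncTree n root (σ.narr 0) A) (hn : σ.nvar 0 = n) (hlt : ∀ i < n, σ.narr 3 i < n)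
    (hinj : ∀ i < n, ∀ j < n, σ.narr 3 i = σ.narr 3 j → i = j)
    (hpar : ∀ i < n, σ.narr 3 i ≠ root → ∃ j < n, i < j ∧ σ.narr 3 j = σ.narr 0 (σ.narr 3 i)) (d : ℕ)
    (hc : 40 * n + 10 + d ≤ c) :
    WP weightProg (fun τ c' => d ≤ c' ∧ τ.nvar 0 = n ∧ τ.rvar = σ.rvar ∧ τ.narr = σ.narr ∧
      (∀ a, a ≠ 6 → τ.rarr a = σ.rarr a) ∧
      ∀ i < n, τ.rarr 6 (σ.narr 3 i) = ∑ y ∈ A (σ.narr 3 i), σ.rarr 0 y) σ c := by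
  refine WP.seq (WP.block (by simp) (40 * n + 8 + d) (by simp; omega) ?_)
  refine WP.loop (fun τ c' => ∃ i ≤ n, τ.nvar 10 = i ∧ τ.nvar 0 = n ∧ τ.rvar = σ.rvar ∧
    τ.narr = σ.narr ∧ (∀ a, a ≠ 6 → τ.rarr a = σ.rarr a) ∧
    (∀ j < n, i ≤ j → τ.rarr 6 (σ.narr 3 j) = ∑ y ∈ A (σ.narr 3 j), σ.rarr 0 y) ∧
    40 * i + 8 + d ≤ c') ?_
    ⟨n, le_rfl, by simp [hn], by simp [hn], rfl, rfl, fun _ _ => rfl, fun j h1 h2 => by omega, le_rfl⟩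
  rintro τ c ⟨i, hi, e10, e0, hrv, hna, hra, hW, hc⟩
  by_cases hz : i = 0
  · right
    subst hz
    exact ⟨by simp [e10], d, by simp; omega, le_rfl, e0, hrv, hna, hra, fun j hj => hW j hj (by omega)⟩
  · left
    obtain ⟨k, rfl⟩ : ∃ k, i = k + 1 := ⟨i - 1, by omega⟩
    refine ⟨by simp [e10], 40 * (k + 1) + d, by simp; omega, ?_⟩
    refine WP.block (by simp) (40 * k + 8 + d) (by simp; omega) ⟨k, by omega, ?_⟩
    set v := σ.narr 3 k with hv
    have hvn : v < n := hlt k (by omega)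
    have hnew : ∀ x, x = ∑ y ∈ A v, σ.rarr 0 y → ∀ j < n, k ≤ j →
        Function.update (τ.rarr 6) v x (σ.narr 3 j) = ∑ y ∈ A (σ.narr 3 j), σ.rarr 0 y := by
      intro x hx j hj hkj
      by_cases e : j = k
      · subst e
        rw [← hv, Function.update_self, hx]
      · rw [Function.update_of_ne fun h => e (hinj j hj k (by omega) h), hW j hj (by omega)]
    by_cases hroot : v = root
    · have hpv : σ.narr 0 v = v := by rw [hroot, T.par_root]
      refine ⟨by simp [e10, hna, ← hv, hpv], by simp [e10, hna, ← hv, hpv, e0],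
        by simp [e10, hna, ← hv, hpv, hrv], by simp [e10, hna, ← hv, hpv], fun a ha => by
          simp [e10, hna, ← hv, hpv, ha, hra], ?_, le_rfl⟩
      have := hnew (σ.rarr 0 v) (by rw [hroot, T.anc_root, Finset.sum_singleton])
      simpa [e10, hna, ← hv, hpv, hra] using this
    · have hpv : σ.narr 0 v ≠ v := T.par_ne hvn hroot
      refine ⟨by simp [e10, hna, ← hv, hpv], by simp [e10, hna, ← hv, hpv, e0],
        by simp [e10, hna, ← hv, hpv, hrv], by simp [e10, hna, ← hv, hpv], fun a ha => by
          simp [e10, hna, ← hv, hpv, ha, hra], ?_, le_rfl⟩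
      have := hnew (σ.rarr 0 v + τ.rarr 6 (σ.narr 0 v)) (by
        obtain ⟨j, hj, hkj, e⟩ := hpar k (by omega) hroot
        rw [T.anc_step v hvn hroot, Finset.sum_insert (T.notMem v hvn hroot), ← e, hW j hj (by omega)])
      simpa [e10, hna, ← hv, hpv, hra] using this

/-- Everything before the main loop. -/
def prepareProg : Prog := initProg ;; collectProg ;; sortProg ;; weightProg

theorem prepareProg_spec {n c root : ℕ} {σ : State} {A : ℕ → Finset ℕ}
    (T : AncTree n root (σ.narr 0) A) (hn : σ.nvar 0 = n)
    (hw : ∀ v < n, 0 ≤ σ.rarr 0 v) (hw₀ : ∀ v < n, σ.rarr 0 v ≤ σ.rvar 0)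
    (hz : ∀ a, a ≠ 0 → ∀ v, σ.narr a v = 0) (hzr : ∀ a, 2 ≤ a → ∀ v, σ.rarr a v = 0)
    (h1 : σ.rvar 1 = 0) (d : ℕ) (hc : 170 * n + 40 + d ≤ c) :
    WP prepareProg (fun τ c' => d ≤ c' ∧ τ.nvar 0 = n ∧ τ.narr 1 = σ.narr 1 ∧
      ∃ P : ChainData, P.n = n ∧ P.root = root ∧ P.par = σ.narr 0 ∧ P.A = A ∧ P.w = σ.rarr 0 ∧
        P.s = σ.rarr 1 ∧ P.w₀ = σ.rvar 0 ∧
        MainInv P 0 τ (fun _ => nil) (fun _ => nil) (fun _ => nil) (fun _ => [])) σ c := by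
  refine WP.seq (WP.mono (initProg_spec hn (hz 2 (by norm_num)) (120 * n + 30 + d) (by omega)) ?_)
  rintro σ1 c1 ⟨hc1, hS⟩
  have f1 : ∀ a, a ≠ 2 → a ≠ 7 → a ≠ 13 → a ≠ 17 → a ≠ 21 → σ1.narr a = σ.narr a := hS.narr
  have p1 : σ1.narr 0 = σ.narr 0 := f1 0 (by norm_num) (by norm_num) (by norm_num) (by norm_num)
    (by norm_num)
  refine WP.seq (WP.mono (collectProg_spec hS.size (by rw [p1]; exact hS.deg) (90 * n + 20 + d)
    (by omega)) ?_)
  rintro σ2 c2 ⟨hc2, n2, rv2, ra2, f2, Q2⟩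
  have p2 : σ2.narr 0 = σ.narr 0 := (f2 0 (by norm_num)).trans p1
  refine WP.seq (WP.mono (sortProg_spec (σ := σ2) (by rw [p2]; exact T) n2 (by rw [p2, ← p1]; exact Q2)
    (40 * n + 10 + d) (by omega)) ?_)
  rintro σ3 c3 ⟨hc3, n3, rv3, ra3, f3, Q3⟩
  have p3 : σ3.narr 0 = σ.narr 0 := (f3 0 (by norm_num) (by norm_num)).trans p2
  rw [p2] at Q3
  have hex : ∀ v < n, ∃ j < n, σ3.narr 3 j = v := fun v hv => by
    have hsub : firsts (σ3.narr 3) n ⊆ Finset.range n := fun x hx => by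
      obtain ⟨a, ha, rfl⟩ := mem_firsts.1 hx
      exact Finset.mem_range.2 (Q3.lt a ha)
    have hcard : (firsts (σ3.narr 3) n).card = n := by
      rw [firsts, Finset.card_image_of_injOn, Finset.card_range]
      intro a ha b hb e
      exact Q3.inj a (by simpa using ha) b (by simpa using hb) e
    have := Finset.eq_of_subset_of_card_le hsub (by rw [hcard, Finset.card_range])
    exact mem_firsts.1 (by rw [this]; exact Finset.mem_range.2 hv)
  have hpar : ∀ i < n, σ3.narr 3 i ≠ root →
      ∃ j < n, i < j ∧ σ3.narr 3 j = σ.narr 0 (σ3.narr 3 i) := by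
    intro i hi hr
    have hvn := Q3.lt i hi
    obtain ⟨j, hj, e⟩ := hex _ (T.par_lt _ hvn)
    obtain ⟨a, ha, e'⟩ := Q3.early j hj _ hvn e.symm (by rw [e]; exact (T.par_ne hvn hr).symm)
    have := Q3.inj a (by omega) i hi e'
    exact ⟨j, hj, by omega, e⟩
  refine WP.mono (weightProg_spec (σ := σ3) (by rw [p3]; exact T) n3 Q3.lt Q3.inj
    (by rw [p3]; exact hpar) d (by omega)) ?_
  rintro τ c4 ⟨hc4, n4, rv4, na4, ra4, hW⟩
  have fa : ∀ a, a ≠ 2 → a ≠ 3 → τ.narr a = σ1.narr a := fun a h2 h3 => by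
    rw [na4, f3 a h2 h3, f2 a h3]
  have fr : ∀ a, a ≠ 6 → τ.rarr a = σ.rarr a := fun a h6 => by
    rw [ra4 a h6, ra3, ra2, hS.rarr]
  have frv : τ.rvar = σ.rvar := by rw [rv4, rv3, rv2, hS.rvar]
  have ra0 : σ3.rarr 0 = σ.rarr 0 := by rw [ra3, ra2, hS.rarr]
  rw [ra0] at hW
  refine ⟨hc4, n4, ?_, ⟨n, root, σ.narr 0, A, σ.rarr 0, σ.rarr 1, τ.rarr 6, σ.rvar 0, σ3.narr 3,
    T, hw, hw₀, fun v hv => ?_, Q3.lt, Q3.inj, hpar⟩, rfl, rfl, rfl, rfl, rfl, rfl, rfl, ?_⟩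
  · rw [fa 1 (by norm_num) (by norm_num), f1 1 (by norm_num) (by norm_num) (by norm_num)
      (by norm_num) (by norm_num)]
  · obtain ⟨j, hj, rfl⟩ := hex v hv
    exact hW j hj
  have hnil : HeapFamily n fun _ => nil := ⟨fun _ => by simp [Leftist], by simp [nodes], by simp [nodes],
    by simp [nodes]⟩
  have hheap : ∀ k, k = 0 ∨ k = 4 ∨ k = 8 → (∀ v < n, σ1.narr (k + 13) v = n) →
      HeapsAt n k τ fun _ => nil := by
    intro k hk hr
    refine ⟨hnil, n4, ?_, fun r hrn => ?_⟩
    · rw [fa _ (by omega) (by omega), f1 _ (by omega) (by omega) (by omega) (by omega) (by omega),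
        hz _ (by omega)]
    · rw [fa _ (by omega) (by omega), hr r hrn]
      simp [State.HStored, Stored, n4]
  refine MainInv.of_empty ⟨?_, ?_, ?_, ?_, ?_, rfl, ?_, ?_, ?_⟩ ?_ ?_ ?_ ?_
  · rw [fa 0 (by norm_num) (by norm_num), p1]
  · rw [na4]
  · rw [frv]
  · exact fr 0 (by norm_num)
  · exact fr 1 (by norm_num)
  · exact hheap 0 (by norm_num) hS.heapM
  · exact hheap 4 (by norm_num) hS.heapO
  · exact hheap 8 (by norm_num) hS.heapI
  · intro v _
    rw [fr 2 (by norm_num), hzr 2 (by norm_num)]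
  · intro v _
    rw [fr 4 (by norm_num), hzr 4 (by norm_num)]
  · intro v hv
    rw [fa 7 (by norm_num) (by norm_num), hS.last v hv]
  · rw [frv, h1]

end RAM

/-! ## Reading off the chains -/

namespace AncTree

variable {n root : ℕ} {par : ℕ → ℕ} {A : ℕ → Finset ℕ}

theorem pathSet_step (T : AncTree n root par A) {v y : ℕ} (hy : y < n) (h : v ∈ A y) (hne : y ≠ v) :
    pathSet A v y = insert y (pathSet A v (par y)) ∧ y ∉ pathSet A v (par y) := by
  have hr : y ≠ root := by
    rintro rfl
    rw [T.anc_root, Finset.mem_singleton] at h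
    exact hne h.symm
  have h1 := T.notMem y hy hr
  unfold pathSet
  refine ⟨?_, fun hh => h1 (Finset.mem_filter.1 hh).1⟩
  rw [T.anc_step y hy hr, Finset.filter_insert, if_pos h]

end AncTree

namespace RAM

open NExpr

/-- Label the path from the node in variable `12` to that in variable `11`. -/
def markProg : Prog :=
  .loop (.not (.eqN (var 12) (var 11)))
    (.putN 1 (var 12) (succ (var 11)) ;; .setN 12 (get 0 (var 12))) ;;
  .putN 1 (var 11) (succ (var 11))

/-- While climbing, the labelled part of the path consists of its nodes that are not ancestors of
the current node. Labels are `v + 1`, so that `0` means unlabelled. -/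
theorem markProg_spec {n root v u c : ℕ} {σ : State} {A : ℕ → Finset ℕ}
    (T : AncTree n root (σ.narr 0) A) (h11 : σ.nvar 11 = v) (h12 : σ.nvar 12 = u)
    (hu : u < n) (hvu : v ∈ A u) (d : ℕ) (hc : 20 * (pathSet A v u).card + 20 + d ≤ c) :
    WP markProg (fun τ c' => d ≤ c' ∧ (∀ x, x ≠ 12 → τ.nvar x = σ.nvar x) ∧ τ.rvar = σ.rvar ∧
      τ.rarr = σ.rarr ∧ (∀ a, a ≠ 1 → τ.narr a = σ.narr a) ∧
      ∀ z, τ.narr 1 z = if z ∈ pathSet A v u then v + 1 else σ.narr 1 z) σ c := by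
  refine WP.seq (WP.loop (fun τ c' => ∃ y, τ.nvar 12 = y ∧ y ∈ pathSet A v u ∧
    (∀ x, x ≠ 12 → τ.nvar x = σ.nvar x) ∧ τ.rvar = σ.rvar ∧
      τ.rarr = σ.rarr ∧ (∀ a, a ≠ 1 → τ.narr a = σ.narr a) ∧
      (∀ z, τ.narr 1 z = if z ∈ pathSet A v u ∧ z ∉ A y then v + 1 else σ.narr 1 z) ∧
      20 * (pathSet A v y).card + 20 + d ≤ c') ?_
      ⟨u, h12, T.mem_pathSet_bot hu hvu, fun _ _ => rfl, rfl, rfl, fun _ _ => rfl, fun z => ?_, hc⟩)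
  · clear hc c
    rintro τ c ⟨y, e12, hy, hnv, hrv, hra, hna, hL, hc⟩
    have e11 : τ.nvar 11 = v := by rw [hnv 11 (by norm_num), h11]
    have hy' := Finset.mem_filter.1 hy
    have hyn := T.anc_lt hu hy'.1
    have e0 : τ.narr 0 = σ.narr 0 := hna 0 (by norm_num)
    by_cases hyv : y = v
    · right
      subst hyv
      refine ⟨by simp [e11, e12], 10 + d, by simp only [Test.cost, NExpr.cost]; omega, ?_⟩
      refine WP.block (by simp) d (by simp) ⟨le_rfl, ?_, ?_, ?_, ?_, fun z => ?_⟩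
      · intro x hx
        simp [hnv x hx]
      · simp [hrv]
      · simp [hra]
      · intro a ha
        simp [ha, hna]
      · by_cases hzy : z = y
        · subst hzy
          simp [e11, hy]
        · have hiff : z ∈ pathSet A y u ∧ z ∉ A y ↔ z ∈ pathSet A y u := by
            refine and_iff_left_of_imp fun hz hz' => hzy ?_
            exact T.anc_antisymm hyn hz' (Finset.mem_filter.1 hz).2
          simp [e11, hzy, hL, hiff]
    · left
      obtain ⟨hs, hnot⟩ := T.pathSet_step hyn hy'.2 hyv
      rw [hs, Finset.card_insert_of_notMem hnot] at hc
      have hr : y ≠ root := by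
        rintro rfl
        have := hy'.2
        rw [T.anc_root, Finset.mem_singleton] at this
        exact hyv this.symm
      refine ⟨by simp [e11, e12, hyv], 20 * (pathSet A v (σ.narr 0 y)).card + 30 + d,
        by simp; omega, ?_⟩
      refine WP.block (by simp) (20 * (pathSet A v (σ.narr 0 y)).card + 20 + d) (by simp; omega)
        ⟨σ.narr 0 y, ?_, ?_, ?_, ?_, ?_, ?_, fun z => ?_, le_rfl⟩
      · simp [e12, e0]
      · refine Finset.mem_filter.2 ⟨T.anc_subset hu hy'.1 (T.par_mem hyn), ?_⟩
        exact T.mem_par_of_ne hyn hy'.2 (Ne.symm hyv)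
      · intro x hx
        simp [hx, hnv x hx]
      · simp [hrv]
      · simp [hra]
      · intro a ha
        simp [ha, hna]
      · by_cases hzy : z = y
        · subst hzy
          simp [e11, e12, hy, T.notMem z hyn hr]
        · simp [e11, e12, hzy, hL, T.anc_step y hyn hr]
  · rw [if_neg]
    rintro ⟨h1, h2⟩
    exact h2 (Finset.mem_filter.1 h1).1

/-- Label the chains from the root towards the leaves. -/
def labelProg : Prog :=
  .setN 10 (var 0) ;; .loop (.not (.eqN (var 10) (.const 0)))
    (.setN 10 (.pred (var 10)) ;; .setN 11 (get 3 (var 10)) ;;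
      .ite (.eqN (get 1 (var 11)) (.const 0)) (.setN 12 (get 5 (var 11)) ;; markProg) .skip)

/-- `L` labels the union of the chains from some `v` down to `ch v`, with `v + 1`, where the `v` come
last in the order. -/
structure Labelled (P : ChainData) (ch : ℕ → ℕ) (i : ℕ) (L : ℕ → ℕ) : Prop where
  top : ∀ y < P.n, L y ≠ 0 → ∃ j < P.n, i ≤ j ∧ y ∈ pathSet P.A (P.ord j) (ch (P.ord j)) ∧
    ∀ z ∈ pathSet P.A (P.ord j) (ch (P.ord j)), L z = P.ord j + 1
  done : ∀ j < P.n, i ≤ j → L (P.ord j) ≠ 0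

/-- Why the selected paths are disjoint. If a node of the new path lay on an earlier one with top
`P.ord j`, both tops would be its ancestors and hence comparable. Either `P.ord i` lies on the
earlier path and is already labelled, or `P.ord j` lies below `P.ord i`, against the order of
treatment. -/
theorem Labelled.unlabelled {P : ChainData} {ch : ℕ → ℕ} {i : ℕ} {L : ℕ → ℕ}
    (h : Labelled P ch (i + 1) L) (hi : i < P.n) (hch : ∀ v < P.n, ch v < P.n ∧ v ∈ P.A (ch v))
    (h0 : L (P.ord i) = 0) : ∀ y ∈ pathSet P.A (P.ord i) (ch (P.ord i)), L y = 0 := by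
  intro y hy
  by_contra hne
  have hv := P.ord_lt i hi
  have hy' := Finset.mem_filter.1 hy
  have hyn := P.tree.anc_lt (hch _ hv).1 hy'.1
  obtain ⟨j, hj, hij, hyj, hall⟩ := h.top y hyn hne
  have hyj' := Finset.mem_filter.1 hyj
  have hc := hch _ (P.ord_lt j hj)
  rcases P.tree.anc_total hyn hyj'.2 hy'.2 with h1 | h1
  · have := hall (P.ord i) (Finset.mem_filter.2 ⟨P.tree.anc_subset hc.1 hyj'.1 hy'.2, h1⟩)
    omega
  · have := ChainData.ord_le_of_anc hj hi h1
    omega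

theorem Labelled.step {P : ChainData} {ch : ℕ → ℕ} {i : ℕ} {L L' : ℕ → ℕ}
    (h : Labelled P ch (i + 1) L) (hi : i < P.n) (hch : ∀ v < P.n, ch v < P.n ∧ v ∈ P.A (ch v))
    (h0 : L (P.ord i) = 0) (hL : ∀ z, L' z =
      if z ∈ pathSet P.A (P.ord i) (ch (P.ord i)) then P.ord i + 1 else L z) :
    Labelled P ch i L' := by
  have hun := h.unlabelled hi hch h0
  have hv := P.ord_lt i hi
  refine ⟨fun y hy hne => ?_, fun j hj hij => ?_⟩
  · by_cases hm : y ∈ pathSet P.A (P.ord i) (ch (P.ord i))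
    · exact ⟨i, hi, le_rfl, hm, fun z hz => by rw [hL, if_pos hz]⟩
    · rw [hL, if_neg hm] at hne
      obtain ⟨j, hj, hij, hyj, hall⟩ := h.top y hy hne
      refine ⟨j, hj, by omega, hyj, fun z hz => ?_⟩
      rw [hL, if_neg, hall z hz]
      intro hz'
      have h1 := hall z hz
      rw [hun z hz'] at h1
      omega
  · rw [hL]
    split_ifs with hm
    · omega
    · refine h.done j hj ?_
      rcases hij.lt_or_eq with h1 | rfl
      · exact h1
      · exact absurd (P.tree.mem_pathSet_top (hch _ hv).1 (hch _ hv).2) hm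

/-- The nodes that have no label. -/
def unlabelled (n : ℕ) (L : ℕ → ℕ) : Finset ℕ := (Finset.range n).filter fun y => L y = 0

/-- A path is marked only if all its nodes are unlabelled, so 20 credits per unlabelled node pay for
all the marking; the other 50 of the 70 pay for the scan. -/
theorem labelProg_spec {P : ChainData} {σ : State} {c : ℕ} (hn : σ.nvar 0 = P.n)
    (hpar : σ.narr 0 = P.par) (hord : σ.narr 3 = P.ord) (hL : ∀ y < P.n, σ.narr 1 y = 0)
    (hch : ∀ v < P.n, σ.narr 5 v < P.n ∧ v ∈ P.A (σ.narr 5 v)) (d : ℕ)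
    (hc : 70 * P.n + 10 + d ≤ c) :
    WP labelProg (fun τ c' => d ≤ c' ∧ τ.rvar = σ.rvar ∧
      Labelled P (σ.narr 5) 0 (τ.narr 1)) σ c := by
  refine WP.seq (WP.block (by simp) (70 * P.n + 8 + d) (by simp; omega) ?_)
  have hcard : ∀ L, (unlabelled P.n L).card ≤ P.n := fun L => by
    simpa [unlabelled] using Finset.card_filter_le (Finset.range P.n) fun y => L y = 0
  refine WP.loop (fun τ c' => ∃ i ≤ P.n, τ.nvar 10 = i ∧ τ.rvar = σ.rvar ∧
    (∀ a, a ≠ 1 → τ.narr a = σ.narr a) ∧ Labelled P (σ.narr 5) i (τ.narr 1) ∧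
    50 * i + 20 * (unlabelled P.n (τ.narr 1)).card + 8 + d ≤ c') ?_
    ⟨P.n, le_rfl, by simp [hn], rfl, fun _ _ => rfl, ⟨fun y hy hne => absurd (hL y hy) hne,
      fun j h1 h2 => by omega⟩, ?_⟩
  · clear hc c
    rintro τ c ⟨i, hi, e10, hrv, hna, hI, hc⟩
    by_cases hz : i = 0
    · right
      subst hz
      exact ⟨by simp [e10], d, by simp; omega, le_rfl, hrv, hI⟩
    left
    obtain ⟨k, rfl⟩ : ∃ k, i = k + 1 := ⟨i - 1, by omega⟩
    set N := 20 * (unlabelled P.n (τ.narr 1)).card with hN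
    refine ⟨by simp [e10], 50 * k + 50 + N + d, by simp; omega, ?_⟩
    refine WP.seq (WP.block (by simp) (50 * k + 47 + N + d) (by simp; omega) ?_)
    refine WP.seq (WP.block (by simp) (50 * k + 44 + N + d) (by simp; omega) ?_)
    have e3 : τ.narr 3 = P.ord := by rw [hna 3 (by norm_num), hord]
    have e0 : τ.narr 0 = P.par := by rw [hna 0 (by norm_num), hpar]
    have e5 : τ.narr 5 = σ.narr 5 := hna 5 (by norm_num)
    set v := P.ord k with hv
    have hvn : v < P.n := P.ord_lt k (by omega)
    set τ1 := Prog.run (.setN 11 (get 3 (var 10))) (Prog.run (.setN 10 (.pred (var 10))) τ) with hτ1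
    have e11 : τ1.nvar 11 = v := by simp [hτ1, e10, e3, hv]
    have e10' : τ1.nvar 10 = k := by simp [hτ1, e10]
    by_cases hlab : τ.narr 1 v = 0
    · refine WP.ite_true (d := 50 * k + 38 + N + d) (by simp [e11]; simp [hτ1, hlab])
        (by simp; omega) ?_
      refine WP.seq (WP.block (by simp) (50 * k + 35 + N + d) (by simp; omega) ?_)
      set τ2 := Prog.run (.setN 12 (get 5 (var 11))) τ1 with hτ2
      have hun := hI.unlabelled (by omega) hch hlab
      have hsub : pathSet P.A v (σ.narr 5 v) ⊆ unlabelled P.n (τ.narr 1) := fun y hy =>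
        Finset.mem_filter.2 ⟨Finset.mem_range.2 (P.tree.anc_lt (hch v hvn).1
          (Finset.mem_filter.1 hy).1), hun y hy⟩
      have hle := Finset.card_le_card hsub
      have f2 : τ2.narr = τ.narr := by simp [hτ2, hτ1]
      refine WP.mono (markProg_spec (n := P.n) (root := P.root) (A := P.A) (v := v) (u := σ.narr 5 v)
        (by rw [f2, e0]; exact P.tree) (by simp [hτ2, e11])
        (by simp [hτ2, e11]; simp [hτ1, e5]) (hch v hvn).1 (hch v hvn).2
        (50 * k + (N - 20 * (pathSet P.A v (σ.narr 5 v)).card) + 8 + d) (by omega)) ?_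
      rintro υ c' ⟨hc', hnv, hrv', -, hna', hL'⟩
      rw [f2] at hL'
      have hstep := hI.step (by omega) hch hlab hL'
      refine ⟨k, by omega, ?_, ?_, fun a ha => ?_, hstep, ?_⟩
      · rw [hnv 10 (by norm_num)]
        simp [hτ2, e10']
      · rw [hrv', ← hrv]
        simp [hτ2, hτ1]
      · rw [hna' a ha, f2, hna a ha]
      · have hsub' : unlabelled P.n (υ.narr 1) ⊆
            unlabelled P.n (τ.narr 1) \ pathSet P.A v (σ.narr 5 v) := by
          intro y hy
          rw [unlabelled, Finset.mem_filter, hL'] at hy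
          rw [Finset.mem_sdiff, unlabelled, Finset.mem_filter]
          split_ifs at hy with hm
          · exact hy.2.elim
          · exact ⟨hy, hm⟩
        have h1 := Finset.card_le_card hsub'
        rw [Finset.card_sdiff_of_subset hsub] at h1
        omega
    · refine WP.ite_false (d := 50 * k + 38 + N + d) (by simp [e11]; simp [hτ1, hlab])
        (by simp; omega) ?_
      refine WP.block (by simp) (50 * k + N + 8 + d) (by simp; omega)
        ⟨k, by omega, e10', by simp [hτ1, hrv], fun a ha => by simp [hτ1, hna a ha], ?_, ?_⟩
      · simp only [Prog.run, hτ1, State.narr_setN]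
        refine ⟨fun y hy hne => ?_, fun j hj hij => ?_⟩
        · obtain ⟨j, hj, h1, h2⟩ := hI.top y hy hne
          exact ⟨j, hj, by omega, h2⟩
        · rcases hij.lt_or_eq with h1 | rfl
          · exact hI.done j hj h1
          · exact hlab
      · simp only [Prog.run, hτ1, State.narr_setN, hN]
        exact le_rfl
  · have := hcard (σ.narr 1)
    simp only [Prog.run, State.narr_setN]
    omega

end RAM

/-! ## Trees on `Fin n` -/

namespace NodeTree

variable {n : ℕ} (T : NodeTree n)

/-- The parent function on natural numbers. -/
def parentNat (i : ℕ) : ℕ := if h : i < n then T.parent ⟨i, h⟩ else 0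

open Classical in
/-- The ancestors of a node, as natural numbers. -/
noncomputable def anc (v : ℕ) : Finset ℕ :=
  if h : v < n then
    (Finset.univ.filter fun u : Fin n => T.IsAncestor u ⟨v, h⟩).map Fin.valEmbedding
  else ∅

@[simp] theorem parentNat_val (v : Fin n) : T.parentNat v = T.parent v := by
  simp [parentNat]

theorem mem_anc {u v : Fin n} : (u : ℕ) ∈ T.anc v ↔ T.IsAncestor u v := by
  simp [anc, Fin.val_inj]

theorem lt_of_mem_anc {u v : ℕ} (h : u ∈ T.anc v) : u < n := by
  unfold anc at h
  split_ifs at h with hv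
  · obtain ⟨x, -, rfl⟩ := Finset.mem_map.1 h
    exact x.2
  · simp at h

theorem iterate_root (k : ℕ) : T.parent^[k] T.root = T.root :=
  Function.iterate_fixed T.parent_root k

theorem isAncestor_root {u : Fin n} : T.IsAncestor u T.root ↔ u = T.root := by
  constructor
  · rintro ⟨k, rfl⟩
    exact T.iterate_root k
  · rintro rfl
    exact ⟨0, rfl⟩

theorem isAncestor_iff {u v : Fin n} :
    T.IsAncestor u v ↔ u = v ∨ T.IsAncestor u (T.parent v) := by
  constructor
  · rintro ⟨k, rfl⟩
    cases k with
    | zero => exact .inl rfl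
    | succ k => exact .inr ⟨k, rfl⟩
  · rintro (rfl | ⟨k, rfl⟩)
    · exact ⟨0, rfl⟩
    · exact ⟨k + 1, rfl⟩

/-- A node that is its own iterated parent is periodic with some period `k + 1`. If it reaches the
root after `m` steps, then `(k + 1) * m` steps lead both back to it and to the root, where the
iteration stays. -/
theorem not_isAncestor_parent {v : Fin n} (hv : v ≠ T.root) : ¬ T.IsAncestor v (T.parent v) := by
  rintro ⟨k, hk⟩
  obtain ⟨m, hm⟩ := T.reaches_root v
  have h1 : T.parent^[k + 1] v = v := hk
  have h2 : T.parent^[(k + 1) * m] v = v := by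
    rw [Function.iterate_mul]
    exact Function.iterate_fixed h1 m
  have h3 : T.parent^[k * m + m] v = T.root := by
    rw [Function.iterate_add_apply, hm, T.iterate_root]
  rw [add_mul, one_mul, h3] at h2
  exact hv h2.symm

theorem ancTree : AncTree n T.root T.parentNat T.anc where
  root_lt := T.root.2
  par_lt v hv := by simp [parentNat, hv]
  par_root := by simp [T.parent_root]
  anc_root := by
    ext u
    constructor
    · intro hu
      lift u to Fin n using T.lt_of_mem_anc hu
      rw [mem_anc, isAncestor_root] at hu
      simp [hu]
    · intro hu
      rw [Finset.mem_singleton.1 hu, mem_anc, isAncestor_root]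
  anc_step v hv hr := by
    lift v to Fin n using hv
    ext u
    rw [Finset.mem_insert, parentNat_val]
    constructor
    · intro hu
      lift u to Fin n using T.lt_of_mem_anc hu
      rw [mem_anc, isAncestor_iff] at hu
      rwa [mem_anc, Fin.val_inj]
    · intro hu
      have hun : u < n := by
        rcases hu with rfl | hu
        · exact v.2
        · exact T.lt_of_mem_anc hu
      lift u to Fin n using hun
      rw [mem_anc, isAncestor_iff]
      rwa [mem_anc, Fin.val_inj] at hu
  notMem v hv hr := by
    lift v to Fin n using hv
    rw [parentNat_val, mem_anc]
    exact T.not_isAncestor_parent fun h => hr (by rw [h])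

theorem mem_anc_of_adj {y : ℕ} {a b : Fin n} (hab : T.graph.Adj a b) (ha : y ≠ a)
    (h : y ∈ T.anc a) : y ∈ T.anc b := by
  rw [graph, SimpleGraph.fromRel_adj] at hab
  rcases hab.2 with h1 | h1
  · have := T.ancTree.mem_par_of_ne a.2 h ha
    rwa [parentNat_val, h1] at this
  · have := T.ancTree.par_mem b.2
    rw [parentNat_val, h1] at this
    exact T.ancTree.anc_subset b.2 this h

/-- The subtree of `y` can be entered or left only through `y`, so a walk avoiding `y` stays on one
side. -/
theorem mem_anc_iff_of_walk {y : ℕ} {a b : Fin n} (p : T.graph.Walk a b)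
    (hy : ∀ x ∈ p.support, y ≠ x) : ∀ x ∈ p.support, y ∈ T.anc x ↔ y ∈ T.anc a := by
  induction p with
  | nil =>
    intro x hx
    rw [SimpleGraph.Walk.support_nil, List.mem_singleton] at hx
    rw [hx]
  | @cons a c b hab p ih =>
    intro x hx
    rw [SimpleGraph.Walk.support_cons] at hx hy
    have hca : y ∈ T.anc c ↔ y ∈ T.anc a :=
      ⟨T.mem_anc_of_adj hab.symm (hy c (by simp)), T.mem_anc_of_adj hab (hy a (by simp))⟩
    rcases List.mem_cons.1 hx with rfl | hx
    · rfl
    · rw [ih (fun z hz => hy z (List.mem_cons_of_mem _ hz)) x hx, hca]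

/-- A chain consists of the nodes on the way from its bottom to its top. -/
theorem IsChain.exists_pathSet {C : Finset (Fin n)} (h : T.IsChain C) :
    ∃ v u : Fin n, (v : ℕ) ∈ T.anc u ∧ C.map Fin.valEmbedding = pathSet T.anc v u := by
  obtain ⟨⟨a, b, p, -, hp⟩, hC⟩ := h
  have hne : C.Nonempty := ⟨a, (hp a).2 p.start_mem_support⟩
  obtain ⟨u, huC, hu⟩ := C.exists_max_image (fun x => (T.anc x).card) hne
  obtain ⟨v, hvC, hv⟩ := C.exists_min_image (fun x => (T.anc x).card) hne
  -- On a chain, ancestry is decided by the number of ancestors, so the extreme values of that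
  -- number give bottom and top.
  have hle : ∀ x ∈ C, ∀ y ∈ C, (T.anc x).card ≤ (T.anc y).card → (x : ℕ) ∈ T.anc y := by
    intro x hx y hy hxy
    rcases hC x hx y hy with h1 | h1
    · exact T.mem_anc.2 h1
    · rw [← T.mem_anc] at h1
      have := Finset.eq_of_subset_of_card_le (T.ancTree.anc_subset x.2 h1) hxy
      rw [this]
      exact T.ancTree.self_mem x.2
  have hvu := hle v hvC u huC (hv u huC)
  refine ⟨v, u, hvu, ?_⟩
  ext y
  simp only [Finset.mem_map, Fin.valEmbedding_apply, pathSet, Finset.mem_filter]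
  constructor
  · rintro ⟨x, hx, rfl⟩
    exact ⟨hle x hx u huC (hu x hx), hle v hvC x hx (hv x hx)⟩
  · rintro ⟨h1, h2⟩
    by_contra hno
    have hy : ∀ x ∈ p.support, y ≠ x := fun x hx e => hno ⟨x, (hp x).2 hx, e.symm⟩
    have h3 := T.mem_anc_iff_of_walk p hy
    -- The walk avoids `y`, so `y` would be an ancestor of the top `v` as well as of the bottom `u`;
    -- being also below `v`, it would equal `v`.
    have h4 : y ∈ T.anc v := by
      rw [h3 v ((hp v).1 hvC), ← h3 u ((hp u).1 huC)]
      exact h1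
    have := T.ancTree.anc_antisymm v.2 h4 h2
    exact hno ⟨v, hvC, this.symm⟩

/-- The walk climbs from `u` parent by parent. It is simple because a node is not on the path that
starts at its parent. -/
theorem exists_path {v u : Fin n} (h : (v : ℕ) ∈ T.anc u) :
    ∃ p : T.graph.Walk u v, p.IsPath ∧ ∀ x : Fin n, x ∈ p.support ↔ (x : ℕ) ∈ pathSet T.anc v u := by
  have key : ∀ z < n, ∀ u : Fin n, (u : ℕ) = z → (v : ℕ) ∈ T.anc u →
      ∃ p : T.graph.Walk u v, p.IsPath ∧
        ∀ x : Fin n, x ∈ p.support ↔ (x : ℕ) ∈ pathSet T.anc v u := by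
    intro z hz
    have hself : ∃ p : T.graph.Walk v v, p.IsPath ∧
        ∀ x : Fin n, x ∈ p.support ↔ (x : ℕ) ∈ pathSet T.anc v v := by
      refine ⟨.nil, by simp, fun x => ?_⟩
      rw [SimpleGraph.Walk.support_nil, List.mem_singleton]
      constructor
      · rintro rfl
        exact T.ancTree.mem_pathSet_top x.2 (T.ancTree.self_mem x.2)
      · intro hx
        have hx := Finset.mem_filter.1 hx
        exact Fin.ext (T.ancTree.anc_antisymm v.2 hx.1 hx.2)
    refine T.ancTree.induct (motive := fun z => ∀ u : Fin n, (u : ℕ) = z → (v : ℕ) ∈ T.anc u →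
      ∃ p : T.graph.Walk u v, p.IsPath ∧
        ∀ x : Fin n, x ∈ p.support ↔ (x : ℕ) ∈ pathSet T.anc v u) ?_ ?_ hz
    · intro u hu hvu
      have e : v = u := by
        rw [hu, T.ancTree.anc_root, Finset.mem_singleton, ← hu] at hvu
        exact Fin.ext hvu
      subst e
      exact hself
    · intro z hz hr ih u hu hvu
      subst hu
      by_cases e : v = u
      · subst e
        exact hself
      have hne : (u : ℕ) ≠ v := fun hh => e (Fin.ext hh.symm)
      obtain ⟨hs, hnot⟩ := T.ancTree.pathSet_step u.2 hvu hne
      have hpar := T.ancTree.mem_par_of_ne u.2 hvu hne.symm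
      rw [parentNat_val] at hs hnot hpar
      obtain ⟨p, hp, hsup⟩ := ih (T.parent u) (by simp) hpar
      have hadj : T.graph.Adj u (T.parent u) := by
        rw [graph, SimpleGraph.fromRel_adj]
        refine ⟨fun hh => T.ancTree.par_ne u.2 hr ?_, .inl rfl⟩
        rw [parentNat_val, ← hh]
      refine ⟨.cons hadj p, ?_, fun x => ?_⟩
      · rw [SimpleGraph.Walk.cons_isPath_iff]
        exact ⟨hp, fun hh => hnot ((hsup u).1 hh)⟩
      · rw [SimpleGraph.Walk.support_cons, List.mem_cons, hsup, hs, Finset.mem_insert, Fin.val_inj]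
  exact key u u.2 u rfl h

theorem isChain_of_pathSet {C : Finset (Fin n)} {v u : Fin n} (h : (v : ℕ) ∈ T.anc u)
    (hC : C.map Fin.valEmbedding = pathSet T.anc v u) : T.IsChain C := by
  have hmem : ∀ x : Fin n, x ∈ C ↔ (x : ℕ) ∈ pathSet T.anc v u := fun x => by
    rw [← hC]
    simp [Fin.val_inj]
  obtain ⟨p, hp, hsup⟩ := T.exists_path h
  refine ⟨⟨u, v, p, hp, fun x => by rw [hmem, hsup]⟩, fun x hx y hy => ?_⟩
  rw [hmem] at hx hy
  rw [← T.mem_anc, ← T.mem_anc]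
  exact T.ancTree.anc_total u.2 (Finset.mem_filter.1 hx).1 (Finset.mem_filter.1 hy).1

end NodeTree

/-! ## Optimality -/

theorem isMaxVal_map {n : ℕ} {s : ℕ → ℝ} {s' : Fin n → ℝ} (hs : ∀ i : Fin n, s i = s' i)
    {C : Finset (Fin n)} (hC : C.Nonempty) {m : ℝ} :
    IsMaxVal s (C.map Fin.valEmbedding) m ↔ C.sup' hC s' = m := by
  constructor
  · rintro ⟨h1, y, hy, rfl⟩
    obtain ⟨i, hi, rfl⟩ := Finset.mem_map.1 hy
    refine le_antisymm (Finset.sup'_le _ _ fun j hj => ?_) ?_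
    · rw [← hs]
      exact h1 _ (Finset.mem_map_of_mem Fin.valEmbedding hj)
    · rw [Fin.valEmbedding_apply, hs]
      exact Finset.le_sup' s' hi
  · rintro rfl
    refine ⟨fun y hy => ?_, ?_⟩
    · obtain ⟨i, hi, rfl⟩ := Finset.mem_map.1 hy
      rw [Fin.valEmbedding_apply, hs]
      exact Finset.le_sup' s' hi
    · obtain ⟨i, hi, e⟩ := Finset.exists_mem_eq_sup' hC s'
      exact ⟨i, Finset.mem_map_of_mem Fin.valEmbedding hi, by rw [e, hs]⟩

theorem Finpartition.sum_parts_attach {n : ℕ} (P : Finpartition (Finset.univ : Finset (Fin n)))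
    (f : Fin n → ℝ) : ∑ C ∈ P.parts.attach, ∑ x ∈ C.1, f x = ∑ x, f x := by
  rw [Finset.sum_attach P.parts fun C => ∑ x ∈ C, f x]
  conv_rhs => rw [← P.biUnion_parts]
  rw [Finset.sum_biUnion P.disjoint]
  rfl

section

variable {n : ℕ} {T : NodeTree n} {w s : ℕ → ℝ} {w' s' : Fin n → ℝ} {w₀ : ℝ} {E : ℕ → ℝ} {ch : ℕ → ℕ}

/-- Feasible values give a lower bound. -/
theorem sum_le_sumOfMax (hw : ∀ i : Fin n, w i = w' i) (hs : ∀ i : Fin n, s i = s' i)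
    (hE : ∀ v < n, PathCert n T.anc w s E w₀ v (ch v))
    {Q : Finpartition (Finset.univ : Finset (Fin n))} (hQ : T.IsChainPartition w' w₀ Q) :
    ∑ i : Fin n, E i ≤ sumOfMax s' Q := by
  rw [← Q.sum_parts_attach fun i => E i]
  refine Finset.sum_le_sum fun C _ => ?_
  obtain ⟨hC, hl⟩ := hQ C.1 C.2
  obtain ⟨v, u, hvu, e⟩ := NodeTree.IsChain.exists_pathSet T hC
  have h1 := (hE v v.2).feasible u u.2 hvu
  rw [← e, Finset.sum_map, Finset.sum_map] at h1
  simp only [Fin.valEmbedding_apply, hw] at h1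
  exact h1 hl _ ((isMaxVal_map hs (Q.nonempty_of_mem_parts C.2)).2 rfl)

open Classical in
/-- The partition given by the labels. -/
noncomputable def labelPartition (n : ℕ) (L : ℕ → ℕ) :
    Finpartition (Finset.univ : Finset (Fin n)) :=
  Finpartition.ofSetoid (Setoid.ker fun i : Fin n => L i)

open Classical in
theorem mem_part_labelPartition {L : ℕ → ℕ} {i j : Fin n} :
    j ∈ (labelPartition n L).part i ↔ L i = L j := by
  rw [labelPartition, Finpartition.mem_part_ofSetoid_iff_rel]
  rfl

theorem part_labelPartition {L : ℕ → ℕ} {i j : Fin n} :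
    (labelPartition n L).part i = (labelPartition n L).part j ↔ L i = L j := by
  rw [← Finpartition.mem_part_iff_part_eq_part _ (Finset.mem_univ _) (Finset.mem_univ _),
    mem_part_labelPartition, eq_comm]

/-- Each class of labels is one tight path, so the cost of the partition is the sum of all `E`, and
this is the lower bound of `sum_le_sumOfMax`. -/
theorem isOptimal_labelPartition (hw : ∀ i : Fin n, w i = w' i) (hs : ∀ i : Fin n, s i = s' i)
    (hE : ∀ v < n, PathCert n T.anc w s E w₀ v (ch v)) {L : ℕ → ℕ}
    (hL : ∀ y < n, ∃ t < n, y ∈ pathSet T.anc t (ch t) ∧ ∀ z ∈ pathSet T.anc t (ch t), L z = t + 1) :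
    IsOptimalPartition T w' s' w₀ (labelPartition n L) ∧
      sumOfMax s' (labelPartition n L) = ∑ i : Fin n, E i := by
  set P := labelPartition n L with hP
  have hpart : ∀ C ∈ P.parts, ∃ t < n, C.map Fin.valEmbedding = pathSet T.anc t (ch t) := by
    intro C hC
    obtain ⟨i, hi⟩ := P.nonempty_of_mem_parts hC
    obtain ⟨t, ht, hit, hall⟩ := hL i i.2
    refine ⟨t, ht, ?_⟩
    have hmem : ∀ j, j ∈ C ↔ L j = t + 1 := fun j => by
      rw [← P.part_eq_of_mem hC hi, hP, mem_part_labelPartition, hall i hit, eq_comm]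
    ext y
    rw [Finset.mem_map]
    constructor
    · rintro ⟨j, hj, rfl⟩
      rw [hmem] at hj
      obtain ⟨t', ht', hjt', hall'⟩ := hL j j.2
      have e : t' = t := by
        have := hall' j hjt'
        omega
      subst e
      exact hjt'
    · intro hy
      have hyn := T.lt_of_mem_anc (Finset.mem_filter.1 hy).1
      exact ⟨⟨y, hyn⟩, (hmem _).2 (hall y hy), rfl⟩
  have hsum : sumOfMax s' P = ∑ i : Fin n, E i := by
    rw [← P.sum_parts_attach fun i => E i]
    refine Finset.sum_congr rfl fun C _ => ?_
    obtain ⟨t, ht, e⟩ := hpart C.1 C.2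
    have h1 := (hE t ht).tight
    rw [← e, Finset.sum_map] at h1
    exact (isMaxVal_map hs _).1 h1
  refine ⟨⟨fun C hC => ?_, fun Q hQ => ?_⟩, hsum⟩
  · obtain ⟨t, ht, e⟩ := hpart C hC
    have h1 := hE t ht
    refine ⟨T.isChain_of_pathSet (v := ⟨t, ht⟩) (u := ⟨ch t, h1.lt⟩) h1.anc e, ?_⟩
    have h2 := h1.light
    rw [← e, Finset.sum_map] at h2
    simpa only [Fin.valEmbedding_apply, hw] using h2
  · rw [hsum]
    exact sum_le_sumOfMax hw hs hE hQ

end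

/-! ## The whole program -/

namespace RAM

/-- The program for the sum-of-max chain partition problem. -/
def chainProg : Prog := prepareProg ;; mainProg ;; labelProg

/-- A bound on the running time. -/
def chainTime (n : ℕ) : ℕ := 240 * n + 50 + mainTime n

theorem chainProg_solves : SolvesInTime chainProg chainTime := by
  intro n T w s w₀ hw hw₀
  set σ := input T w s w₀ with hσ
  have hpar : σ.narr 0 = T.parentNat := by
    funext i
    simp [hσ, input, NodeTree.parentNat]
  have ew : ∀ i : Fin n, σ.rarr 0 i = w i := fun i => by simp [hσ, input]
  have es : ∀ i : Fin n, σ.rarr 1 i = s i := fun i => by simp [hσ, input]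
  have e0 : σ.rvar 0 = w₀ := by simp [hσ, input]
  have hz : ∀ a, a ≠ 0 → ∀ v, σ.narr a v = 0 := fun a ha v => by simp [hσ, input, ha]
  have key : WP chainProg (fun τ _ => ∃ P, IsOptimalPartition T w s w₀ P ∧
      Outputs τ P (sumOfMax s P)) σ (chainTime n) := by
    refine WP.seq (WP.mono (prepareProg_spec (n := n) (root := T.root) (A := T.anc)
      (by rw [hpar]; exact T.ancTree) (by simp [hσ, input])
      (fun v hv => by have := ew ⟨v, hv⟩; rw [show σ.rarr 0 v = _ from this]; exact hw _)
      (fun v hv => by have := ew ⟨v, hv⟩; rw [show σ.rarr 0 v = _ from this, e0]; exact hw₀ _)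
      hz (fun a ha v => by
        have h0 : a ≠ 0 := by omega
        have h1 : a ≠ 1 := by omega
        simp [hσ, input, h0, h1])
      (by simp [hσ, input]) (70 * n + 10 + mainTime n) (by unfold chainTime; omega)) ?_)
    rintro σ1 c1 ⟨hc1, n1, l1, P, rfl, -, -, eA, eW, eS, ew₀, hI⟩
    refine WP.seq (WP.mono (mainProg_spec hI n1 (70 * P.n + 10) (by omega)) ?_)
    rintro σ2 c2 ⟨hc2, n2, l2, tM, tO, tI, cl, h2⟩
    have htr : P.treated P.n = Finset.range P.n := by
      ext v
      rw [Finset.mem_range]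
      refine ⟨ChainData.treated_lt le_rfl, fun hv => ?_⟩
      obtain ⟨j, hj, e⟩ := ChainData.exists_ord hv
      exact ChainData.mem_treated.2 ⟨j, hj, e⟩
    have hcert : ∀ v < P.n, PathCert P.n P.A P.w P.s (σ2.rarr 5) P.w₀ v (σ2.narr 5 v) :=
      fun v hv => h2.cert v (by rw [htr]; exact Finset.mem_range.2 hv)
    refine WP.mono (labelProg_spec n2 h2.par h2.ord
      (fun y _ => by rw [l2, l1]; exact hz 1 (by norm_num) y)
      (fun v hv => ⟨(hcert v hv).lt, (hcert v hv).anc⟩) 0 (by omega)) ?_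
    rintro τ c3 ⟨-, hrv, hL⟩
    have hcert' : ∀ v < P.n, PathCert P.n T.anc (σ.rarr 0) (σ.rarr 1) (σ2.rarr 5) w₀ v
        (σ2.narr 5 v) := by
      rw [← eA, ← eW, ← eS, ← e0, ← ew₀]
      exact hcert
    have hlab : ∀ y < P.n, ∃ t < P.n, y ∈ pathSet T.anc t (σ2.narr 5 t) ∧
        ∀ z ∈ pathSet T.anc t (σ2.narr 5 t), τ.narr 1 z = t + 1 := by
      intro y hy
      obtain ⟨i, hi, rfl⟩ := ChainData.exists_ord hy
      obtain ⟨j, hj, -, h3, h4⟩ := hL.top _ hy (hL.done i hi (Nat.zero_le _))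
      rw [eA] at h3 h4
      exact ⟨P.ord j, P.ord_lt j hj, h3, h4⟩
    obtain ⟨hopt, hsum⟩ := isOptimal_labelPartition ew es hcert' hlab
    refine ⟨_, hopt, fun i j => part_labelPartition.symm, ?_⟩
    rw [hsum, hrv, h2.total, htr, Finset.sum_range]
  obtain ⟨k, τ, c', hex, hk, P, hopt, hout⟩ := key
  exact ⟨k, τ, P, by omega, hex, hopt, hout⟩

theorem chainTime_isBigO :
    (fun n : ℕ => (chainTime n : ℝ)) =O[Filter.atTop] (fun n : ℕ => (n : ℝ) * Real.log n) := by
  -- A generous constant: the dominant term `13 * 200 * n * Nat.log 2 (n + 1)` is at most `10400 * n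
  -- * Real.log n` by `h4`.
  refine Asymptotics.IsBigO.of_bound 20000 ?_
  -- From 3 on, `Real.log n` is at least 1 and absorbs the linear and constant terms.
  filter_upwards [Filter.eventually_ge_atTop 3] with n hn
  have hlog1 : 1 ≤ Real.log n := by
    rw [Real.le_log_iff_exp_le (by positivity)]
    have : (3 : ℝ) ≤ n := by exact_mod_cast hn
    linarith [Real.exp_one_lt_d9]
  have hlb : ∀ m : ℕ, 0 < m → (Nat.log 2 m : ℝ) ≤ 2 * Real.log m := by
    intro m hm
    have h1 : ((2 ^ Nat.log 2 m : ℕ) : ℝ) ≤ m := by exact_mod_cast Nat.pow_log_le_self 2 hm.ne'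
    have h2 := Real.log_le_log (by positivity) h1
    rw [Nat.cast_pow, Real.log_pow] at h2
    have h3 := Real.log_two_gt_d9
    push_cast at h2
    have h4 : (0 : ℝ) ≤ Nat.log 2 m := by positivity
    nlinarith
  -- This is `n + 1 ≤ n ^ 2`.
  have hsucc : Real.log ((n + 1 : ℕ) : ℝ) ≤ 2 * Real.log n := by
    rw [← Nat.cast_two, ← Real.log_pow]
    refine Real.log_le_log (by positivity) ?_
    have : (3 : ℝ) ≤ n := by exact_mod_cast hn
    push_cast
    nlinarith
  have h1 := hlb n (by omega)
  have h2 := hlb (n + 1) (by omega)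
  have hn' : (3 : ℝ) ≤ n := by exact_mod_cast hn
  have hnl : (n : ℝ) ≤ n * Real.log n := by nlinarith
  have h3 : (n : ℝ) * Nat.log 2 n ≤ 2 * (n * Real.log n) := by nlinarith
  have h4 : (n : ℝ) * Nat.log 2 (n + 1) ≤ 4 * (n * Real.log n) := by nlinarith
  rw [Real.norm_of_nonneg (by positivity), Real.norm_of_nonneg (by nlinarith)]
  unfold chainTime mainTime heapTime
  push_cast
  nlinarith

end RAM

theorem theorem1 :
    ∃ (p : RAM.Prog) (t : ℕ → ℕ),
      RAM.SolvesInTime p t ∧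
        (fun n : ℕ => (t n : ℝ)) =O[Filter.atTop] (fun n : ℕ => (n : ℝ) * Real.log n) :=
  ⟨RAM.chainProg, RAM.chainTime, RAM.chainProg_solves, RAM.chainTime_isBigO⟩
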